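/- Let $\mathbb F$ be a quadratically closed field of characteristic zero and let $0\neq q\in\mathbb F$ be not a root of unity. Put $[n]_q=\frac{q^n-q^{-n}}{q-q^{-1}}$ for $n\in\mathbb Z$ and $[n]_q^!=[n]_q\cdots[1]_q$ for $n\in\mathbb N$. Fix any square root $q^{1/2}$ of $q$ and any square roots $[n]_q^{1/2}$ of the scalars $[n]_q$ $(n\in\mathbb N)$; all half-integer powers of $q$ below are powers of $q^{1/2}$, and all square roots of products and quotients of $q$-integers below are the corresponding products and quotients of the $[n]_q^{1/2}$. Write $c(t)=t-t^{-1}$. **The $q$-shuffle algebra.** Let $\mathbb V$ be the $\mathbb F$-vector space with basis all words in two letters $x,y$. Put $\langle x,x\rangle=\langle y,y\rangle=2$, $\langle x,y\rangle=\langle y,x\rangle=-2$. The $q$-shuffle product $\star$ is the bilinear associative product on $\mathbb V$ whose unit is the trivial word and such that for nontrivial words $u=u_1\cdots u_r$, $v=v_1\cdots v_p$, $$u\star v=u_1\big((u_2\cdots u_r)\star v\big)+q^{\langle v_1,u_1\rangle+\cdots+\langle v_1,u_r\rangle}\,v_1\big(u\star(v_2\cdots v_p)\big).$$ **The K-matrix.**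 Let $\overline x=1$, $\overline y=-1$. A word $a_1\cdots a_n$ is Catalan if $\overline a_1+\cdots+\overline a_i\ge 0$ for all $i$, with equality for $i=n$; let $\mathrm{Cat}_n$ be the set of Catalan words of length $2n$. For $m\in\mathbb Z$ let $$\Delta^{(m)}(t)=\sum_{n\ge0}t^n\sum_{a_1\cdots a_{2n}\in\mathrm{Cat}_n}\ \prod_{i=1}^{2n}\big[\overline a_1+\cdots+\overline a_{i-1}+m(\overline a_i+1)/2\big]_q\ a_1\cdots a_{2n}.$$ Let $x^{-1}$ be the linear map on $\mathbb V$ that deletes the first letter of a word if that letter is $x$ and sends all other words (including the trivial one) to $0$; let right multiplication by $y^{-1}$ be the linear map that deletes the last letter of a word if that letter is $y$ and sends all other words to $0$; apply both coefficientwise to series. For $j\in\frac12\mathbb N^+$ let $K^{(j)}(t)$ be the $(2j+1)\times(2j+1)$ matrix, with entries formal Laurent series in $t$ over $\mathbb V$, given for $1\le a,b\le 2j+1$ by $$K^{(j)}_{(a,b)}(t)=\varphi(a,b,j)\,t^{a-b-2j}\,x^{1-b}\Delta^{(-2j)}(-t^2)y^{a-2j-1},\qquad \varphi(a,b,j)=\frac{q^{\rho(a,b,j)}}{[2j]_q^!}\left(\frac{[a-1]_q^!\,[2j+1-b]_q^!}{[b-1]_q^!\,[2j+1-a]_q^!}\right)^{1/2},$$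 $$\rho(a,b,j)=(a^2+b^2+6j^2+4ab-6aj-6bj-6a-6b+13j+6)/2.$$ **The R-matrix.** Tensor products of matrices are taken with the basis in lexicographic order; subscripts indicate the tensor factors on which a matrix acts. For $j\in\frac12\mathbb N^+$ let $\mathcal E^{(j+\frac12)}$ be the $(4j+2)\times(2j+2)$ matrix and $\mathcal F^{(j+\frac12)}$ the $(2j+2)\times(4j+2)$ matrix whose only nonzero entries are, for $1\le a\le 2j+1$, $$\mathcal E^{(j+\frac12)}_{(a,a)}=\left(\tfrac{[2j+2-a]_q}{[2j+1]_q}\right)^{1/2},\quad \mathcal E^{(j+\frac12)}_{(a+2j+1,a+1)}=\left(\tfrac{[a]_q}{[2j+1]_q}\right)^{1/2},$$ $$\mathcal F^{(j+\frac12)}_{(a,a)}=\frac{([2j+2-a]_q[2j+1]_q)^{1/2}}{[2j+2-a]_q+[a-1]_q},\quad \mathcal F^{(j+\frac12)}_{(a+1,a+2j+1)}=\frac{([a]_q[2j+1]_q)^{1/2}}{[2j+1-a]_q+[a]_q}.$$ Define matrices $R^{(j_1,j_2)}(t)$ of size $(2j_1+1)(2j_2+1)$ over $\mathbb F[t,t^{-1}]$,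 for $j_1,j_2\in\frac12\mathbb N^+$, by $$R^{(\frac12,\frac12)}(t)=\begin{pmatrix}c(qt)&0&0&0\\0&c(t)&c(q)&0\\0&c(q)&c(t)&0\\0&0&0&c(qt)\end{pmatrix},$$ $$R^{(\frac12,j_2+\frac12)}(t)=\mathcal F^{(j_2+\frac12)}_{23}R^{(\frac12,j_2)}_{13}(q^{-\frac12}t)R^{(\frac12,\frac12)}_{12}(q^{j_2}t)\mathcal E^{(j_2+\frac12)}_{23},$$ $$R^{(j_1+\frac12,j_2)}(t)=\mathcal F^{(j_1+\frac12)}_{12}R^{(\frac12,j_2)}_{13}(q^{-j_1}t)R^{(j_1,j_2)}_{23}(q^{\frac12}t)\mathcal E^{(j_1+\frac12)}_{12}.$$ **The $\widehat R$-matrix.** Let $\widehat R^{(j_1,j_2)}=q^{2\,\mathrm{diag}(j_1,j_1-1,\ldots,-j_1)\otimes\mathrm{diag}(j_2,j_2-1,\ldots,-j_2)}$, a diagonal matrix. **Claim.** Let $s,t$ be commuting indeterminates, and write $K_1=K\otimes I$, $K_2=I\otimes K$. Then for all $j_1,j_2\in\frac12\mathbb N^+$, $$K^{(j_1)}_1(s)\star\widehat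 R^{(j_1,j_2)}\star K^{(j_2)}_2(t)\star R^{(j_1,j_2)}(s/t)=R^{(j_1,j_2)}(s/t)\star K^{(j_2)}_2(t)\star\widehat R^{(j_1,j_2)}\star K^{(j_1)}_1(s),$$ where matrices are multiplied with the product $\star$ on their entries, as an identity of matrices over the ring of formal Laurent series in $s,t$ with coefficients in $\mathbb V$. -/

import Mathlib

noncomputable section

namespace FreidelMaillet

/-! ### The `q`-shuffle algebra on words in two letters -/

/-- The two letters. -/
inductive Letter where
  | x
  | y
  deriving DecidableEq

instance : Fintype Letter := ⟨{Letter.x, Letter.y}, fun a => by cases a <;> simp⟩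

/-- The symmetric form on letters: `⟨x,x⟩ = ⟨y,y⟩ = 2` and `⟨x,y⟩ = ⟨y,x⟩ = -2`. -/
def pair (a b : Letter) : ℤ := if a = b then 2 else -2

/-- The underlying vector space of the `q`-shuffle algebra: its standard basis is the set of all
words in `x, y`. The parameter `q` is recorded in the type since the product depends on it. -/
def Shuffle (F : Type*) [Field F] (_q : F) : Type _ := List Letter →₀ F

section Shuffle

variable {F : Type*} [Field F] {q : F}

instance : AddCommGroup (Shuffle F q) := inferInstanceAs (AddCommGroup (List Letter →₀ F))

instance : Module F (Shuffle F q) := inferInstanceAs (Module F (List Letter →₀ F))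

/-- The basis vector of `Shuffle F q` given by a word. -/
def word (q : F) (w : List Letter) : Shuffle F q := Finsupp.single w (1 : F)

/-- The linear map on `Shuffle F q` with prescribed values on words. -/
def linExt {M : Type*} [AddCommGroup M] [Module F M] (f : List Letter → M) :
    Shuffle F q →ₗ[F] M :=
  Finsupp.linearCombination F f

theorem linExt_word {M : Type*} [AddCommGroup M] [Module F M] (f : List Letter → M)
    (w : List Letter) : linExt (q := q) f (word q w) = f w := by
  exact (Finsupp.linearCombination_single F (1 : F) w).trans (one_smul F (f w))

theorem hom_ext {M : Type*} [AddCommGroup M] [Module F M] {f g : Shuffle F q →ₗ[F] M}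
    (h : ∀ w, f (word q w) = g (word q w)) : f = g := by
  refine Finsupp.lhom_ext' fun w => LinearMap.ext_ring ?_
  exact h w

/-- Left concatenation with a letter, `v ↦ a v`. -/
def consL (q : F) (a : Letter) : Shuffle F q →ₗ[F] Shuffle F q :=
  linExt fun w => word q (a :: w)

/-- The factor `q ^ (⟨b, u₁⟩ + ⋯ + ⟨b, uᵣ⟩)` attached to a letter `b` and a word `u₁ ⋯ uᵣ`. -/
def twist (q : F) (b : Letter) (u : List Letter) : F := (u.map fun a => q ^ pair b a).prod

/-- The `q`-shuffle product of two words, by the first-letter recursion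
`u ⋆ v = u₁ ((u₂ ⋯ uᵣ) ⋆ v) + q ^ (⟨v₁, u₁⟩ + ⋯ + ⟨v₁, uᵣ⟩) v₁ (u ⋆ (v₂ ⋯ vₛ))`. -/
def shuffleWord (q : F) : List Letter → List Letter → Shuffle F q
  | [], v => word q v
  | a :: u, [] => word q (a :: u)
  | a :: u, b :: v =>
      consL q a (shuffleWord q u (b :: v)) +
        twist q b (a :: u) • consL q b (shuffleWord q (a :: u) v)
  termination_by u v => u.length + v.length

/-- The `q`-shuffle product, extended bilinearly. -/
def shuffleMul (q : F) : Shuffle F q →ₗ[F] Shuffle F q →ₗ[F] Shuffle F q :=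
  linExt fun u => linExt fun v => shuffleWord q u v

theorem shuffleMul_word (u v : List Letter) :
    shuffleMul q (word q u) (word q v) = shuffleWord q u v := by
  simp [shuffleMul, linExt_word]

theorem consL_word (a : Letter) (w : List Letter) : consL q a (word q w) = word q (a :: w) := by
  simp [consL, linExt_word]

theorem shuffleWord_nil_left (v : List Letter) : shuffleWord q [] v = word q v := by
  simp [shuffleWord]

theorem shuffleWord_nil_right (u : List Letter) : shuffleWord q u [] = word q u := by
  cases u <;> simp [shuffleWord]

/-- The linear map multiplying each word `w` by `twist q c w`. -/
def twistMap (q : F) (c : Letter) : Shuffle F q →ₗ[F] Shuffle F q :=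
  linExt fun w => twist q c w • word q w

theorem twistMap_word (c : Letter) (w : List Letter) :
    twistMap q c (word q w) = twist q c w • word q w := by
  simp [twistMap, linExt_word]

theorem twistMap_consL (c a : Letter) (z : Shuffle F q) :
    twistMap q c (consL q a z) = q ^ pair c a • consL q a (twistMap q c z) := by
  have : (twistMap q c).comp (consL q a) =
      (q ^ pair c a) • (consL q a).comp (twistMap q c) :=
    hom_ext fun w => by
      simp [consL_word, twistMap_word, twist, mul_smul]
  exact LinearMap.congr_fun this z

theorem twistMap_shuffleWord (c : Letter) (u v : List Letter) :
    twistMap q c (shuffleWord q u v) = (twist q c u * twist q c v) • shuffleWord q u v := by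
  induction u, v using shuffleWord.induct with
  | case1 v => simp [shuffleWord, twistMap_word, twist]
  | case2 a u => simp [shuffleWord, twistMap_word, twist]
  | case3 a u b v ih1 ih2 =>
    rw [shuffleWord, map_add, map_smul, twistMap_consL, twistMap_consL, ih1, ih2]
    simp only [twist, List.map_cons, List.prod_cons, map_smul, smul_add, smul_smul]
    congr 2 <;> ring

theorem mul_word_nil (z : Shuffle F q) : shuffleMul q z (word q []) = z := by
  have : (shuffleMul q).flip (word q []) = LinearMap.id :=
    hom_ext fun w => by simp [shuffleMul_word, shuffleWord_nil_right]
  exact LinearMap.congr_fun this z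

theorem word_nil_mul (z : Shuffle F q) : shuffleMul q (word q []) z = z := by
  have : shuffleMul q (word q []) = LinearMap.id :=
    hom_ext fun w => by simp [shuffleMul_word, shuffleWord_nil_left]
  exact LinearMap.congr_fun this z

theorem consL_mul_word (a c : Letter) (z : Shuffle F q) (w : List Letter) :
    shuffleMul q (consL q a z) (word q (c :: w)) =
      consL q a (shuffleMul q z (word q (c :: w))) +
        consL q c (shuffleMul q (twistMap q c (consL q a z)) (word q w)) := by
  have : ((shuffleMul q).flip (word q (c :: w))).comp (consL q a) =
      (consL q a).comp ((shuffleMul q).flip (word q (c :: w))) +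
        (consL q c).comp (((shuffleMul q).flip (word q w)).comp
          ((twistMap q c).comp (consL q a))) :=
    hom_ext fun u => by
      simp [consL_word, shuffleMul_word, twistMap_word, shuffleWord]
  exact LinearMap.congr_fun this z

theorem word_mul_consL (a b : Letter) (u : List Letter) (z : Shuffle F q) :
    shuffleMul q (word q (a :: u)) (consL q b z) =
      consL q a (shuffleMul q (word q u) (consL q b z)) +
        twist q b (a :: u) • consL q b (shuffleMul q (word q (a :: u)) z) := by
  have : (shuffleMul q (word q (a :: u))).comp (consL q b) =
      (consL q a).comp ((shuffleMul q (word q u)).comp (consL q b)) +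
        twist q b (a :: u) • (consL q b).comp (shuffleMul q (word q (a :: u))) :=
    hom_ext fun v => by
      simp [consL_word, shuffleMul_word, shuffleWord]
  exact LinearMap.congr_fun this z

theorem shuffleWord_assoc : ∀ (u v w : List Letter),
    shuffleMul q (shuffleWord q u v) (word q w) = shuffleMul q (word q u) (shuffleWord q v w)
  | [], v, w => by
    rw [shuffleWord_nil_left, word_nil_mul, shuffleMul_word]
  | a :: u, [], w => by
    rw [shuffleWord_nil_left, shuffleWord_nil_right]
  | a :: u, b :: v, [] => by
    rw [shuffleWord_nil_right, shuffleMul_word, mul_word_nil]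
  | a :: u, b :: v, c :: w => by
    have h1 := shuffleWord_assoc u (b :: v) (c :: w)
    have h2 := shuffleWord_assoc (a :: u) v (c :: w)
    have h3 := shuffleWord_assoc (a :: u) (b :: v) w
    have ht := twistMap_shuffleWord (q := q) c (a :: u) (b :: v)
    have key : shuffleMul q (shuffleWord q (a :: u) (b :: v)) (word q (c :: w)) =
        consL q a (shuffleMul q (shuffleWord q u (b :: v)) (word q (c :: w))) +
        twist q b (a :: u) •
          consL q b (shuffleMul q (shuffleWord q (a :: u) v) (word q (c :: w))) +
        consL q c (shuffleMul q (twistMap q c (shuffleWord q (a :: u) (b :: v))) (word q w)) := by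
      rw [shuffleWord]
      simp only [map_add, map_smul, LinearMap.add_apply, LinearMap.smul_apply, consL_mul_word,
        smul_add]
      abel
    rw [key, ht, h1, h2, map_smul, LinearMap.smul_apply, map_smul, h3]
    have e : shuffleWord q (b :: v) (c :: w) = consL q b (shuffleWord q v (c :: w)) +
        twist q c (b :: v) • consL q c (shuffleWord q (b :: v) w) := by
      rw [shuffleWord]
    rw [e]
    simp only [map_add, map_smul, word_mul_consL, smul_add, smul_smul]
    rw [mul_comm (twist q c (b :: v)) (twist q c (a :: u))]
    abel
  termination_by u v w => u.length + v.length + w.length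

theorem word_induction {P : Shuffle F q → Prop} (hw : ∀ w, P (word q w))
    (hadd : ∀ f g, P f → P g → P (f + g)) (hsmul : ∀ (c : F) f, P f → P (c • f))
    (f : Shuffle F q) : P f := by
  refine Finsupp.induction_linear (motive := P) f ?_ (fun f g => hadd f g) fun w c => ?_
  · have h := hsmul 0 _ (hw [])
    rw [zero_smul] at h
    exact h
  · have h := hsmul c _ (hw w)
    have e : c • word q w = (Finsupp.single w c : List Letter →₀ F) :=
      (Finsupp.smul_single c w (1 : F)).trans (by simp)
    rw [e] at h
    exact h

theorem shuffleMul_assoc (f g h : Shuffle F q) :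
    shuffleMul q (shuffleMul q f g) h = shuffleMul q f (shuffleMul q g h) := by
  induction f using word_induction with
  | hadd f f' h1 h2 => simp [h1, h2]
  | hsmul c f h1 => simp [h1]
  | hw u =>
    induction g using word_induction with
    | hadd f f' h1 h2 => simp [h1, h2]
    | hsmul c f h1 => simp [h1]
    | hw v =>
      induction h using word_induction with
      | hadd f f' h1 h2 => simp [h1, h2]
      | hsmul c f h1 => simp [h1]
      | hw w => rw [shuffleMul_word, shuffleMul_word, shuffleWord_assoc]

/-- The `q`-shuffle algebra as a ring: multiplication is the `q`-shuffle product `⋆` and the unit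
is the trivial word. -/
instance : Ring (Shuffle F q) where
  __ := (inferInstance : AddCommGroup (Shuffle F q))
  mul f g := shuffleMul q f g
  one := word q []
  left_distrib f g h := map_add (shuffleMul q f) g h
  right_distrib f g h := LinearMap.map_add₂ (shuffleMul q) f g h
  zero_mul f := LinearMap.map_zero₂ (shuffleMul q) f
  mul_zero f := map_zero (shuffleMul q f)
  mul_assoc := shuffleMul_assoc
  one_mul := word_nil_mul
  mul_one := mul_word_nil

instance : Algebra F (Shuffle F q) :=
  Algebra.ofModule (fun c f g => LinearMap.map_smul₂ (shuffleMul q) c f g)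
    (fun c f g => map_smul (shuffleMul q f) c g)

theorem mul_def (f g : Shuffle F q) : f * g = shuffleMul q f g := rfl

theorem one_def : (1 : Shuffle F q) = word q [] := rfl

theorem word_mul_word (u v : List Letter) : word q u * word q v = shuffleWord q u v :=
  shuffleMul_word u v

end Shuffle

/-! ### `q`-integers and square roots

Throughout, `r` is a square root of `q`, and `s n` is a square root of the `q`-integer `[n]_q`. -/

section Defs

variable {F : Type*} [Field F]

/-- The `q`-integer `[n]_q`. -/
def qnum (q : F) (n : ℤ) : F := (q ^ n - q ^ (-n)) / (q - q⁻¹)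

/-- The `q`-factorial `[n]_q^! = [1]_q ⋯ [n]_q`. -/
def qfact (q : F) (n : ℕ) : F := ∏ i ∈ Finset.range n, qnum q (i + 1)

/-- The square root of `[n]_q^!` given by the square roots `s i` of `[i]_q`. -/
def sqrtFact (s : ℕ → F) (n : ℕ) : F := ∏ i ∈ Finset.range n, s (i + 1)

/-! ### Catalan words and the generating functions `Δ^{(m)}` -/

/-- The weight `x̄ = 1`, `ȳ = -1` of a letter. -/
def Letter.bar : Letter → ℤ
  | .x => 1
  | .y => -1

/-- The weight `ā₁ + ⋯ + āₙ` of a word. -/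
def wt (w : List Letter) : ℤ := (w.map Letter.bar).sum

/-- A word is Catalan if all its prefixes have nonnegative weight and its weight is zero. -/
def IsCatalan (w : List Letter) : Prop := (∀ i ≤ w.length, 0 ≤ wt (w.take i)) ∧ wt w = 0

instance (w : List Letter) : Decidable (IsCatalan w) :=
  inferInstanceAs (Decidable ((∀ i ≤ w.length, 0 ≤ wt (w.take i)) ∧ wt w = 0))

/-- The coefficient `∏ᵢ [ā₁ + ⋯ + āᵢ₋₁ + m (āᵢ + 1) / 2]_q` of a word `a₁ ⋯ aₖ` in `Δ^{(m)}`
(the division by two is exact, as `āᵢ + 1` is `2` or `0`). -/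
def deltaCoeff (q : F) (m : ℤ) (w : List Letter) : F :=
  ∏ i : Fin w.length, qnum q (wt (w.take i) + m * ((w[i].bar + 1) / 2))

/-- The element `Δ^{(m)}_n`: a sum over the Catalan words of length `2n`. -/
def delta (q : F) (m : ℤ) (n : ℕ) : Shuffle F q :=
  ∑ a : Fin (2 * n) → Letter,
    if IsCatalan (List.ofFn a) then deltaCoeff q m (List.ofFn a) • word q (List.ofFn a) else 0

/-- The linear map `w ↦ a⁻¹ w`: it removes a first letter `a`, and kills the words that do not
start with `a`. -/
def leftQuot (q : F) (a : Letter) : Module.End F (Shuffle F q) :=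
  linExt fun w => match w with
    | [] => 0
    | b :: v => if b = a then word q v else 0

/-- The linear map `w ↦ w a⁻¹`: it removes a last letter `a`, and kills the words that do not
end with `a`. -/
def rightQuot (q : F) (a : Letter) : Module.End F (Shuffle F q) :=
  linExt fun w => if w.getLast? = some a then word q w.dropLast else 0

/-! ### The K-matrix

A spin `j ∈ ½ℕ⁺` is recorded by the positive integer `m = 2j`. Rows and columns, numbered
`1, …, 2j + 1` in the formulas, are indexed by `Fin (m + 1)`, that is, by `0, …, m`. -/

/-- `2 ρ(a, b, j) = a² + b² + 6j² + 4ab - 6aj - 6bj - 6a - 6b + 13j + 6` for `m = 2j`; the division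
by two is exact, since `m (3m + 13)` is even. -/
def twoRho (a b m : ℤ) : ℤ :=
  a ^ 2 + b ^ 2 + 4 * a * b - 3 * a * m - 3 * b * m - 6 * a - 6 * b + 6 + m * (3 * m + 13) / 2

/-- The scalar `φ(a, b, j)`, for `m = 2j` and `1 ≤ a, b ≤ m + 1`; here `q ^ ρ = r ^ (2ρ)`. -/
def phi (q r : F) (s : ℕ → F) (a b m : ℕ) : F :=
  r ^ twoRho a b m * (qfact q m)⁻¹ *
    ((sqrtFact s (a - 1) * sqrtFact s (m + 1 - b)) /
      (sqrtFact s (b - 1) * sqrtFact s (m + 1 - a)))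

/-- The series `x^{-l} Δ^{(k)}(-t²) y^{-p} = ∑ₙ (-1)ⁿ (x^{-l} Δ^{(k)}_n y^{-p}) t^{2n}`. -/
def deltaSeries (q : F) (k : ℤ) (l p : ℕ) : PowerSeries (Shuffle F q) :=
  PowerSeries.mk fun d =>
    if Even d then
      (-1 : F) ^ (d / 2) • (leftQuot q .x ^ l) ((rightQuot q .y ^ p) (delta q k (d / 2)))
    else 0

/-- The matrix `K^{(j)}(t)`, `m = 2j`, with entries
`φ(a,b,j) t^{a-b-2j} x^{1-b} Δ^{(-2j)}(-t²) y^{a-2j-1}`, `a = i + 1`, `b = l + 1`,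
in the ring of formal Laurent series in `t` over the `q`-shuffle algebra. -/
def Kmat (q r : F) (s : ℕ → F) (m : ℕ) :
    Matrix (Fin (m + 1)) (Fin (m + 1)) (HahnSeries ℤ (Shuffle F q)) :=
  Matrix.of fun i l =>
    HahnSeries.single ((i : ℤ) - l - m) (algebraMap F (Shuffle F q) (phi q r s (i + 1) (l + 1) m)) *
      HahnSeries.ofPowerSeries ℤ (Shuffle F q) (deltaSeries q (-m) l (m - i))

/-! ### The R-matrix -/

open LaurentPolynomial in
/-- The substitution `f(t) ↦ f(ct)` for a scalar `c`. -/
def rescale (c : F) (f : LaurentPolynomial F) : LaurentPolynomial F :=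
  f.coeff.sum fun n a => C (a * c ^ n) * T n

open LaurentPolynomial in
/-- The Laurent polynomial `c(at) = at - a⁻¹t⁻¹`. -/
def cT (a : F) : LaurentPolynomial F := C a * T 1 - C a⁻¹ * T (-1)

open LaurentPolynomial in
/-- The matrix `R^{(1/2,1/2)}(t)`. The basis of a tensor product is ordered lexicographically. -/
def Rbase (q : F) : Matrix (Fin 2 × Fin 2) (Fin 2 × Fin 2) (LaurentPolynomial F) :=
  (!![cT q, 0, 0, 0;
      0, cT 1, C (q - q⁻¹), 0;
      0, C (q - q⁻¹), cT 1, 0;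
      0, 0, 0, cT q] : Matrix (Fin 4) (Fin 4) (LaurentPolynomial F)).submatrix
    finProdFinEquiv finProdFinEquiv

/-- The matrix `E^{(j+1/2)}`, `n = 2j`. Its rows, numbered `1, …, 4j + 2`, are indexed by
`Fin 2 × Fin (n + 1)` in lexicographic order; the nonzero entries are
`([2j+2-a] / [2j+1])^{1/2}` at `(a, a)` and `([a] / [2j+1])^{1/2}` at `(a+2j+1, a+1)`, for
`1 ≤ a ≤ 2j + 1`. -/
def Emat (s : ℕ → F) (n : ℕ) : Matrix (Fin 2 × Fin (n + 1)) (Fin (n + 2)) F :=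
  Matrix.of fun i b =>
    if i.1 = 0 then
      if b = i.2.castSucc then s (n + 1 - i.2) / s (n + 1) else 0
    else
      if b = i.2.succ then s (i.2 + 1) / s (n + 1) else 0

/-- The matrix `F^{(j+1/2)}`, `n = 2j`, whose nonzero entries are
`([2j+2-a] [2j+1])^{1/2} / ([2j+2-a] + [a-1])` at `(a, a)` and
`([a] [2j+1])^{1/2} / ([2j+1-a] + [a])` at `(a+1, a+2j+1)`, for `1 ≤ a ≤ 2j + 1`. -/
def Fmat (q : F) (s : ℕ → F) (n : ℕ) : Matrix (Fin (n + 2)) (Fin 2 × Fin (n + 1)) F :=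
  Matrix.of fun b i =>
    if i.1 = 0 then
      if b = i.2.castSucc then
        s (n + 1 - i.2) * s (n + 1) / (qnum q (n + 1 - i.2) + qnum q i.2) else 0
    else
      if b = i.2.succ then
        s (i.2 + 1) * s (n + 1) / (qnum q (n - i.2) + qnum q (i.2 + 1)) else 0

section Legs

variable {A α β γ δ : Type*} [Semiring A] [DecidableEq α] [DecidableEq β] [DecidableEq γ]

open scoped Kronecker

/-- `M₁ = M ⊗ I`, on two tensor factors. -/
def leg1 (β : Type*) [DecidableEq β] (M : Matrix α α A) : Matrix (α × β) (α × β) A := M ⊗ₖ 1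

/-- `M₂ = I ⊗ M`, on two tensor factors. -/
def leg2 (α : Type*) [DecidableEq α] (M : Matrix β β A) : Matrix (α × β) (α × β) A := 1 ⊗ₖ M

/-- `M₁₂ = M ⊗ I`, on three tensor factors. -/
def leg12 (M : Matrix (α × β) (α × β) A) : Matrix (α × β × γ) (α × β × γ) A :=
  (M ⊗ₖ (1 : Matrix γ γ A)).submatrix (Equiv.prodAssoc α β γ).symm (Equiv.prodAssoc α β γ).symm

/-- `M₂₃ = I ⊗ M`, on three tensor factors. -/
def leg23 (M : Matrix (β × γ) (β × γ) A) : Matrix (α × β × γ) (α × β × γ) A := 1 ⊗ₖ M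

/-- `M₂₃ = I ⊗ M` for a rectangular matrix `M` whose rows are indexed by two tensor factors. -/
def leg23E (α : Type*) [DecidableEq α] (M : Matrix (β × γ) δ A) :
    Matrix (α × β × γ) (α × δ) A := 1 ⊗ₖ M

/-- `M₂₃ = I ⊗ M` for a rectangular matrix `M` whose columns are indexed by two tensor factors. -/
def leg23F (α : Type*) [DecidableEq α] (M : Matrix δ (β × γ) A) :
    Matrix (α × δ) (α × β × γ) A := 1 ⊗ₖ M

/-- `M₁₂ = M ⊗ I` for a rectangular matrix `M` whose rows are indexed by two tensor factors. -/
def leg12E (γ : Type*) [DecidableEq γ] (M : Matrix (α × β) δ A) :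
    Matrix (α × β × γ) (δ × γ) A :=
  (M ⊗ₖ (1 : Matrix γ γ A)).submatrix (Equiv.prodAssoc α β γ).symm id

/-- `M₁₂ = M ⊗ I` for a rectangular matrix `M` whose columns are indexed by two tensor factors. -/
def leg12F (γ : Type*) [DecidableEq γ] (M : Matrix δ (α × β) A) :
    Matrix (δ × γ) (α × β × γ) A :=
  (M ⊗ₖ (1 : Matrix γ γ A)).submatrix id (Equiv.prodAssoc α β γ).symm

/-- `M₁₃`, acting on the first and the third of three tensor factors. -/
def leg13 (M : Matrix (α × γ) (α × γ) A) : Matrix (α × β × γ) (α × β × γ) A :=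
  Matrix.of fun i j => if i.2.1 = j.2.1 then M (i.1, i.2.2) (j.1, j.2.2) else 0

end Legs

/-- The matrix `R^{(1/2,j)}(t)` for `n = 2j`, by the recursion
`R^{(1/2,j+1/2)}(t) = F₂₃ R₁₃^{(1/2,j)}(q^{-1/2} t) R₁₂^{(1/2,1/2)}(q^j t) E₂₃`, where `E` and `F`
are `E^{(j+1/2)}` and `F^{(j+1/2)}`. (The value at `n = 0` is a convention and is not used.) -/
def Rhalf (q r : F) (s : ℕ → F) :
    (n : ℕ) → Matrix (Fin 2 × Fin (n + 1)) (Fin 2 × Fin (n + 1)) (LaurentPolynomial F)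
  | 0 => 1
  | 1 => Rbase q
  | n + 2 =>
    leg23F (Fin 2) ((Fmat q s (n + 1)).map LaurentPolynomial.C) *
      leg13 (β := Fin 2) ((Rhalf q r s (n + 1)).map (rescale r⁻¹)) *
      leg12 (γ := Fin (n + 2)) ((Rbase q).map (rescale (r ^ (n + 1)))) *
      leg23E (Fin 2) ((Emat s (n + 1)).map LaurentPolynomial.C)

/-- The matrix `R^{(j₁,j₂)}(t)` for `m₁ = 2j₁`, `m₂ = 2j₂`, by the recursion
`R^{(j₁+1/2,j₂)}(t) = F₁₂ R₁₃^{(1/2,j₂)}(q^{-j₁} t) R₂₃^{(j₁,j₂)}(q^{1/2} t) E₁₂`, where `E` and `F`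
are `E^{(j₁+1/2)}` and `F^{(j₁+1/2)}`. (The value at `m₁ = 0` is a convention and is not used.) -/
def Rmat (q r : F) (s : ℕ → F) (m₂ : ℕ) :
    (m₁ : ℕ) →
      Matrix (Fin (m₁ + 1) × Fin (m₂ + 1)) (Fin (m₁ + 1) × Fin (m₂ + 1)) (LaurentPolynomial F)
  | 0 => 1
  | 1 => Rhalf q r s m₂
  | n + 2 =>
    leg12F (Fin (m₂ + 1)) ((Fmat q s (n + 1)).map LaurentPolynomial.C) *
      leg13 (β := Fin (n + 2)) ((Rhalf q r s m₂).map (rescale (r ^ (n + 1))⁻¹)) *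
      leg23 (α := Fin 2) ((Rmat q r s m₂ (n + 1)).map (rescale r)) *
      leg12E (Fin (m₂ + 1)) ((Emat s (n + 1)).map LaurentPolynomial.C)

/-! ### Two variables

`HahnSeries (ℤ × ℤ) A`, for the product order on `ℤ × ℤ`, is the ring of formal Laurent series in two
commuting variables `s, t` (series whose exponents are bounded below in each variable);
the exponent `(k, l)` stands for `s ^ k t ^ l`. -/

variable {A : Type*} [Ring A]

/-- `f(t) ↦ f(s)`: a one-variable Laurent series read in the first variable `s`. -/
def inS : HahnSeries ℤ A →+* HahnSeries (ℤ × ℤ) A :=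
  HahnSeries.embDomainRingHom (AddMonoidHom.inl ℤ ℤ) (fun a b h => by simpa using h)
    fun a b => by simp

/-- `f(t) ↦ f(t)`: a one-variable Laurent series read in the second variable `t`. -/
def inT : HahnSeries ℤ A →+* HahnSeries (ℤ × ℤ) A :=
  HahnSeries.embDomainRingHom (AddMonoidHom.inr ℤ ℤ) (fun a b h => by simpa using h)
    fun a b => by simp

/-- The substitution `f(t) ↦ f(s/t)` for a Laurent polynomial `f` with scalar coefficients. -/
def atQuotient [Algebra F A] (f : LaurentPolynomial F) : HahnSeries (ℤ × ℤ) A :=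
  f.coeff.sum fun n a => HahnSeries.single (n, -n) (algebraMap F A a)

/-- The matrix `K₁^{(j₁)}(s)`, `m₁ = 2j₁`, `m₂ = 2j₂`. -/
def K1 (q r : F) (s : ℕ → F) (m₁ m₂ : ℕ) :
    Matrix (Fin (m₁ + 1) × Fin (m₂ + 1)) (Fin (m₁ + 1) × Fin (m₂ + 1))
      (HahnSeries (ℤ × ℤ) (Shuffle F q)) :=
  leg1 (Fin (m₂ + 1)) ((Kmat q r s m₁).map inS)

/-- The matrix `K₂^{(j₂)}(t)`, `m₁ = 2j₁`, `m₂ = 2j₂`. -/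
def K2 (q r : F) (s : ℕ → F) (m₁ m₂ : ℕ) :
    Matrix (Fin (m₁ + 1) × Fin (m₂ + 1)) (Fin (m₁ + 1) × Fin (m₂ + 1))
      (HahnSeries (ℤ × ℤ) (Shuffle F q)) :=
  leg2 (Fin (m₁ + 1)) ((Kmat q r s m₂).map inT)

/-- The matrix `R^{(j₁,j₂)}(s/t)`, `m₁ = 2j₁`, `m₂ = 2j₂`. -/
def Rquot (q r : F) (s : ℕ → F) (m₁ m₂ : ℕ) :
    Matrix (Fin (m₁ + 1) × Fin (m₂ + 1)) (Fin (m₁ + 1) × Fin (m₂ + 1))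
      (HahnSeries (ℤ × ℤ) (Shuffle F q)) :=
  (Rmat q r s m₂ m₁).map atQuotient

/-- The diagonal matrix `R̂^{(j₁,j₂)} = q^{2 diag(j₁, …, -j₁) ⊗ diag(j₂, …, -j₂)}`, `m₁ = 2j₁`,
`m₂ = 2j₂`: the entry `q^{2(j₁-i)(j₂-l)}` is written as `r^{(m₁-2i)(m₂-2l)}`. -/
def Rhat (q r : F) (m₁ m₂ : ℕ) :
    Matrix (Fin (m₁ + 1) × Fin (m₂ + 1)) (Fin (m₁ + 1) × Fin (m₂ + 1))
      (HahnSeries (ℤ × ℤ) (Shuffle F q)) :=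
  Matrix.diagonal fun i =>
    HahnSeries.C (algebraMap F (Shuffle F q)
      (r ^ (((m₁ : ℤ) - 2 * (i.1 : ℕ)) * ((m₂ : ℤ) - 2 * (i.2 : ℕ)))))

end Defs

end FreidelMaillet

end

noncomputable section

namespace FreidelMaillet

open Matrix
open scoped Kronecker

/-! ### Modules given by matrices, and their tensor products -/

section Rep

variable {L : Type*} [CommRing L]

/-! An element of the `q`-shuffle algebra is determined by the coefficient of the trivial word and
by its left quotients by `x` and `y`. The left quotient is a twisted derivation for `⋆`
(`leftQuot_mul`), so both sides of the equation can be compared through a linear system.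

The Catalan weights make the K-matrix a closed system: the left quotient of the entry `(i, l)` by a
letter is `t` times a neighbouring entry of the same row, or zero (`IsParam.leftQuot_Kmat`). Up to
powers of `r`, the structure constants are those of the lowering matrix of the spin `m / 2` module
for `x`, and of its reversal for `y`. Hence `X = K₁ R̂ K₂` satisfies `a⁻¹X = D_a X M_a`, with `D_a`
a scalar diagonal matrix depending only on the weight of the row, and `Y = K₂ R̂ K₁` satisfies `a⁻¹Y
= D_a Y M'_a`. Here `M_a` and `M'_a` are built from the lowering operators for the two opposite
coproducts, on a tensor product of evaluation modules whose spectral parameters have quotient `s /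
t`. The matrix `R̂` is what allows the row factor `D_a` to be pulled out.

Suppose `R(s/t)` intertwines the two coproducts. It then preserves weights, so it commutes with
`D_a`, and `M_a R = R M'_a`. Therefore `Z = XR - RY` satisfies `a⁻¹Z = D_a Z M'_a`. The constant
terms of `X` and `Y` are the same antidiagonal matrix, which commutes with `R`, so `Z` has no
constant term. Induction on words gives `Z = 0` (`eq_zero_of_quotSer`, `IsParam.reflection`).

It remains to see that the fused R-matrices intertwine. The case of two spins one half is a direct
check (`sixVertex_intw`). For fusion, `E` embeds a module of higher spin in a tensor product
(`Intw_Emat`), so a product such as `R₁₃ R₂₃ E₁₂` intertwines; the point is that its image lies in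
that of `E₁₂`, so that `F₁₂`, a left inverse, loses nothing. The vectors sent into that image form a
subspace containing the highest weight vector and stable under two lowering operators, for the
parameters `(r, T)` and `(r⁻¹, T⁻¹)`. For an indeterminate spectral parameter these generate the
whole module (`eq_zero_of_lowering`, `Intw.project`). This is why both relations are carried along
in `IntwT`, although the reflection equation uses only the first. -/

/-- A lowering matrix `f`, diagonal-type matrices `k, k'` and a flip `J` on a common space. -/
structure Rep (L ι : Type*) where
  f : Matrix ι ι L
  k : Matrix ι ι L
  k' : Matrix ι ι L
  J : Matrix ι ι L

variable {α β γ δ ε : Type*}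

/-- The tensor product for the coproduct `f ↦ f ⊗ k + k' ⊗ f`. -/
def Rep.tens (V : Rep L α) (W : Rep L β) : Rep L (α × β) :=
  ⟨V.f ⊗ₖ W.k + V.k' ⊗ₖ W.f, V.k ⊗ₖ W.k, V.k' ⊗ₖ W.k', V.J ⊗ₖ W.J⟩

/-- The tensor product for the coproduct `f ↦ f ⊗ k' + k ⊗ f`. -/
def Rep.tensOp (V : Rep L α) (W : Rep L β) : Rep L (α × β) :=
  ⟨V.f ⊗ₖ W.k' + V.k ⊗ₖ W.f, V.k ⊗ₖ W.k, V.k' ⊗ₖ W.k', V.J ⊗ₖ W.J⟩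

/-- Transport of the structure along a bijection of the index sets. -/
def Rep.reindex (e : α ≃ β) (V : Rep L α) : Rep L β :=
  ⟨V.f.submatrix e.symm e.symm, V.k.submatrix e.symm e.symm, V.k'.submatrix e.symm e.symm,
    V.J.submatrix e.symm e.symm⟩

/-- `A` intertwines the operators of `V` and `W`. -/
structure Intw [Fintype α] [Fintype β] (A : Matrix β α L) (V : Rep L α) (W : Rep L β) : Prop where
  f : A * V.f = W.f * A
  k : A * V.k = W.k * A
  k' : A * V.k' = W.k' * A
  J : A * V.J = W.J * A

section Basic

variable [Fintype α] [Fintype β] [Fintype γ] [Fintype δ]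

theorem Intw.mul {V : Rep L α} {W : Rep L β} {U : Rep L γ} {B : Matrix γ β L} {A : Matrix β α L}
    (hB : Intw B W U) (hA : Intw A V W) : Intw (B * A) V U where
  f := by rw [Matrix.mul_assoc, hA.f, ← Matrix.mul_assoc, hB.f, Matrix.mul_assoc]
  k := by rw [Matrix.mul_assoc, hA.k, ← Matrix.mul_assoc, hB.k, Matrix.mul_assoc]
  k' := by rw [Matrix.mul_assoc, hA.k', ← Matrix.mul_assoc, hB.k', Matrix.mul_assoc]
  J := by rw [Matrix.mul_assoc, hA.J, ← Matrix.mul_assoc, hB.J, Matrix.mul_assoc]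

theorem Intw.one [DecidableEq α] (V : Rep L α) : Intw 1 V V := by
  constructor <;> simp

theorem Intw.kron {V : Rep L α} {W : Rep L β} {V' : Rep L γ} {W' : Rep L δ} {A : Matrix γ α L}
    {B : Matrix δ β L} (hA : Intw A V V') (hB : Intw B W W') :
    Intw (A ⊗ₖ B) (V.tens W) (V'.tens W') := by
  constructor <;>
    simp only [Rep.tens, Matrix.mul_add, Matrix.add_mul, ← mul_kronecker_mul, hA.f, hA.k, hA.k',
      hA.J, hB.f, hB.k, hB.k', hB.J]

theorem Intw.kronOp {V : Rep L α} {W : Rep L β} {V' : Rep L γ} {W' : Rep L δ} {A : Matrix γ α L}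
    {B : Matrix δ β L} (hA : Intw A V V') (hB : Intw B W W') :
    Intw (A ⊗ₖ B) (V.tensOp W) (V'.tensOp W') := by
  constructor <;>
    simp only [Rep.tensOp, Matrix.mul_add, Matrix.add_mul, ← mul_kronecker_mul, hA.f, hA.k, hA.k',
      hA.J, hB.f, hB.k, hB.k', hB.J]

theorem Intw.reindex_right {V : Rep L α} {W : Rep L β} {A : Matrix β α L} (hA : Intw A V W)
    (e : β ≃ γ) : Intw (A.submatrix e.symm id) V (W.reindex e) := by
  constructor <;>
    simp only [Rep.reindex, Matrix.submatrix_mul_equiv, ← hA.f, ← hA.k, ← hA.k', ← hA.J] <;> rfl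

theorem Intw.reindex {V : Rep L α} {W : Rep L α} {A : Matrix α α L} (hA : Intw A V W)
    (e : α ≃ γ) : Intw (A.submatrix e.symm e.symm) (V.reindex e) (W.reindex e) := by
  constructor <;>
    simp only [Rep.reindex, Matrix.submatrix_mul_equiv, ← hA.f, ← hA.k, ← hA.k', ← hA.J]

end Basic

/-- Coassociativity: `k` and `k'` are group-like. -/
theorem tens_assoc (U : Rep L α) (V : Rep L β) (W : Rep L γ) :
    ((U.tens V).tens W).reindex (Equiv.prodAssoc α β γ) = U.tens (V.tens W) := by
  simp only [Rep.tens, Rep.reindex, Rep.mk.injEq]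
  refine ⟨?_, ?_, ?_, ?_⟩ <;> ext ⟨a, b, c⟩ ⟨a', b', c'⟩ <;> simp <;> ring

/-! ### Intertwiners on three tensor factors -/

section Legs

variable [Fintype α] [Fintype β] [Fintype γ]

/-- `N` on the first and third tensor factors, `B` on the second. -/
def onOuter (N : Matrix (α × γ) (α × γ) L) (B : Matrix β β L) :
    Matrix (α × β × γ) (α × β × γ) L :=
  Matrix.of fun i j => N (i.1, i.2.2) (j.1, j.2.2) * B i.2.1 j.2.1

theorem Intw.leg12E_op [Fintype δ] [DecidableEq γ] {U : Rep L α} {V : Rep L β} {VE : Rep L δ}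
    {E : Matrix (α × β) δ L}
    (hE : Intw E VE (U.tens V)) (W : Rep L γ) :
    Intw (leg12E γ E) (VE.tensOp W)
      (((U.tens V).tensOp W).reindex (Equiv.prodAssoc α β γ)) :=
  (hE.kronOp (Intw.one W)).reindex_right (Equiv.prodAssoc α β γ)

variable [DecidableEq β]

theorem leg13_mul_onOuter (R N : Matrix (α × γ) (α × γ) L) (B : Matrix β β L) :
    leg13 R * onOuter N B = onOuter (R * N) B := by
  ext ⟨a, b, c⟩ ⟨a', b', c'⟩
  simp only [leg13, onOuter, Matrix.mul_apply, Matrix.of_apply, Fintype.sum_prod_type, ite_mul,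
    zero_mul, Finset.sum_mul, ← mul_assoc]
  refine Finset.sum_congr rfl fun x _ => ?_
  rw [Finset.sum_eq_single b (by intro y _ h; simp [h.symm]) (by simp)]
  simp

theorem onOuter_mul_leg13 (R N : Matrix (α × γ) (α × γ) L) (B : Matrix β β L) :
    onOuter N B * leg13 R = onOuter (N * R) B := by
  ext ⟨a, b, c⟩ ⟨a', b', c'⟩
  simp only [leg13, onOuter, Matrix.mul_apply, Matrix.of_apply, Fintype.sum_prod_type, mul_ite,
    mul_zero, Finset.sum_mul]
  refine Finset.sum_congr rfl fun x _ => ?_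
  rw [Finset.sum_eq_single b' (by intro y _ h; simp [h]) (by simp)]
  refine Finset.sum_congr rfl fun y _ => ?_
  simp only [if_true]
  ring

theorem leg13_onOuter_comm {R N N' M : Matrix (α × γ) (α × γ) L} {B B' : Matrix β β L}
    (h : R * N = N' * R) (h' : R * M = M * R) :
    leg13 R * (onOuter N B + onOuter M B') = (onOuter N' B + onOuter M B') * leg13 R := by
  rw [Matrix.mul_add, Matrix.add_mul, leg13_mul_onOuter, leg13_mul_onOuter, onOuter_mul_leg13,
    onOuter_mul_leg13, h, h']

/-- The source operator regroups as `f ⊗ k + k' ⊗ f` on the outer legs with `k` in the middle, plus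
`k' ⊗ f ⊗ k'`. On the outer legs `R` turns the first bracket into its opposite, and it commutes with
`k' ⊗ k'`. -/
theorem Intw.leg13_left {U : Rep L α} {W : Rep L γ} {R : Matrix (α × γ) (α × γ) L}
    (h : Intw R (U.tens W) (U.tensOp W)) (V : Rep L β) :
    Intw (leg13 R) (U.tens (V.tensOp W))
      (((U.tens V).tensOp W).reindex (Equiv.prodAssoc α β γ)) := by
  have hk : ∀ (A : Matrix (α × γ) (α × γ) L) (B : Matrix β β L) {X Y}, R * A = A * R →
      X = onOuter A B → Y = onOuter A B → leg13 R * X = Y * leg13 R := by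
    rintro A B _ _ hA rfl rfl
    rw [leg13_mul_onOuter, onOuter_mul_leg13, hA]
  constructor
  · have e1 : (U.tens (V.tensOp W)).f =
        onOuter (U.tens W).f V.k + onOuter (U.tens W).k' V.f := by
      ext ⟨a, b, c⟩ ⟨a', b', c'⟩
      simp [Rep.tens, Rep.tensOp, onOuter]; ring
    have e2 : (((U.tens V).tensOp W).reindex (Equiv.prodAssoc α β γ)).f =
        onOuter (U.tensOp W).f V.k + onOuter (U.tens W).k' V.f := by
      ext ⟨a, b, c⟩ ⟨a', b', c'⟩
      simp [Rep.tens, Rep.tensOp, Rep.reindex, onOuter]; ring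
    rw [e1, e2, leg13_onOuter_comm h.f h.k']
  · refine hk _ V.k h.k ?_ ?_ <;> ext ⟨a, b, c⟩ ⟨a', b', c'⟩ <;>
      simp [Rep.tens, Rep.tensOp, Rep.reindex, onOuter] <;> ring
  · refine hk _ V.k' h.k' ?_ ?_ <;> ext ⟨a, b, c⟩ ⟨a', b', c'⟩ <;>
      simp [Rep.tens, Rep.tensOp, Rep.reindex, onOuter] <;> ring
  · refine hk _ V.J h.J ?_ ?_ <;> ext ⟨a, b, c⟩ ⟨a', b', c'⟩ <;>
      simp [Rep.tens, Rep.tensOp, Rep.reindex, onOuter] <;> ring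

/-- Mirror image of `Intw.leg13_left`: the bracket on the outer legs now has `k'` in the middle, and
the remaining term is `k ⊗ f ⊗ k`. -/
theorem Intw.leg13_right {U : Rep L α} {W : Rep L γ} {R : Matrix (α × γ) (α × γ) L}
    (h : Intw R (U.tens W) (U.tensOp W)) (V : Rep L β) :
    Intw (leg13 R) (((U.tensOp V).tens W).reindex (Equiv.prodAssoc α β γ))
      (U.tensOp (V.tens W)) := by
  have hk : ∀ (A : Matrix (α × γ) (α × γ) L) (B : Matrix β β L) {X Y}, R * A = A * R →
      X = onOuter A B → Y = onOuter A B → leg13 R * X = Y * leg13 R := by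
    rintro A B _ _ hA rfl rfl
    rw [leg13_mul_onOuter, onOuter_mul_leg13, hA]
  constructor
  · have e1 : (((U.tensOp V).tens W).reindex (Equiv.prodAssoc α β γ)).f =
        onOuter (U.tens W).f V.k' + onOuter (U.tens W).k V.f := by
      ext ⟨a, b, c⟩ ⟨a', b', c'⟩
      simp [Rep.tens, Rep.tensOp, Rep.reindex, onOuter]; ring
    have e2 : (U.tensOp (V.tens W)).f =
        onOuter (U.tensOp W).f V.k' + onOuter (U.tens W).k V.f := by
      ext ⟨a, b, c⟩ ⟨a', b', c'⟩
      simp [Rep.tens, Rep.tensOp, onOuter]; ring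
    rw [e1, e2, leg13_onOuter_comm h.f h.k]
  · refine hk _ V.k h.k ?_ ?_ <;> ext ⟨a, b, c⟩ ⟨a', b', c'⟩ <;>
      simp [Rep.tens, Rep.tensOp, Rep.reindex, onOuter] <;> ring
  · refine hk _ V.k' h.k' ?_ ?_ <;> ext ⟨a, b, c⟩ ⟨a', b', c'⟩ <;>
      simp [Rep.tens, Rep.tensOp, Rep.reindex, onOuter] <;> ring
  · refine hk _ V.J h.J ?_ ?_ <;> ext ⟨a, b, c⟩ ⟨a', b', c'⟩ <;>
      simp [Rep.tens, Rep.tensOp, Rep.reindex, onOuter] <;> ring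

variable [Fintype δ] [DecidableEq α] [DecidableEq γ]

/-- The product `R₁₃ R₂₃ E₁₂`, for a fusion in the first leg. -/
theorem Intw.fuse_left {U : Rep L α} {V : Rep L β} {W : Rep L γ} {VE : Rep L δ}
    {R₁ : Matrix (α × γ) (α × γ) L} {R₂ : Matrix (β × γ) (β × γ) L} {E : Matrix (α × β) δ L}
    (h₁ : Intw R₁ (U.tens W) (U.tensOp W)) (h₂ : Intw R₂ (V.tens W) (V.tensOp W))
    (hE : Intw E VE (U.tens V)) :
    Intw (leg13 R₁ * leg23 R₂ * leg12E γ E) (VE.tens W)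
      (((U.tens V).tensOp W).reindex (Equiv.prodAssoc α β γ)) := by
  have hE' := (hE.kron (Intw.one W)).reindex_right (Equiv.prodAssoc α β γ)
  rw [tens_assoc] at hE'
  exact ((h₁.leg13_left V).mul ((Intw.one U).kron h₂)).mul hE'

/-- The product `R₁₃ R₁₂ E₂₃`, for a fusion in the second leg. -/
theorem Intw.fuse_right {U : Rep L α} {V : Rep L β} {W : Rep L γ} {VE : Rep L δ}
    {R₁ : Matrix (α × γ) (α × γ) L} {R₂ : Matrix (α × β) (α × β) L} {E : Matrix (β × γ) δ L}
    (h₁ : Intw R₁ (U.tens W) (U.tensOp W)) (h₂ : Intw R₂ (U.tens V) (U.tensOp V))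
    (hE : Intw E VE (V.tens W)) :
    Intw (leg13 R₁ * leg12 R₂ * leg23E α E) (U.tens VE) (U.tensOp (V.tens W)) := by
  have h₂' := (h₂.kron (Intw.one W)).reindex (Equiv.prodAssoc α β γ)
  rw [tens_assoc] at h₂'
  exact ((h₁.leg13_right V).mul h₂').mul ((Intw.one U).kron hE)

end Legs

/-- If `X` intertwines and its image lies in the image of an injective intertwiner `E`, then the
corestriction `F * X` intertwines. -/
theorem Intw.corestrict [Fintype α] [Fintype β] [Fintype γ] [DecidableEq β] {S : Rep L α}
    {T : Rep L γ} {V : Rep L β} {X : Matrix γ α L} {E : Matrix γ β L} {F : Matrix β γ L}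
    (hX : Intw X S T) (hE : Intw E V T) (hFE : F * E = 1) (h : E * (F * X) = X) :
    Intw (F * X) S V := by
  have key : ∀ {a : Matrix α α L} {t : Matrix γ γ L} {b : Matrix β β L},
      X * a = t * X → E * b = t * E → F * X * a = b * (F * X) := by
    intro a t b h1 h2
    calc F * X * a = F * (t * (E * (F * X))) := by rw [Matrix.mul_assoc, h1, h]
      _ = (F * E) * (b * (F * X)) := by
          rw [← Matrix.mul_assoc t, ← h2]; simp only [Matrix.mul_assoc]
      _ = b * (F * X) := by rw [hFE, Matrix.one_mul]
  exact ⟨key hX.f hE.f, key hX.k hE.k, key hX.k' hE.k', key hX.J hE.J⟩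

end Rep

end FreidelMaillet

namespace FreidelMaillet

open Matrix
open scoped Kronecker

/-! ### Evaluation modules -/

section Eval

variable {F L : Type*} [Field F] [CommRing L] (φ : F →+* L) (s : ℕ → F)

/-- The evaluation module of spin `m / 2` and spectral parameter `z`, for the parameter `κ²`. -/
def ev (m : ℕ) (κ : F) (z : L) : Rep L (Fin (m + 1)) where
  f := Matrix.of fun i j => if (i : ℕ) = j + 1 then z * φ (s (j + 1) * s (m - j)) else 0
  k := Matrix.diagonal fun i => φ (κ ^ ((m : ℤ) - 2 * (i : ℕ)))
  k' := Matrix.diagonal fun i => φ (κ ^ (2 * (i : ℕ) - (m : ℤ)))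
  J := Matrix.of fun i j => if (i : ℕ) + j = m then 1 else 0

/-- `R` intertwines the two tensor products of evaluation modules with quotient `ζ` of spectral
parameters. -/
def IntwEv (m₁ m₂ : ℕ) (κ : F) (ζ : L)
    (R : Matrix (Fin (m₁ + 1) × Fin (m₂ + 1)) (Fin (m₁ + 1) × Fin (m₂ + 1)) L) : Prop :=
  Intw R ((ev φ s m₁ κ ζ).tens (ev φ s m₂ κ 1)) ((ev φ s m₁ κ ζ).tensOp (ev φ s m₂ κ 1))

variable {φ s}

/-- Both lowering operators are homogeneous of degree one in the pair of spectral parameters, so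
only the quotient matters. -/
theorem IntwEv.scale {m₁ m₂ : ℕ} {κ : F} {ζ : L}
    {R : Matrix (Fin (m₁ + 1) × Fin (m₂ + 1)) (Fin (m₁ + 1) × Fin (m₂ + 1)) L}
    (h : IntwEv φ s m₁ m₂ κ ζ R) {z₁ z₂ : L} (hz : z₁ = ζ * z₂) :
    Intw R ((ev φ s m₁ κ z₁).tens (ev φ s m₂ κ z₂))
      ((ev φ s m₁ κ z₁).tensOp (ev φ s m₂ κ z₂)) := by
  subst hz
  refine ⟨?_, h.k, h.k', h.J⟩
  have e1 : ((ev φ s m₁ κ (ζ * z₂)).tens (ev φ s m₂ κ z₂)).f =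
      z₂ • ((ev φ s m₁ κ ζ).tens (ev φ s m₂ κ 1)).f := by
    ext ⟨a, b⟩ ⟨a', b'⟩
    simp only [Rep.tens, ev, Matrix.add_apply, kroneckerMap_apply, of_apply, Matrix.smul_apply,
      smul_eq_mul]
    split_ifs <;> ring
  have e2 : ((ev φ s m₁ κ (ζ * z₂)).tensOp (ev φ s m₂ κ z₂)).f =
      z₂ • ((ev φ s m₁ κ ζ).tensOp (ev φ s m₂ κ 1)).f := by
    ext ⟨a, b⟩ ⟨a', b'⟩
    simp only [Rep.tensOp, ev, Matrix.add_apply, kroneckerMap_apply, of_apply, Matrix.smul_apply,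
      smul_eq_mul]
    split_ifs <;> ring
  rw [e1, e2, Matrix.mul_smul, Matrix.smul_mul, h.f]

theorem IntwEv.map {m₁ m₂ : ℕ} {κ : F} {ζ : L}
    {R : Matrix (Fin (m₁ + 1) × Fin (m₂ + 1)) (Fin (m₁ + 1) × Fin (m₂ + 1)) L}
    (h : IntwEv φ s m₁ m₂ κ ζ R) {L' : Type*} [CommRing L'] (ψ : L →+* L') :
    IntwEv (ψ.comp φ) s m₁ m₂ κ (ψ ζ) (R.map ψ) := by
  have key : ∀ {A B : Matrix (Fin (m₁ + 1) × Fin (m₂ + 1)) (Fin (m₁ + 1) × Fin (m₂ + 1)) L}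
      {A' B'}, R * A = B * R → A' = A.map ψ → B' = B.map ψ → R.map ψ * A' = B' * R.map ψ := by
    rintro A B _ _ e rfl rfl
    rw [← Matrix.map_mul, ← Matrix.map_mul, e]
  refine ⟨key h.f ?_ ?_, key h.k ?_ ?_, key h.k' ?_ ?_, key h.J ?_ ?_⟩ <;>
  · ext ⟨a, b⟩ ⟨a', b'⟩
    simp only [Rep.tens, Rep.tensOp, ev, Matrix.add_apply, kroneckerMap_apply, of_apply, map_apply,
      diagonal_apply]
    split_ifs <;> simp

/-- The basis vector `e_{i,k}` of a tensor product, zero if an index is out of range. -/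
def basisVec (L : Type*) [CommRing L] (m₁ m₂ i k : ℕ) : Fin (m₁ + 1) × Fin (m₂ + 1) → L :=
  fun x => if (x.1 : ℕ) = i ∧ (x.2 : ℕ) = k then 1 else 0

theorem basisVec_eq_single {m₁ m₂ : ℕ} (i : Fin (m₁ + 1)) (k : Fin (m₂ + 1)) :
    basisVec L m₁ m₂ i k = Pi.single (i, k) 1 := by
  funext x
  simp [basisVec, Pi.single_apply, Prod.ext_iff, Fin.ext_iff]

/-- No boundary case arises, since `basisVec` vanishes when an index leaves its range. -/
theorem tens_f_mulVec (m₁ m₂ : ℕ) (κ : F) (z : L) {i k : ℕ} (hi : i ≤ m₁) (hk : k ≤ m₂) :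
    ((ev φ s m₁ κ z).tens (ev φ s m₂ κ 1)).f *ᵥ basisVec L m₁ m₂ i k =
      (z * φ (s (i + 1) * s (m₁ - i) * κ ^ ((m₂ : ℤ) - 2 * k))) • basisVec L m₁ m₂ (i + 1) k +
      φ (κ ^ (2 * i - (m₁ : ℤ)) * (s (k + 1) * s (m₂ - k))) • basisVec L m₁ m₂ i (k + 1) := by
  have := basisVec_eq_single (L := L) (⟨i, by omega⟩ : Fin (m₁ + 1)) (⟨k, by omega⟩ : Fin (m₂ + 1))
  simp only at this
  rw [this, mulVec_single_one]
  funext ⟨a, b⟩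
  simp only [Rep.tens, ev, Matrix.col_apply, Matrix.add_apply, kroneckerMap_apply, of_apply,
    diagonal_apply, basisVec, Pi.add_apply, Pi.smul_apply, smul_eq_mul, Fin.ext_iff]
  congr 1
  · by_cases h : (a : ℕ) = i + 1 <;> by_cases h' : (b : ℕ) = k <;> simp [h, h', mul_assoc]
  · by_cases h : (a : ℕ) = i <;> by_cases h' : (b : ℕ) = k + 1 <;> simp [h, h']

/-- The vector `e_{0,0}` generates a generic tensor product under the two lowering operators. -/
theorem eq_zero_of_lowering [IsDomain L] {m₁ m₂ : ℕ} {κ : F} (hκ : κ ≠ 0) {z z' : L}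
    (hz : z * z' = 1) (hgen : ∀ n : ℤ, z * z * φ (κ ^ n) ≠ 1) (hs : ∀ n, s (n + 1) ≠ 0)
    {τ : Type*} (M : Matrix τ (Fin (m₁ + 1) × Fin (m₂ + 1)) L)
    (h0 : M *ᵥ basisVec L m₁ m₂ 0 0 = 0)
    (h1 : ∀ v, M *ᵥ v = 0 → M *ᵥ (((ev φ s m₁ κ z).tens (ev φ s m₂ κ 1)).f *ᵥ v) = 0)
    (h2 : ∀ v, M *ᵥ v = 0 → M *ᵥ (((ev φ s m₁ κ⁻¹ z').tens (ev φ s m₂ κ⁻¹ 1)).f *ᵥ v) = 0) :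
    M = 0 := by
  have hφ : ∀ x : F, x ≠ 0 → φ x ≠ 0 := fun x hx => by
    rw [Ne, map_eq_zero]; exact hx
  -- The two lowering operators send `e_{i,k}` to two combinations of `e_{i+1,k}` and `e_{i,k+1}`.
  -- This is the determinant of that system, up to factors `s`; as `z' = z⁻¹`, its vanishing would
  -- give `z² κ^{2n} = 1`.
  have hdet : ∀ n : ℤ, z * φ (κ ^ n) - z' * φ (κ ^ (-n)) ≠ 0 := by
    intro n h
    apply hgen (n + n)
    have e : φ (κ ^ n) * φ (κ ^ (-n)) = 1 := by
      rw [← map_mul, ← zpow_add₀ hκ]; simp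
    rw [zpow_add₀ hκ, map_mul]
    linear_combination z * φ (κ ^ n) * h + (z * z') * e + hz
  have hpos : ∀ i m : ℕ, i + 1 ≤ m → s (m - i) ≠ 0 := fun i m h => by
    obtain ⟨c, rfl⟩ := Nat.exists_eq_add_of_le h
    have : i + 1 + c - i = c + 1 := by omega
    rw [this]; exact hs c
  have hall : ∀ i k, M *ᵥ basisVec L m₁ m₂ i k = 0 := by
    have hstep : ∀ i k, i ≤ m₁ → k ≤ m₂ → M *ᵥ basisVec L m₁ m₂ i k = 0 → ∀ t,
        φ (s (i + 1) * s (m₁ - i)) * (M *ᵥ basisVec L m₁ m₂ (i + 1) k) t = 0 ∧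
        φ (s (k + 1) * s (m₂ - k)) * (M *ᵥ basisVec L m₁ m₂ i (k + 1)) t = 0 := by
      intro i k hi hk h t
      have e1 := congrFun (h1 _ h) t
      have e2 := congrFun (h2 _ h) t
      rw [tens_f_mulVec _ _ _ _ hi hk, mulVec_add, mulVec_smul, mulVec_smul] at e1 e2
      simp only [Pi.add_apply, Pi.smul_apply, smul_eq_mul, Pi.zero_apply, _root_.inv_zpow', map_mul,
        neg_sub] at e1 e2
      set u := (M *ᵥ basisVec L m₁ m₂ (i + 1) k) t
      set w := (M *ᵥ basisVec L m₁ m₂ i (k + 1)) t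
      set a : ℤ := (m₁ : ℤ) - 2 * i
      set b : ℤ := (m₂ : ℤ) - 2 * k
      have ea : (2 * i - (m₁ : ℤ)) = -a := by ring
      have eb : (2 * k - (m₂ : ℤ)) = -b := by ring
      rw [eb] at e2
      rw [ea] at e1
      have ia : φ (κ ^ a) * φ (κ ^ (-a)) = 1 := by
        rw [← map_mul, ← zpow_add₀ hκ]; simp
      have ib : φ (κ ^ b) * φ (κ ^ (-b)) = 1 := by
        rw [← map_mul, ← zpow_add₀ hκ]; simp
      have hd := hdet (a + b)
      rw [neg_add, zpow_add₀ hκ, zpow_add₀ hκ, map_mul, map_mul] at hd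
      simp only [map_mul]
      constructor
      · refine (mul_eq_zero.1 ?_).resolve_left hd
        linear_combination φ (κ ^ a) * e1 - φ (κ ^ (-a)) * e2
      · refine (mul_eq_zero.1 ?_).resolve_left hd
        linear_combination z * φ (κ ^ b) * e2 - z' * φ (κ ^ (-b)) * e1
    -- The vectors `e_{i,0}` are reached by raising the first index, then each `e_{i,k}` by raising
    -- the second.
    have hrow : ∀ i, M *ᵥ basisVec L m₁ m₂ i 0 = 0 := by
      intro i
      induction i with
      | zero => exact h0
      | succ i ih =>
        by_cases hi : i + 1 ≤ m₁
        · funext t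
          exact (mul_eq_zero.1 (hstep i 0 (by omega) (by omega) ih t).1).resolve_left
            (hφ _ (mul_ne_zero (hs i) (hpos i m₁ hi)))
        · have : basisVec L m₁ m₂ (i + 1) 0 = 0 := by
            funext x
            have := x.1.2
            simp only [basisVec, Pi.zero_apply]
            rw [if_neg]; omega
          rw [this, mulVec_zero]
    intro i k
    by_cases hi : i ≤ m₁
    · induction k with
      | zero => exact hrow i
      | succ k ih =>
        by_cases hk : k + 1 ≤ m₂
        · funext t
          exact (mul_eq_zero.1 (hstep i k (by omega) (by omega) ih t).2).resolve_left
            (hφ _ (mul_ne_zero (hs k) (hpos k m₂ hk)))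
        · have : basisVec L m₁ m₂ i (k + 1) = 0 := by
            funext x
            have := x.2.2
            simp only [basisVec, Pi.zero_apply]
            rw [if_neg]; omega
          rw [this, mulVec_zero]
    · have : basisVec L m₁ m₂ i k = 0 := by
        funext x
        have := x.1.2
        simp only [basisVec, Pi.zero_apply]
        rw [if_neg]; omega
      rw [this, mulVec_zero]
  ext t ⟨i, k⟩
  have := congrFun (hall i k) t
  rw [basisVec_eq_single, mulVec_single_one] at this
  simpa using this

/-- Projecting an intertwiner from a generic tensor product onto a submodule of its target. -/
theorem Intw.project [IsDomain L] {m₁ m₂ : ℕ} {κ : F} (hκ : κ ≠ 0)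
    (hκ1 : ∀ n : ℤ, κ ^ n = 1 → n = 0) {z z' : L}
    (hz : z * z' = 1) (hgen : ∀ n : ℤ, z * z * φ (κ ^ n) ≠ 1) (hs : ∀ n, s (n + 1) ≠ 0)
    {τ β : Type*} [Fintype τ] [DecidableEq τ] [Fintype β] [DecidableEq β]
    {T T' : Rep L τ} {V V' : Rep L β}
    {X : Matrix τ (Fin (m₁ + 1) × Fin (m₂ + 1)) L} {E : Matrix τ β L} {P : Matrix β τ L}
    (hX : Intw X ((ev φ s m₁ κ z).tens (ev φ s m₂ κ 1)) T)
    (hX' : Intw X ((ev φ s m₁ κ⁻¹ z').tens (ev φ s m₂ κ⁻¹ 1)) T')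
    (hE : Intw E V T) (hE' : Intw E V' T') (hPE : P * E = 1)
    (w : τ → ℕ) (hT : T.k = Matrix.diagonal fun t => φ (κ ^ ((m₁ : ℤ) + m₂ - 2 * w t)))
    (t₀ : τ) (ht₀ : ∀ t, w t = 0 → t = t₀) (b₀ : β) (hb₀ : E *ᵥ Pi.single b₀ 1 = Pi.single t₀ 1) :
    Intw (P * X) ((ev φ s m₁ κ z).tens (ev φ s m₂ κ 1)) V ∧
      Intw (P * X) ((ev φ s m₁ κ⁻¹ z').tens (ev φ s m₂ κ⁻¹ 1)) V' := by
  -- The vectors `v` with `X v = E P X v`, that is, with `X v` in the image of `E`, are stable under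
  -- every operator that both `X` and `E` carry to `t`.
  have hstab : ∀ {a : Matrix (Fin (m₁ + 1) × Fin (m₂ + 1)) (Fin (m₁ + 1) × Fin (m₂ + 1)) L}
      {t : Matrix τ τ L} {b : Matrix β β L}, X * a = t * X → E * b = t * E → ∀ v,
      (X - E * (P * X)) *ᵥ v = 0 → (X - E * (P * X)) *ᵥ (a *ᵥ v) = 0 := by
    intro a t b e1 e2 v hv
    rw [sub_mulVec, sub_eq_zero] at hv ⊢
    have e3 : X *ᵥ (a *ᵥ v) = E *ᵥ (b *ᵥ (P *ᵥ (X *ᵥ v))) := by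
      calc X *ᵥ (a *ᵥ v) = t *ᵥ (X *ᵥ v) := by rw [mulVec_mulVec, e1, ← mulVec_mulVec]
        _ = t *ᵥ (E *ᵥ (P *ᵥ (X *ᵥ v))) := by
          conv_lhs => rw [hv, ← mulVec_mulVec, ← mulVec_mulVec]
        _ = _ := by rw [mulVec_mulVec, ← e2, ← mulVec_mulVec]
    rw [← mulVec_mulVec, ← mulVec_mulVec, e3, mulVec_mulVec _ P E, hPE, one_mulVec]
  -- By generation from `e_{0,0}` it suffices that `X e_{0,0}` lies in the image of `E`. It has the
  -- top weight, so it is a multiple of the vector at `t₀`, which is the image of the one at `b₀`.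
  have hzero : X - E * (P * X) = 0 := by
    refine eq_zero_of_lowering hκ hz hgen hs _ ?_ (hstab hX.f hE.f) (hstab hX'.f hE'.f)
    have e0 := basisVec_eq_single (L := L) (0 : Fin (m₁ + 1)) (0 : Fin (m₂ + 1))
    simp only [Fin.val_zero] at e0
    set u := X *ᵥ basisVec L m₁ m₂ 0 0 with hu
    have hk : ∀ t, φ (κ ^ ((m₁ : ℤ) + m₂)) * u t =
        φ (κ ^ ((m₁ : ℤ) + m₂ - 2 * w t)) * u t := by
      intro t
      have e1 : X *ᵥ ((((ev φ s m₁ κ z).tens (ev φ s m₂ κ 1)).k) *ᵥ basisVec L m₁ m₂ 0 0) =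
          T.k *ᵥ u := by
        rw [mulVec_mulVec, hX.k, ← mulVec_mulVec]
      have e2 : (((ev φ s m₁ κ z).tens (ev φ s m₂ κ 1)).k) *ᵥ basisVec L m₁ m₂ 0 0 =
          φ (κ ^ ((m₁ : ℤ) + m₂)) • basisVec L m₁ m₂ 0 0 := by
        simp only [Rep.tens, ev, diagonal_kronecker_diagonal]
        funext x
        rw [mulVec_diagonal]
        simp only [basisVec, Pi.smul_apply, smul_eq_mul]
        split_ifs with hx
        · rw [hx.1, hx.2, ← map_mul, ← zpow_add₀ hκ]; simp
        · simp
      rw [e2, mulVec_smul, hT] at e1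
      have := congrFun e1 t
      rwa [mulVec_diagonal] at this
    have hu0 : u = u t₀ • Pi.single t₀ 1 := by
      funext t
      by_cases h : t = t₀
      · subst h; simp
      · have hw : w t ≠ 0 := fun h' => h (ht₀ t h')
        simp only [Pi.smul_apply, Pi.single_apply, h, if_false, smul_zero]
        -- Different weights give different eigenvalues of `k`, because `κ` is not a root of unity.
        have h3 : (φ (κ ^ ((m₁ : ℤ) + m₂)) - φ (κ ^ ((m₁ : ℤ) + m₂ - 2 * w t))) * u t = 0 := by
          rw [sub_mul, hk t, sub_self]
        refine (mul_eq_zero.1 h3).resolve_left fun h4 => hw ?_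
        have h5 := φ.injective (sub_eq_zero.1 h4)
        have h6 := hκ1 (2 * w t) (by
          have : (2 * w t : ℤ) = ((m₁ : ℤ) + m₂) - ((m₁ : ℤ) + m₂ - 2 * w t) := by ring
          rw [this, zpow_sub₀ hκ, h5, div_self (zpow_ne_zero _ hκ)])
        omega
    rw [sub_mulVec, ← mulVec_mulVec, ← mulVec_mulVec, ← hu, hu0, mulVec_smul, mulVec_smul, ← hb₀,
      mulVec_mulVec _ P E, hPE, one_mulVec, sub_self]
  have h := (sub_eq_zero.1 hzero).symm
  exact ⟨hX.corestrict hE hPE h, hX'.corestrict hE' hPE h⟩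

end Eval

end FreidelMaillet

namespace FreidelMaillet

open Matrix
open scoped Kronecker

/-! ### The fusion matrices -/

section Fusion

variable {F L : Type*} [Field F] [CommRing L] {φ : F →+* L} {s : ℕ → F}

theorem Emat_zero (n : ℕ) (p : Fin (n + 1)) (b : Fin (n + 2)) :
    Emat s n (0, p) b = if (b : ℕ) = p then s (n + 1 - p) / s (n + 1) else 0 := by
  have : b = p.castSucc ↔ (b : ℕ) = p := Fin.ext_iff
  simp only [Emat, of_apply, if_true, this]

theorem Emat_one (n : ℕ) (p : Fin (n + 1)) (b : Fin (n + 2)) :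
    Emat s n (1, p) b = if (b : ℕ) = p + 1 then s (p + 1) / s (n + 1) else 0 := by
  have : b = p.succ ↔ (b : ℕ) = p + 1 := Fin.ext_iff
  simp only [Emat, of_apply, one_ne_zero, if_false, this]

/-- The diagonal entry at `b` collects `[n+1-b]` from the first half and `[b]` from the second, over
the common denominator `[n+1-b] + [b]`. Both halves are summed over all of `Fin (n + 2)`: the index
missing in each contributes `s 0 = 0`. -/
theorem Fmat_mul_Emat {q : F} (hs : ∀ n, s n ^ 2 = qnum q n) (hs0 : ∀ n, s (n + 1) ≠ 0)
    (hden : ∀ n b : ℕ, b ≤ n + 1 → qnum q (n + 1 - b) + qnum q b ≠ 0) (n : ℕ) :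
    Fmat q s n * Emat s n = 1 := by
  have h00 : s 0 = 0 := by
    have := hs 0
    simpa [qnum] using this
  ext b b'
  have e1 : ∑ p : Fin (n + 1), Fmat q s n b (0, p) * Emat s n (0, p) b' =
      ∑ c : Fin (n + 2), if b = c ∧ b' = c then
        s (n + 1 - c) ^ 2 / (qnum q (n + 1 - c) + qnum q c) else 0 := by
    rw [Fin.sum_univ_castSucc (n := n + 1)]
    simp only [Fin.val_last, Nat.sub_self, h00]
    simp only [ne_eq, OfNat.ofNat_ne_zero, not_false_eq_true, zero_pow, zero_div, ite_self,
      add_zero]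
    refine Finset.sum_congr rfl fun p _ => ?_
    simp only [Fmat, Emat, of_apply, if_true, Fin.val_castSucc]
    have := hs0 n
    by_cases h : b = p.castSucc <;> by_cases h' : b' = p.castSucc <;> simp [h, h']
    field_simp
  have e2 : ∑ p : Fin (n + 1), Fmat q s n b (1, p) * Emat s n (1, p) b' =
      ∑ c : Fin (n + 2), if b = c ∧ b' = c then
        s c ^ 2 / (qnum q (n + 1 - c) + qnum q c) else 0 := by
    rw [Fin.sum_univ_succ (n := n + 1)]
    simp only [Fin.val_zero, h00]
    simp only [ne_eq, OfNat.ofNat_ne_zero, not_false_eq_true, zero_pow, zero_div, ite_self,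
      zero_add]
    refine Finset.sum_congr rfl fun p _ => ?_
    simp only [Fmat, Emat, of_apply, Fin.val_succ, one_ne_zero, if_false]
    have := hs0 n
    have e : ((n : ℤ) + 1 - ((p : ℕ) + 1 : ℕ)) = n - (p : ℕ) := by push_cast; ring
    rw [e]
    by_cases h : b = p.succ <;> by_cases h' : b' = p.succ <;> simp [h, h']
    field_simp
  rw [Matrix.mul_apply, Fintype.sum_prod_type, Fin.sum_univ_two, e1, e2, ← Finset.sum_add_distrib]
  by_cases hb : b = b'
  · subst hb
    rw [Finset.sum_eq_single b (fun c _ hc => by simp [hc.symm]) (by simp)]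
    have hle : (b : ℕ) ≤ n + 1 := by omega
    have := hden n b hle
    have e : ((n + 1 - (b : ℕ) : ℕ) : ℤ) = n + 1 - (b : ℕ) := by omega
    simp only [and_self, if_true, one_apply_eq, hs, e]
    rw [← add_div, div_self this]
  · rw [one_apply_ne hb]
    refine Finset.sum_eq_zero fun c _ => ?_
    have : ¬ (b = c ∧ b' = c) := fun h => hb (h.1.trans h.2.symm)
    simp [this]

/-- At the quotient `κ^{-n} : κ` of spectral parameters, the tensor product contains a copy of the
module of the next spin. The whole relation for `f` reduces to `[p+1] = κ^{-2p} + κ² [p]`, which is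
`hrec`; it holds for `κ = r` and for `κ = r⁻¹`, so one matrix `E` serves both lowering operators. -/
theorem Intw_Emat {κ : F} (hκ : κ ≠ 0)
    (hrec : ∀ p : ℕ, s (p + 1) ^ 2 = κ ^ (-2 * (p : ℤ)) + κ ^ 2 * s p ^ 2)
    (h00 : s 0 = 0) (n : ℕ) (z : L) :
    Intw ((Emat s n).map φ) (ev φ s (n + 1) κ z)
      ((ev φ s 1 κ (z * φ (κ ^ (-(n : ℤ))))).tens (ev φ s n κ (z * φ κ))) := by
  have hE0 : ∀ (p : Fin (n + 1)) (b : Fin (n + 2)), Emat s n ((0 : Fin (1 + 1)), p) b =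
      if (b : ℕ) = p then s (n + 1 - p) / s (n + 1) else 0 := Emat_zero n
  have hE1 : ∀ (p : Fin (n + 1)) (b : Fin (n + 2)), Emat s n ((1 : Fin (1 + 1)), p) b =
      if (b : ℕ) = p + 1 then s (p + 1) / s (n + 1) else 0 := Emat_one n
  have h11 : s 1 * s 1 = 1 := by
    have := hrec 0
    simpa [h00, sq] using this
  have cases : ∀ {P : Fin (1 + 1) × Fin (n + 1) → Prop}, (∀ p, P (0, p)) → (∀ p, P (1, p)) →
      ∀ x, P x := by
    rintro P h0 h1 ⟨a, p⟩
    obtain rfl | rfl : a = 0 ∨ a = 1 := by fin_cases a <;> simp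
    · exact h0 p
    · exact h1 p
  -- The value `c = 1` gives the relation for `k`, and `c = -1` the one for `k'`.
  have hdiag : ∀ c : ℤ, ∀ x : Fin (1 + 1) × Fin (n + 1), ∀ b : Fin (n + 2),
      (Emat s n).map φ x b * φ (κ ^ (c * (((n + 1 : ℕ) : ℤ) - 2 * (b : ℕ)))) =
        φ (κ ^ (c * (((1 : ℕ) : ℤ) - 2 * (x.1 : ℕ)))) * φ (κ ^ (c * ((n : ℤ) - 2 * (x.2 : ℕ)))) *
          (Emat s n).map φ x b := by
    intro c x b
    rw [← map_mul φ, ← zpow_add₀ hκ, mul_comm]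
    revert x
    refine cases (fun p => ?_) (fun p => ?_)
    · rw [map_apply, Emat_zero]
      split_ifs with h
      · congr 3
        rw [h]; push_cast; simp; ring
      · simp
    · rw [map_apply, Emat_one]
      split_ifs with h
      · congr 3
        rw [h]; push_cast; simp; ring
      · simp
  refine ⟨?_, ?_, ?_, ?_⟩
  · ext x b
    revert x
    have hL : ∀ (x : Fin (1 + 1) × Fin (n + 1)) (c : Fin (n + 2)),
        (∀ c', c' ≠ c → Emat s n x c' = 0) →
        ((Emat s n).map φ * (ev φ s (n + 1) κ z).f) x b =
          φ (Emat s n x c) * if (c : ℕ) = b + 1 then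
            z * φ (s (b + 1) * s (n + 1 - b)) else 0 := by
      intro x c hc
      rw [Matrix.mul_apply, Finset.sum_eq_single c (fun c' _ h => by simp [hc c' h]) (by simp)]
      simp [ev]
    have hR : ∀ (a : Fin (1 + 1)) (p : Fin (n + 1)),
        (((ev φ s 1 κ (z * φ (κ ^ (-(n : ℤ))))).tens (ev φ s n κ (z * φ κ))).f *
          (Emat s n).map φ) (a, p) b =
        (if a = 1 then z * φ (κ ^ (-(n : ℤ))) * φ (s 1 * s 1) * φ (κ ^ ((n : ℤ) - 2 * (p : ℕ))) *
          φ (Emat s n (0, p) b) else 0) +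
        φ (κ ^ (2 * (a : ℕ) - (1 : ℤ))) * ∑ p' : Fin (n + 1),
          (if (p : ℕ) = p' + 1 then z * φ κ * φ (s (p' + 1) * s (n - p')) else 0) *
            φ (Emat s n (a, p') b) := by
      intro a p
      rw [Rep.tens, Matrix.add_mul, Matrix.add_apply, Matrix.mul_apply, Matrix.mul_apply,
        Fintype.sum_prod_type, Fintype.sum_prod_type]
      congr 1
      · rw [Fin.sum_univ_two, Finset.sum_eq_single p (fun p' _ h => by
          simp [ev, h.symm]) (by simp)]
        obtain rfl | rfl : a = 0 ∨ a = 1 := by fin_cases a <;> simp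
        · simp [ev]
        · simp [ev]
      · rw [Finset.sum_eq_single a (fun p' _ h => by
          simp [ev, h.symm]) (by simp), Finset.mul_sum]
        simp [ev, mul_assoc]
    -- Only `p' = p - 1` contributes. At `p = 0` the truncated subtraction is harmless because of
    -- the factor `s 0 = 0`.
    have hS : ∀ (a : Fin 2) (p : Fin (n + 1)), ∑ p' : Fin (n + 1),
          (if (p : ℕ) = p' + 1 then z * φ κ * φ (s (p' + 1) * s (n - p')) else 0) *
            φ (Emat s n (a, p') b) =
        z * φ κ * φ (s p * s (n + 1 - p)) * φ (Emat s n (a, ⟨p - 1, by omega⟩) b) := by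
      intro a p
      by_cases hp : (p : ℕ) = 0
      · have hsp : s p = 0 := by rw [hp, h00]
        rw [hsp, zero_mul, map_zero, mul_zero, zero_mul]
        exact Finset.sum_eq_zero fun p' _ => by rw [if_neg (by omega), zero_mul]
      · rw [Finset.sum_eq_single ⟨p - 1, by omega⟩ (fun p' _ h' => by
          rw [if_neg, zero_mul]; exact fun h => h' (Fin.ext (by simp; omega))) (by simp)]
        have h1 : (p : ℕ) - 1 + 1 = p := by omega
        have h2 : n - ((p : ℕ) - 1) = n + 1 - p := by omega
        simp only [h1, h2, if_true]
    refine cases (fun p => ?_) (fun p => ?_)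
    · rw [hL (0, p) p.castSucc (fun c' h => by
        rw [Emat_zero, if_neg]; exact fun h' => h (Fin.ext h')), hR, hS]
      simp only [hE0, Fin.val_castSucc, if_true, zero_ne_one, if_false, zero_add]
      by_cases h : (p : ℕ) = b + 1
      · have e : φ (κ ^ (2 * ((0 : Fin (1 + 1)) : ℕ) - (1 : ℤ))) * φ κ = 1 := by
          rw [← map_mul]; simp [hκ]
        have h1 : (p : ℕ) - 1 = b := by omega
        have h2 : n + 1 - (b : ℕ) = n + 1 + 1 - p := by omega
        have h3 : s p = s (b + 1) := by rw [h]
        have h4 : n + 1 - (b + 1 : ℕ) = n + 1 - p := by omega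
        have h5 : n + 1 - ((b : ℕ) + 1) = n + 1 - p := by omega
        simp only [h1, if_true, if_pos h, h3]
        have hF : s (n + 1 - p) / s (n + 1) * (s (b + 1) * s (n + 1 - b)) =
            s (b + 1) * s (n + 1 - p) * (s (n + 1 - b) / s (n + 1)) := by ring
        have := congrArg (fun x => z * φ x) hF
        simp only [map_mul] at this ⊢
        linear_combination this - z * (φ (s (b + 1)) * φ (s (n + 1 - p)) *
          φ (s (n + 1 - b) / s (n + 1))) * e
      · rw [if_neg h]
        by_cases h1 : (b : ℕ) = p - 1
        · have : (p : ℕ) = 0 := by omega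
          rw [this, h00]; simp
        · rw [if_neg h1]; simp
    · rw [hL (1, p) p.succ (fun c' h => by
        rw [Emat_one, if_neg]; exact fun h' => h (Fin.ext h')), hR, hS]
      simp only [hE1, Emat_zero, Fin.val_succ, if_true]
      by_cases h : (b : ℕ) = p
      · have e : (if (b : ℕ) = (p : ℕ) - 1 + 1 then s ((p : ℕ) - 1 + 1) / s (n + 1) else 0) * s p =
            s p / s (n + 1) * s p := by
          by_cases hp : (p : ℕ) = 0
          · rw [hp, h00]; simp
          · have h1 : (p : ℕ) - 1 + 1 = p := by omega
            rw [h1, if_pos h]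
        have hr := hrec p
        have e1 : κ ^ (-(n : ℤ)) * κ ^ ((n : ℤ) - 2 * (p : ℕ)) = κ ^ (-2 * ((p : ℕ) : ℤ)) := by
          rw [← zpow_add₀ hκ]; congr 1; ring
        have e2 : κ ^ (2 * ((1 : Fin (1 + 1)) : ℕ) - (1 : ℤ)) = κ := by simp
        rw [e2, h, if_pos rfl, if_pos rfl]
        rw [h] at e
        -- Rows `(1, p)` receive both terms of the coproduct; this is where the recursion for `s`
        -- enters.
        have hF : s (p + 1) / s (n + 1) * (s (p + 1) * s (n + 1 - p)) =
            κ ^ (-(n : ℤ)) * (s 1 * s 1) * κ ^ ((n : ℤ) - 2 * (p : ℕ)) *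
              (s (n + 1 - p) / s (n + 1)) +
            κ * (κ * (s p * s (n + 1 - p)) * (if (p : ℕ) = (p : ℕ) - 1 + 1 then
              s ((p : ℕ) - 1 + 1) / s (n + 1) else 0)) := by
          linear_combination s (n + 1 - p) / s (n + 1) * (hr - e1 - κ ^ (-(n : ℤ)) *
            κ ^ ((n : ℤ) - 2 * (p : ℕ)) * h11) - κ * κ * s (n + 1 - p) * e
        have := congrArg (fun x => z * φ x) hF
        simp only [map_mul, map_add] at this ⊢
        linear_combination this
      · have h1 : ¬ (p : ℕ) + 1 = b + 1 := by omega
        rw [if_neg h1, if_neg h]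
        by_cases h2 : (b : ℕ) = p - 1 + 1
        · have : (p : ℕ) = 0 := by omega
          rw [this, h00]; simp
        · rw [if_neg h2]; simp
  · ext x b
    simp only [ev, Rep.tens, diagonal_kronecker_diagonal, diagonal_mul, mul_diagonal]
    simpa using hdiag 1 x b
  · ext x b
    simp only [ev, Rep.tens, diagonal_kronecker_diagonal, diagonal_mul, mul_diagonal]
    simpa using hdiag (-1) x b
  · ext x b
    revert x
    have hL : ∀ x, ((Emat s n).map φ * (ev φ s (n + 1) κ z).J) x b =
        φ (Emat s n x b.rev) := by
      intro x
      rw [Matrix.mul_apply, Finset.sum_eq_single b.rev (fun c _ h => ?_) (by simp)]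
      · have : (b.rev : ℕ) + b = n + 1 := by rw [Fin.val_rev]; omega
        simp [ev, this, -Fin.val_rev]
      · have : ¬ (c : ℕ) + b = n + 1 := fun h' => h (Fin.ext (by rw [Fin.val_rev]; omega))
        simp [ev, this, -Fin.val_rev]
    have hR : ∀ (a : Fin (1 + 1)) (p : Fin (n + 1)),
        (((ev φ s 1 κ (z * φ (κ ^ (-(n : ℤ))))).tens (ev φ s n κ (z * φ κ))).J *
          (Emat s n).map φ) (a, p) b = φ (Emat s n (a.rev, p.rev) b) := by
      intro a p
      rw [Matrix.mul_apply, Finset.sum_eq_single (a.rev, p.rev) (fun c _ h => ?_) (by simp)]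
      · have h1 : (a : ℕ) + a.rev = 1 := by rw [Fin.val_rev]; omega
        have h2 : (p : ℕ) + p.rev = n := by rw [Fin.val_rev]; omega
        simp [ev, Rep.tens, h1, h2, -Fin.val_rev]
      · have : ¬ ((a : ℕ) + c.1 = 1 ∧ (p : ℕ) + c.2 = n) := fun h' =>
          h (Prod.ext (Fin.ext (by rw [Fin.val_rev]; omega)) (Fin.ext (by rw [Fin.val_rev]; omega)))
        simp only [not_and_or] at this
        rcases this with h | h <;> simp [ev, Rep.tens, h]
    refine cases (fun p => ?_) (fun p => ?_)
    · rw [hL, hR]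
      have : (0 : Fin (1 + 1)).rev = 1 := rfl
      rw [this, Emat_zero, Emat_one, Fin.val_rev, Fin.val_rev]
      have h1 : n + 1 - (p + 1) + 1 = n + 1 - p := by omega
      rw [h1]
      congr 2
      apply propext; omega
    · rw [hL, hR]
      have : (1 : Fin (1 + 1)).rev = 0 := rfl
      rw [this, Emat_zero, Emat_one, Fin.val_rev, Fin.val_rev]
      have h1 : n + 1 - (n + 1 - (p + 1)) = p + 1 := by omega
      rw [h1]
      congr 2
      apply propext; omega

end Fusion

end FreidelMaillet

namespace FreidelMaillet

open Matrix
open scoped Kronecker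

/-! ### Fusion of the R-matrices of evaluation modules -/

section Fuse

variable {F L : Type*} [Field F] [CommRing L] {φ : F →+* L} {s : ℕ → F}

theorem leg12F_mul_leg12E {α β γ δ : Type*} [Fintype α] [Fintype β] [Fintype γ] [Fintype δ]
    [DecidableEq γ] [DecidableEq δ] {P : Matrix δ (α × β) L} {E : Matrix (α × β) δ L}
    (h : P * E = 1) : leg12F γ P * leg12E γ E = 1 := by
  rw [leg12F, leg12E, Matrix.submatrix_mul_equiv, ← mul_kronecker_mul, h, Matrix.one_mul,
    one_kronecker_one, submatrix_id_id]

theorem leg23F_mul_leg23E {α β γ δ : Type*} [Fintype α] [Fintype β] [Fintype γ] [Fintype δ]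
    [DecidableEq α] [DecidableEq δ] {P : Matrix δ (β × γ) L} {E : Matrix (β × γ) δ L}
    (h : P * E = 1) : leg23F α P * leg23E α E = 1 := by
  rw [leg23F, leg23E, ← mul_kronecker_mul, h, Matrix.one_mul, one_kronecker_one]

/-- The highest weight vector goes to the highest weight vector with coefficient one, as
`Intw.project` requires. -/
theorem Emat_col_zero (hs0 : ∀ n, s (n + 1) ≠ 0) (n : ℕ) (x : Fin 2 × Fin (n + 1)) :
    Emat s n x 0 = if x = 0 then 1 else 0 := by
  obtain ⟨a, p⟩ := x
  obtain rfl | rfl : a = 0 ∨ a = 1 := by fin_cases a <;> simp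
  · rw [Emat_zero]
    by_cases h : p = 0
    · subst h; simp [hs0 n, Prod.ext_iff]
    · have h' : ¬ 0 = (p : ℕ) := fun e => h (Fin.ext e.symm)
      simp [h', h, Prod.ext_iff]
  · rw [Emat_one]
    simp [Prod.ext_iff]

variable [IsDomain L] {κ : F} {z z' : L}

theorem IntwEv.fuse_left (hκ : κ ≠ 0) (hκ1 : ∀ n : ℤ, κ ^ n = 1 → n = 0)
    (hz : z * z' = 1) (hgen : ∀ n : ℤ, z * z * φ (κ ^ n) ≠ 1)
    (hs0 : ∀ n, s (n + 1) ≠ 0) (h00 : s 0 = 0)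
    (hrec : ∀ p : ℕ, s (p + 1) ^ 2 = κ ^ (-2 * (p : ℤ)) + κ ^ 2 * s p ^ 2)
    (hrec' : ∀ p : ℕ, s (p + 1) ^ 2 = κ⁻¹ ^ (-2 * (p : ℤ)) + κ⁻¹ ^ 2 * s p ^ 2)
    {n m : ℕ} {P : Matrix (Fin (n + 2)) (Fin 2 × Fin (n + 1)) L}
    (hP : P * (Emat s n).map φ = 1)
    {R₁ : Matrix (Fin 2 × Fin (m + 1)) (Fin 2 × Fin (m + 1)) L}
    {R₂ : Matrix (Fin (n + 1) × Fin (m + 1)) (Fin (n + 1) × Fin (m + 1)) L}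
    (h₁ : IntwEv φ s 1 m κ (z * φ (κ ^ (-(n : ℤ)))) R₁)
    (h₁' : IntwEv φ s 1 m κ⁻¹ (z' * φ (κ⁻¹ ^ (-(n : ℤ)))) R₁)
    (h₂ : IntwEv φ s n m κ (z * φ κ) R₂) (h₂' : IntwEv φ s n m κ⁻¹ (z' * φ κ⁻¹) R₂) :
    let R := leg12F (Fin (m + 1)) P * leg13 (β := Fin (n + 1)) R₁ * leg23 (α := Fin 2) R₂ *
      leg12E (Fin (m + 1)) ((Emat s n).map φ)
    IntwEv φ s (n + 1) m κ z R ∧ IntwEv φ s (n + 1) m κ⁻¹ z' R := by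
  intro R
  have hE := Intw_Emat (φ := φ) hκ hrec h00 n z
  have hE' := Intw_Emat (φ := φ) (inv_ne_zero hκ) hrec' h00 n z'
  have hX := Intw.fuse_left h₁ h₂ hE
  have hX' := Intw.fuse_left h₁' h₂' hE'
  -- Any left inverse `P` of `E` will do: the image of `R₁₃ R₂₃ E₁₂` is already contained in that of
  -- `E₁₂`.
  have := Intw.project hκ hκ1 hz hgen hs0 hX hX' (hE.leg12E_op _) (hE'.leg12E_op _)
    (leg12F_mul_leg12E hP) (fun t => t.1 + t.2.1 + t.2.2) ?_ (0, 0, 0) ?_ (0, 0) ?_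
  · simpa only [R, IntwEv, Matrix.mul_assoc] using this
  · simp only [Rep.reindex, Rep.tensOp, Rep.tens, ev, diagonal_kronecker_diagonal]
    rw [Matrix.submatrix_diagonal_equiv]
    congr 1
    funext t
    simp only [Function.comp, Equiv.prodAssoc_symm_apply, ← map_mul, ← zpow_add₀ hκ]
    congr 2
    push_cast; ring
  · rintro ⟨a, b, c⟩ h
    simp only [Nat.add_eq_zero_iff, Fin.val_eq_zero_iff] at h
    simp [h]
  · rw [mulVec_single_one]
    funext ⟨a, b, c⟩
    simp only [leg12E, col_apply, submatrix_apply, Equiv.prodAssoc_symm_apply, id, kronecker_apply,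
      map_apply, Emat_col_zero hs0, Pi.single_apply, one_apply, Prod.ext_iff]
    by_cases ha : a = 0 <;> by_cases hb : b = 0 <;> by_cases hc : c = 0 <;> simp [ha, hb, hc]

theorem IntwEv.fuse_right (hκ : κ ≠ 0) (hκ1 : ∀ n : ℤ, κ ^ n = 1 → n = 0)
    (hz : z * z' = 1) (hgen : ∀ n : ℤ, z * z * φ (κ ^ n) ≠ 1)
    (hs0 : ∀ n, s (n + 1) ≠ 0) (h00 : s 0 = 0)
    (hrec : ∀ p : ℕ, s (p + 1) ^ 2 = κ ^ (-2 * (p : ℤ)) + κ ^ 2 * s p ^ 2)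
    (hrec' : ∀ p : ℕ, s (p + 1) ^ 2 = κ⁻¹ ^ (-2 * (p : ℤ)) + κ⁻¹ ^ 2 * s p ^ 2)
    {n : ℕ} {P : Matrix (Fin (n + 2)) (Fin 2 × Fin (n + 1)) L}
    (hP : P * (Emat s n).map φ = 1)
    {R₁ : Matrix (Fin 2 × Fin (n + 1)) (Fin 2 × Fin (n + 1)) L}
    {R₂ : Matrix (Fin 2 × Fin 2) (Fin 2 × Fin 2) L}
    (h₁ : IntwEv φ s 1 n κ (z * φ κ⁻¹) R₁) (h₁' : IntwEv φ s 1 n κ⁻¹ (z' * φ κ) R₁)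
    (h₂ : IntwEv φ s 1 1 κ (z * φ (κ ^ n)) R₂) (h₂' : IntwEv φ s 1 1 κ⁻¹ (z' * φ (κ⁻¹ ^ n)) R₂) :
    let R := leg23F (Fin 2) P * leg13 (β := Fin 2) R₁ * leg12 (γ := Fin (n + 1)) R₂ *
      leg23E (Fin 2) ((Emat s n).map φ)
    IntwEv φ s 1 (n + 1) κ z R ∧ IntwEv φ s 1 (n + 1) κ⁻¹ z' R := by
  intro R
  have hE := Intw_Emat (φ := φ) hκ hrec h00 n 1
  have hE' := Intw_Emat (φ := φ) (inv_ne_zero hκ) hrec' h00 n 1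
  -- The fused leg has spectral parameter `1` and its constituents have `κ^{-n}` and `κ`, so the
  -- quotients with `z` are `z κ^n` and `z κ⁻¹`.
  have e₁ : z = z * φ κ⁻¹ * (1 * φ κ) := by
    rw [one_mul, mul_assoc, ← map_mul, inv_mul_cancel₀ hκ, map_one, mul_one]
  have e₁' : z' = z' * φ κ * (1 * φ κ⁻¹) := by
    rw [one_mul, mul_assoc, ← map_mul, mul_inv_cancel₀ hκ, map_one, mul_one]
  have e₂ : z = z * φ (κ ^ n) * (1 * φ (κ ^ (-(n : ℤ)))) := by
    rw [one_mul, mul_assoc, ← map_mul, _root_.zpow_neg, zpow_natCast,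
      mul_inv_cancel₀ (pow_ne_zero _ hκ), map_one, mul_one]
  have e₂' : z' = z' * φ (κ⁻¹ ^ n) * (1 * φ (κ⁻¹ ^ (-(n : ℤ)))) := by
    rw [one_mul, mul_assoc, ← map_mul, _root_.zpow_neg, zpow_natCast,
      mul_inv_cancel₀ (pow_ne_zero _ (inv_ne_zero hκ)), map_one, mul_one]
  have hX := Intw.fuse_right (h₁.scale e₁) (h₂.scale e₂) hE
  have hX' := Intw.fuse_right (h₁'.scale e₁') (h₂'.scale e₂') hE'
  have := Intw.project hκ hκ1 hz hgen hs0 hX hX'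
    (Intw.kronOp (Intw.one _) hE) (Intw.kronOp (Intw.one _) hE')
    (leg23F_mul_leg23E hP) (fun t => t.1 + t.2.1 + t.2.2) ?_ (0, 0, 0) ?_ (0, 0) ?_
  · simpa only [R, IntwEv, Matrix.mul_assoc] using this
  · simp only [Rep.tensOp, Rep.tens, ev, diagonal_kronecker_diagonal]
    congr 1
    funext t
    simp only [← map_mul, ← zpow_add₀ hκ]
    congr 2
    push_cast; ring
  · rintro ⟨a, b, c⟩ h
    simp only [Nat.add_eq_zero_iff, Fin.val_eq_zero_iff] at h
    simp [h]
  · rw [mulVec_single_one]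
    funext ⟨a, b, c⟩
    simp only [col_apply, kronecker_apply,
      map_apply, Emat_col_zero hs0, Pi.single_apply, one_apply, Prod.ext_iff]
    by_cases ha : a = 0 <;> by_cases hb : b = 0 <;> by_cases hc : c = 0 <;> simp [ha, hb, hc]

end Fuse

end FreidelMaillet

namespace FreidelMaillet

/-! ### The parameters -/

section Parameters

variable {F : Type*} [Field F]

/-- `r` is a square root of `q`, which is not a root of unity, and `s n` is a square root
of `[n]_q`. -/
structure IsParam (q r : F) (s : ℕ → F) : Prop where
  q0 : q ≠ 0
  hq : ∀ n : ℕ, 0 < n → q ^ n ≠ 1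
  hr : r ^ 2 = q
  hs : ∀ n : ℕ, s n ^ 2 = qnum q n
  two : (2 : F) ≠ 0

namespace IsParam

variable {q r : F} {s : ℕ → F} (h : IsParam q r s)

include h

theorem r0 : r ≠ 0 := by
  rintro rfl
  exact h.q0 (by rw [← h.hr]; simp)

theorem q_zpow {n : ℤ} (hn : q ^ n = 1) : n = 0 := by
  by_contra hne
  refine h.hq n.natAbs (Int.natAbs_pos.2 hne) ?_
  rcases Int.natAbs_eq n with e | e
  · rw [e, zpow_natCast] at hn
    exact hn
  · rw [e, zpow_neg, zpow_natCast, inv_eq_one] at hn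
    exact hn

theorem r_zpow {n : ℤ} (hn : r ^ n = 1) : n = 0 := by
  refine h.q_zpow ?_
  rw [← h.hr, ← zpow_natCast, ← zpow_mul, mul_comm, zpow_mul, hn, one_zpow]

theorem den : q - q⁻¹ ≠ 0 := by
  intro e
  have h2 : q ^ (2 : ℤ) = 1 := by
    have := h.q0
    have e' : q * q = 1 := by
      nth_rw 2 [sub_eq_zero.1 e]
      exact mul_inv_cancel₀ h.q0
    rw [zpow_two, e']
  have := h.q_zpow h2
  omega

theorem qnum_eq (n : ℤ) : qnum q n * (q - q⁻¹) = q ^ n - (q ^ n)⁻¹ := by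
  rw [qnum, div_mul_cancel₀ _ h.den, zpow_neg]

theorem qnum_ne_zero {n : ℤ} (hn : n ≠ 0) : qnum q n ≠ 0 := by
  rw [qnum, Ne, div_eq_zero_iff, not_or]
  refine ⟨fun e => hn ?_, h.den⟩
  have : q ^ (2 * n) = 1 := by
    rw [two_mul, zpow_add₀ h.q0]
    nth_rw 2 [sub_eq_zero.1 e]
    rw [← zpow_add₀ h.q0]
    simp
  have := h.q_zpow this
  omega

theorem s_ne_zero (n : ℕ) : s (n + 1) ≠ 0 := by
  intro e
  have := h.hs (n + 1)
  rw [e] at this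
  exact h.qnum_ne_zero (n := ((n + 1 : ℕ) : ℤ)) (by omega) (by rw [← this]; simp)

theorem s_zero : s 0 = 0 := by
  have := h.hs 0
  simpa [qnum] using this

theorem q_eq_r (n : ℤ) : q ^ n = r ^ (2 * n) := by
  rw [← h.hr, ← zpow_natCast, ← zpow_mul]; simp

/-- This is `[p+1] = q^{-p} + q [p]`. Replacing `q` by `q⁻¹`, which fixes the `q`-integers, gives
`rec_r_inv`. -/
theorem rec_r (p : ℕ) : s (p + 1) ^ 2 = r ^ (-2 * (p : ℤ)) + r ^ 2 * s p ^ 2 := by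
  have e1 := h.qnum_eq p
  have e2 := h.qnum_eq (p + 1)
  have e3 : r ^ (-2 * (p : ℤ)) = (q ^ (p : ℤ))⁻¹ := by
    rw [h.q_eq_r, ← zpow_neg, neg_mul]
  rw [h.hs, h.hs, h.hr, e3]
  refine mul_right_cancel₀ h.den ?_
  push_cast
  rw [add_mul, mul_assoc, e1, e2, zpow_add₀ h.q0, zpow_one]
  have := h.q0
  have := zpow_ne_zero (p : ℤ) h.q0
  field_simp
  ring

theorem rec_r_inv (p : ℕ) : s (p + 1) ^ 2 = r⁻¹ ^ (-2 * (p : ℤ)) + r⁻¹ ^ 2 * s p ^ 2 := by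
  have e1 := h.qnum_eq p
  have e2 := h.qnum_eq (p + 1)
  have e3 : r⁻¹ ^ (-2 * (p : ℤ)) = q ^ (p : ℤ) := by
    rw [h.q_eq_r, inv_zpow, ← zpow_neg]; congr 1; ring
  rw [h.hs, h.hs, inv_pow, h.hr, e3]
  refine mul_right_cancel₀ h.den ?_
  push_cast
  rw [add_mul, mul_assoc, e1, e2, zpow_add₀ h.q0, zpow_one]
  have := h.q0
  have := zpow_ne_zero (p : ℤ) h.q0
  field_simp
  ring

/-- Up to a unit, `[a] + [b]` is `(q^{a+b} - 1)(q^a + q^b)`. If the second factor vanishes then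
`q^{2(a-b)} = 1`, so `a = b` and `2 q^b = 0`, which is excluded as `2 ≠ 0`. -/
theorem qnum_add_ne_zero (a b : ℤ) (hab : 0 < a + b) : qnum q a + qnum q b ≠ 0 := by
  intro e
  have e1 := h.qnum_eq a
  have e2 := h.qnum_eq b
  have e3 : (q ^ (a + b) - 1) * (q ^ a + q ^ b) = 0 := by
    have ha := zpow_ne_zero a h.q0
    have hb := zpow_ne_zero b h.q0
    have : q ^ a - (q ^ a)⁻¹ + (q ^ b - (q ^ b)⁻¹) = 0 := by
      rw [← e1, ← e2, ← add_mul, e, zero_mul]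
    rw [zpow_add₀ h.q0]
    field_simp at this
    linear_combination this
  rcases mul_eq_zero.1 e3 with e4 | e4
  · have := h.q_zpow (sub_eq_zero.1 e4)
    omega
  · have e5 : q ^ a = - q ^ b := eq_neg_of_add_eq_zero_left e4
    have e6 : q ^ (2 * (a - b)) = 1 := by
      rw [mul_comm, zpow_mul, zpow_sub₀ h.q0, e5, neg_div, div_self (zpow_ne_zero b h.q0)]
      norm_num
    have := h.q_zpow e6
    have e7 : a = b := by omega
    rw [e7, ← two_mul] at e4
    exact (mul_ne_zero h.two (zpow_ne_zero b h.q0)) e4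

theorem Fmat_mul_Emat (n : ℕ) : Fmat q s n * Emat s n = 1 :=
  FreidelMaillet.Fmat_mul_Emat h.hs h.s_ne_zero
    (fun n b _ => h.qnum_add_ne_zero _ _ (by omega)) n

end IsParam

end Parameters

/-! ### The R-matrices intertwine -/

section RMatrix

open Matrix LaurentPolynomial
open scoped Kronecker

variable {F : Type*} [Field F]

/-- The substitution `T ↦ c T` as a ring homomorphism. -/
def rescaleHom {c : F} (hc : c ≠ 0) : LaurentPolynomial F →+* LaurentPolynomial F :=
  eval₂ C
    ⟨C c * T 1, C c⁻¹ * T (-1), by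
      rw [mul_mul_mul_comm, ← map_mul, ← T_add, mul_inv_cancel₀ hc]; simp,
      by rw [mul_mul_mul_comm, ← map_mul, ← T_add, inv_mul_cancel₀ hc]; simp⟩

theorem rescale_add (c : F) (f g : LaurentPolynomial F) :
    rescale c (f + g) = rescale c f + rescale c g :=
  Finsupp.sum_add_index' (fun n => by simp) (fun n a b => by rw [add_mul, map_add, add_mul])

theorem rescale_C_mul_T (c : F) (n : ℤ) (a : F) :
    rescale c (C a * T n) = C (a * c ^ n) * T n := by
  rw [← single_eq_C_mul_T, rescale, AddMonoidAlgebra.coeff_single, Finsupp.sum_single_index]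
  simp

theorem rescaleHom_apply {c : F} (hc : c ≠ 0) (f : LaurentPolynomial F) :
    rescaleHom hc f = rescale c f := by
  induction f using LaurentPolynomial.induction_on' with
  | add p q hp hq => rw [map_add, rescale_add, hp, hq]
  | C_mul_T n a =>
    rw [rescale_C_mul_T, rescaleHom, eval₂_C_mul_T, map_mul, mul_assoc]
    congr 1
    rcases Int.natAbs_eq n with e | e
    · rw [e, zpow_natCast, zpow_natCast, Units.val_pow_eq_pow_val, mul_pow, T_pow, ← map_pow]
      simp
    · rw [e, _root_.zpow_neg, _root_.zpow_neg, zpow_natCast, zpow_natCast, ← inv_pow, ← inv_pow,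
        Units.val_pow_eq_pow_val, Units.inv_mk, mul_pow, T_pow, ← map_pow]
      simp

theorem map_rescale {ι : Type*} {c : F} (hc : c ≠ 0) (M : Matrix ι ι (LaurentPolynomial F)) :
    M.map (rescale c) = M.map (rescaleHom hc) := by
  ext i j
  rw [map_apply, map_apply, rescaleHom_apply]

/-- Both intertwining relations for a matrix `R(T)`. -/
def IntwT (r : F) (s : ℕ → F) (m₁ m₂ : ℕ) (R : Matrix (Fin (m₁ + 1) × Fin (m₂ + 1))
    (Fin (m₁ + 1) × Fin (m₂ + 1)) (LaurentPolynomial F)) : Prop :=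
  IntwEv C s m₁ m₂ r (T 1) R ∧ IntwEv C s m₁ m₂ r⁻¹ (T (-1)) R

/-- The substitution `T ↦ cT` scales `T⁻¹` by `c⁻¹`, whence inverse scalars in the two relations. -/
theorem IntwT.rescale {r : F} {s : ℕ → F} {m₁ m₂ : ℕ} {R : Matrix (Fin (m₁ + 1) × Fin (m₂ + 1))
    (Fin (m₁ + 1) × Fin (m₂ + 1)) (LaurentPolynomial F)} (h : IntwT r s m₁ m₂ R) {c : F}
    (hc : c ≠ 0) :
    IntwEv C s m₁ m₂ r (T 1 * C c) (R.map (rescale c)) ∧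
      IntwEv C s m₁ m₂ r⁻¹ (T (-1) * C c⁻¹) (R.map (rescale c)) := by
  have e : (rescaleHom hc).comp C = C := by
    ext1 a
    rw [RingHom.comp_apply, rescaleHom, eval₂_C]
  have e1 : rescaleHom hc (T 1) = T 1 * C c := by
    rw [rescaleHom, eval₂_T, zpow_one]
    exact mul_comm _ _
  have e2 : rescaleHom hc (T (-1)) = T (-1) * C c⁻¹ := by
    rw [rescaleHom, eval₂_T, _root_.zpow_neg, zpow_one, Units.inv_mk]
    exact mul_comm _ _
  have h1 := h.1.map (rescaleHom hc)
  have h2 := h.2.map (rescaleHom hc)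
  rw [e, e1] at h1
  rw [e, e2] at h2
  rw [map_rescale hc]
  exact ⟨h1, h2⟩

theorem Rbase_apply (q : F) (x y : Fin 2 × Fin 2) : Rbase q x y =
    if x = y then (if x.1 = x.2 then cT q else cT 1)
    else if x.1 = y.2 ∧ x.2 = y.1 then C (q - q⁻¹) else 0 := by
  obtain ⟨a, b⟩ := x
  obtain ⟨c, d⟩ := y
  fin_cases a <;> fin_cases b <;> fin_cases c <;> fin_cases d <;> rfl

variable {q r : F} {s : ℕ → F}

-- For a matrix of six-vertex shape the relations for `k`, `k'` and `J` are automatic, and the one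
-- for `f` has just four nontrivial entries. With `κ` and `ζ` free, the lemma covers both `(r, T)`
-- and `(r⁻¹, T⁻¹)`.
set_option maxHeartbeats 1000000 in
theorem sixVertex_intw {L : Type*} [CommRing L] {φ : F →+* L} {κ : F} {ζ A B D : L}
    {R : Matrix (Fin 2 × Fin 2) (Fin 2 × Fin 2) L}
    (hR : ∀ x y, R x y = if x = y then (if x.1 = x.2 then A else B)
      else if x.1 = y.2 ∧ x.2 = y.1 then D else 0)
    (hs0 : s 0 = 0) (hs1 : s 1 * s 1 = 1)
    (h₁ : B * φ κ⁻¹ + D * (φ κ * ζ) = φ κ * A) (h₂ : D * φ κ⁻¹ + B * (φ κ * ζ) = φ κ⁻¹ * ζ * A)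
    (h₃ : A * (φ κ⁻¹ * ζ) = φ κ * ζ * B + φ κ⁻¹ * D) (h₄ : A * φ κ = φ κ * ζ * D + φ κ⁻¹ * B) :
    IntwEv φ s 1 1 κ ζ R := by
  have hs2 : φ (s 1) * φ (s 1) = 1 := by rw [← map_mul, hs1, map_one]
  refine ⟨?_, ?_, ?_, ?_⟩
  · refine Matrix.ext fun ⟨a, b⟩ ⟨c, d⟩ => ?_
    fin_cases a <;> fin_cases b <;> fin_cases c <;> fin_cases d <;>
    simp [Matrix.mul_apply, Fintype.sum_prod_type, Fin.sum_univ_two, hR, ev, Rep.tens,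
        Rep.tensOp, hs2, diagonal_apply, hs0]
    · linear_combination h₁
    · linear_combination h₂
    · linear_combination h₃
    · linear_combination h₄
  all_goals
    refine Matrix.ext fun ⟨a, b⟩ ⟨c, d⟩ => ?_
    fin_cases a <;> fin_cases b <;> fin_cases c <;> fin_cases d <;>
    simp [Matrix.mul_apply, Fintype.sum_prod_type, hR, ev, Rep.tens, Rep.tensOp, diagonal_apply,
      mul_comm]

theorem IsParam.intwT_Rbase (h : IsParam q r s) : IntwT r s 1 1 (Rbase q) := by
  have hs1 : s 1 * s 1 = 1 := by
    have := h.rec_r 0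
    simpa [h.s_zero, sq] using this
  have hC : C r * C r⁻¹ = (1 : LaurentPolynomial F) := by
    rw [← map_mul, mul_inv_cancel₀ h.r0, map_one]
  have hT : T 1 * T (-1) = (1 : LaurentPolynomial F) := by
    rw [← T_add]; simp
  have hq : C q = C r * C r := by rw [← map_mul, ← sq, h.hr]
  have hq' : C q⁻¹ = C r⁻¹ * C r⁻¹ := by rw [← map_mul, ← sq, inv_pow, h.hr]
  constructor <;> refine sixVertex_intw (Rbase_apply q) h.s_zero hs1 ?_ ?_ ?_ ?_ <;>
    simp only [cT, map_sub, hq, hq', inv_one, map_one, one_mul, inv_inv] <;>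
    generalize C r = x at * <;> generalize C r⁻¹ = y at * <;>
    generalize (T 1 : LaurentPolynomial F) = t at * <;> generalize (T (-1) : LaurentPolynomial F) =
      u at * <;>
    clear hs1 hq hq' h <;> grind

/-- The genericity needed by `eq_zero_of_lowering`: a multiple of `T²` has no constant term. -/
theorem T_sq_mul_C_ne_one (a : F) : T 1 * T 1 * C a ≠ 1 := by
  intro e
  rw [← T_add, mul_comm, ← single_eq_C_mul_T] at e
  have := congrArg (fun f : LaurentPolynomial F => f.coeff 0) e
  rw [AddMonoidAlgebra.coeff_single, ← T_zero, T_apply, Finsupp.single_apply] at this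
  simp at this

theorem IsParam.intwT_Rhalf (h : IsParam q r s) (n : ℕ) :
    IntwT r s 1 (n + 1) (Rhalf q r s (n + 1)) := by
  have hT : T 1 * T (-1) = (1 : LaurentPolynomial F) := by
    rw [← T_add]; simp
  induction n with
  | zero => exact h.intwT_Rbase
  | succ n ih =>
    have hP : (Fmat q s (n + 1)).map (C : F →+* LaurentPolynomial F) *
        (Emat s (n + 1)).map C = 1 := by
      rw [← Matrix.map_mul, h.Fmat_mul_Emat, Matrix.map_one _ (map_zero _) (map_one _)]
    have h₁ := ih.rescale (inv_ne_zero h.r0)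
    have h₂ := h.intwT_Rbase.rescale (pow_ne_zero (n + 1) h.r0)
    rw [inv_inv] at h₁
    rw [← inv_pow] at h₂
    exact IntwEv.fuse_right h.r0 (fun _ => h.r_zpow) hT (fun _ => T_sq_mul_C_ne_one _) h.s_ne_zero
      h.s_zero h.rec_r
      h.rec_r_inv hP h₁.1 h₁.2 h₂.1 h₂.2

theorem IsParam.intwT_Rmat (h : IsParam q r s) (n m : ℕ) :
    IntwT r s (n + 1) (m + 1) (Rmat q r s (m + 1) (n + 1)) := by
  have hT : T 1 * T (-1) = (1 : LaurentPolynomial F) := by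
    rw [← T_add]; simp
  induction n with
  | zero => exact h.intwT_Rhalf m
  | succ n ih =>
    have hP : (Fmat q s (n + 1)).map (C : F →+* LaurentPolynomial F) *
        (Emat s (n + 1)).map C = 1 := by
      rw [← Matrix.map_mul, h.Fmat_mul_Emat, Matrix.map_one _ (map_zero _) (map_one _)]
    have h₁ := (h.intwT_Rhalf m).rescale (inv_ne_zero (pow_ne_zero (n + 1) h.r0))
    have h₂ := ih.rescale h.r0
    have e1 : (r ^ (n + 1))⁻¹ = r ^ (-((n + 1 : ℕ) : ℤ)) := by
      rw [_root_.zpow_neg, zpow_natCast]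
    have e2 : ((r ^ (n + 1))⁻¹)⁻¹ = r⁻¹ ^ (-((n + 1 : ℕ) : ℤ)) := by
      rw [_root_.zpow_neg, zpow_natCast, inv_pow]
    rw [e2] at h₁
    rw [e1] at h₁
    have := IntwEv.fuse_left h.r0 (fun _ => h.r_zpow) hT (fun _ => T_sq_mul_C_ne_one _) h.s_ne_zero
      h.s_zero h.rec_r
      h.rec_r_inv hP h₁.1 h₁.2 h₂.1 h₂.2
    rw [← e1] at this
    exact this

end RMatrix

end FreidelMaillet

namespace FreidelMaillet

/-! ### Coefficients of words, and the Leibniz rule -/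

section Words

variable {F : Type*} [Field F] {q : F}

/-- The coefficient of a word. -/
def coeffW (w : List Letter) : Shuffle F q →ₗ[F] F :=
  linExt fun v => if v = w then 1 else 0

theorem coeffW_word (w v : List Letter) : coeffW w (word q v) = if v = w then 1 else 0 :=
  linExt_word _ v

theorem coeffW_apply (w : List Letter) (f : Shuffle F q) :
    coeffW w f = DFunLike.coe (F := List Letter →₀ F) f w := by
  have : coeffW (q := q) w = (Finsupp.lapply w : (List Letter →₀ F) →ₗ[F] F) := by
    refine hom_ext (q := q) fun v => ?_
    rw [coeffW_word]
    exact (Finsupp.single_apply (a := v) (a' := w) (b := (1 : F))).symm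
  exact LinearMap.congr_fun this f

theorem shuffle_ext {f g : Shuffle F q} (h : ∀ w, coeffW w f = coeffW w g) : f = g := by
  refine Finsupp.ext (M := F) (α := List Letter) fun w => ?_
  exact (coeffW_apply w f).symm.trans ((h w).trans (coeffW_apply w g))

theorem leftQuot_word_nil (a : Letter) : leftQuot q a (word q []) = 0 := linExt_word _ _

theorem leftQuot_word_cons (a b : Letter) (w : List Letter) :
    leftQuot q a (word q (b :: w)) = if b = a then word q w else 0 := linExt_word _ _

theorem leftQuot_consL (a b : Letter) (z : Shuffle F q) :
    leftQuot q a (consL q b z) = if b = a then z else 0 := by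
  induction z using word_induction with
  | hw w => rw [consL_word, leftQuot_word_cons]
  | hadd f g hf hg => rw [map_add, map_add, hf, hg]; split_ifs <;> simp
  | hsmul c f hf => rw [map_smul, map_smul, hf]; split_ifs <;> simp

theorem coeffW_leftQuot (a : Letter) (w : List Letter) (f : Shuffle F q) :
    coeffW w (leftQuot q a f) = coeffW (a :: w) f := by
  induction f using word_induction with
  | hw v =>
    cases v with
    | nil => rw [leftQuot_word_nil, map_zero, coeffW_word, if_neg (by simp)]
    | cons b v =>
      rw [leftQuot_word_cons, coeffW_word]
      by_cases h : b = a
      · simp [h, coeffW_word]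
      · simp [h]
  | hadd f g hf hg => rw [map_add, map_add, hf, hg, map_add]
  | hsmul c f hf => rw [map_smul, map_smul, hf, map_smul]

theorem coeffW_rightQuot (a : Letter) (w : List Letter) (f : Shuffle F q) :
    coeffW w (rightQuot q a f) = coeffW (w ++ [a]) f := by
  induction f using word_induction with
  | hw v =>
    have : rightQuot q a (word q v) = if v.getLast? = some a then word q v.dropLast else 0 :=
      linExt_word _ _
    rw [this, coeffW_word]
    induction v using List.reverseRecOn with
    | nil => simp
    | append_singleton v b _ =>
      by_cases h : b = a
      · simp [h, coeffW_word]
      · simp [h]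
  | hadd f g hf hg => rw [map_add, map_add, hf, hg, map_add]
  | hsmul c f hf => rw [map_smul, map_smul, hf, map_smul]

theorem coeffW_leftQuot_pow (a : Letter) (n : ℕ) (w : List Letter) (f : Shuffle F q) :
    coeffW w ((leftQuot q a ^ n) f) = coeffW (List.replicate n a ++ w) f := by
  induction n generalizing w with
  | zero => simp
  | succ n ih =>
    rw [pow_succ', Module.End.mul_apply, coeffW_leftQuot, ih, List.replicate_succ']
    simp

theorem coeffW_rightQuot_pow (a : Letter) (n : ℕ) (w : List Letter) (f : Shuffle F q) :
    coeffW w ((rightQuot q a ^ n) f) = coeffW (w ++ List.replicate n a) f := by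
  induction n generalizing w with
  | zero => simp
  | succ n ih =>
    rw [pow_succ', Module.End.mul_apply, coeffW_rightQuot, ih, List.replicate_succ]
    simp

/-- The first letter of a term of `u ⋆ v` is the first letter of `u`, or that of `v`; in the second
case it has crossed all of `u` and picked up the twist. -/
theorem leftQuot_mul (a : Letter) (f g : Shuffle F q) :
    leftQuot q a (f * g) = leftQuot q a f * g + twistMap q a f * leftQuot q a g := by
  induction f using word_induction with
  | hadd f f' h1 h2 => simp only [add_mul, map_add, h1, h2]; abel
  | hsmul c f h1 => simp only [smul_mul_assoc, map_smul, h1, smul_add]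
  | hw u =>
    induction g using word_induction with
    | hadd f f' h1 h2 => simp only [mul_add, map_add, h1, h2]; abel
    | hsmul c f h1 => simp only [mul_smul_comm, map_smul, h1, smul_add]
    | hw v =>
      match u, v with
      | [], v =>
        have : twist q a [] = 1 := by simp [twist]
        rw [twistMap_word, leftQuot_word_nil, this, one_smul, ← one_def, one_mul, zero_mul, one_mul,
          zero_add]
      | b :: u, [] => rw [leftQuot_word_nil, ← one_def, mul_one, mul_one, mul_zero, add_zero]
      | b :: u, c :: v =>
        rw [word_mul_word, shuffleWord, map_add, map_smul, leftQuot_consL, leftQuot_consL,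
          leftQuot_word_cons, leftQuot_word_cons, twistMap_word, smul_mul_assoc]
        congr 1
        · split_ifs with h
          · rw [word_mul_word]
          · simp
        · by_cases h : c = a
          · simp [h, word_mul_word]
          · simp [h]

theorem coeffW_nil_consL (a : Letter) (f : Shuffle F q) : coeffW [] (consL q a f) = 0 := by
  induction f using word_induction with
  | hw v => rw [consL_word, coeffW_word, if_neg (by simp)]
  | hadd f g hf hg => rw [map_add, map_add, hf, hg, add_zero]
  | hsmul c f hf => rw [map_smul, map_smul, hf, smul_zero]

theorem coeffW_nil_mul (f g : Shuffle F q) :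
    coeffW [] (f * g) = coeffW [] f * coeffW [] g := by
  induction f using word_induction with
  | hadd f f' h1 h2 => simp only [add_mul, map_add, h1, h2]
  | hsmul c f h1 => simp only [smul_mul_assoc, map_smul, h1]
  | hw u =>
    induction g using word_induction with
    | hadd f f' h1 h2 => simp only [mul_add, map_add, h1, h2]
    | hsmul c f h1 => simp only [mul_smul_comm, map_smul, h1]
    | hw v =>
      match u, v with
      | [], v => simp [word_mul_word, shuffleWord_nil_left, coeffW_word]
      | b :: u, [] => simp [word_mul_word, shuffleWord_nil_right, coeffW_word]
      | b :: u, c :: v =>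
        rw [word_mul_word, shuffleWord, map_add, map_smul, coeffW_nil_consL, coeffW_nil_consL,
          coeffW_word, if_neg (by simp)]
        simp

theorem algebraMap_eq (c : F) : algebraMap F (Shuffle F q) c = c • word q [] :=
  Algebra.algebraMap_eq_smul_one c

theorem leftQuot_algebraMap (a : Letter) (c : F) :
    leftQuot q a (algebraMap F (Shuffle F q) c) = 0 := by
  rw [algebraMap_eq, map_smul, leftQuot_word_nil, smul_zero]

theorem twistMap_algebraMap (a : Letter) (c : F) :
    twistMap q a (algebraMap F (Shuffle F q) c) = algebraMap F (Shuffle F q) c := by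
  rw [algebraMap_eq, map_smul, twistMap_word]
  simp [twist]

theorem coeffW_nil_algebraMap (c : F) : coeffW [] (algebraMap F (Shuffle F q) c) = c := by
  rw [algebraMap_eq, map_smul, coeffW_word]
  simp

theorem coeffW_twistMap (a : Letter) (w : List Letter) (f : Shuffle F q) :
    coeffW w (twistMap q a f) = twist q a w * coeffW w f := by
  induction f using word_induction with
  | hw v =>
    rw [twistMap_word, map_smul, coeffW_word, smul_eq_mul]
    split_ifs with h
    · rw [h]
    · simp
  | hadd f g hf hg => rw [map_add, map_add, hf, hg, map_add, mul_add]
  | hsmul c f hf => rw [map_smul, map_smul, hf, map_smul, smul_eq_mul, smul_eq_mul, mul_left_comm]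

/-- Since `⟨a, b⟩ = 2 ā b̄`, the twist depends on a word only through its weight. -/
theorem twist_eq_zpow (hq : q ≠ 0) (a : Letter) (w : List Letter) :
    twist q a w = q ^ (2 * a.bar * wt w) := by
  induction w with
  | nil => simp [twist, wt]
  | cons b w ih =>
    have h1 : twist q a (b :: w) = q ^ pair a b * twist q a w := by simp [twist]
    have h2 : wt (b :: w) = b.bar + wt w := by simp [wt]
    rw [h1, ih, h2, ← zpow_add₀ hq]
    congr 1
    cases a <;> cases b <;> simp [pair, Letter.bar] <;> ring

end Words

/-! ### Coefficientwise maps of Hahn series -/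

section Hahn

variable {Γ A B : Type*} [PartialOrder Γ]

/-- An additive map applied coefficientwise to a Hahn series. -/
def hmap [AddCommGroup A] [AddCommGroup B] (f : A →+ B) : HahnSeries Γ A →+ HahnSeries Γ B where
  toFun x := x.map f
  map_zero' := by ext; simp
  map_add' x y := by ext; simp

@[simp]
theorem coeff_hmap [AddCommGroup A] [AddCommGroup B] (f : A →+ B) (x : HahnSeries Γ A) (g : Γ) :
    (hmap f x).coeff g = f (x.coeff g) := rfl

theorem support_hmap [AddCommGroup A] [AddCommGroup B] (f : A →+ B) (x : HahnSeries Γ A) :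
    (hmap f x).support ⊆ x.support := by
  intro g hg h
  exact hg (by rw [coeff_hmap, h, map_zero])

theorem hmap_single [AddCommGroup A] [AddCommGroup B] (f : A →+ B) (g : Γ) (a : A) :
    hmap f (HahnSeries.single g a) = HahnSeries.single g (f a) := by
  ext g'
  rw [coeff_hmap]
  by_cases h : g' = g
  · subst h; simp
  · simp [HahnSeries.coeff_single_of_ne h]

variable [AddCommMonoid Γ] [IsOrderedCancelAddMonoid Γ] [Ring A] [Ring B]

/-- A coefficientwise map may shrink supports, so products before and after it are compared over the
supports of the original series. -/
theorem coeff_mul_of_subset {x y : HahnSeries Γ A} {g : Γ} {s t : Set Γ} (hs : s.IsPWO)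
    (ht : t.IsPWO) (hx : x.support ⊆ s) (hy : y.support ⊆ t) :
    (x * y).coeff g =
      ∑ ij ∈ Finset.antidiagonal hs ht g, x.coeff ij.1 * y.coeff ij.2 := by
  rw [HahnSeries.coeff_mul]
  refine Finset.sum_subset (fun ij h => ?_) (fun ij h h' => ?_)
  · rw [Finset.mem_antidiagonal] at h ⊢
    exact ⟨hx h.1, hy h.2.1, h.2.2⟩
  · rw [Finset.mem_antidiagonal] at h h'
    by_cases h1 : x.coeff ij.1 = 0
    · rw [h1, zero_mul]
    · by_cases h2 : y.coeff ij.2 = 0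
      · rw [h2, mul_zero]
      · exact absurd ⟨h1, h2, h.2.2⟩ h'

theorem hmap_leibniz {D τ : A →+ A} (h : ∀ a b, D (a * b) = D a * b + τ a * D b)
    (x y : HahnSeries Γ A) : hmap D (x * y) = hmap D x * y + hmap τ x * hmap D y := by
  ext g
  rw [HahnSeries.coeff_add, coeff_hmap,
    coeff_mul_of_subset x.isPWO_support y.isPWO_support (support_hmap D x) subset_rfl,
    coeff_mul_of_subset x.isPWO_support y.isPWO_support (support_hmap τ x) (support_hmap D y),
    HahnSeries.coeff_mul, map_sum, ← Finset.sum_add_distrib]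
  simp [h]

theorem hmap_mul {τ : A →+ B} (h : ∀ a b, τ (a * b) = τ a * τ b) (x y : HahnSeries Γ A) :
    hmap τ (x * y) = hmap τ x * hmap τ y := by
  ext g
  rw [coeff_hmap,
    coeff_mul_of_subset x.isPWO_support y.isPWO_support (support_hmap τ x) (support_hmap τ y),
    HahnSeries.coeff_mul, map_sum]
  simp [h]

end Hahn

end FreidelMaillet

namespace FreidelMaillet

/-! ### The entries of the K-matrix -/

section PathValue

variable {F : Type*} [Field F]

/-- The weight in `Δ^{(k)}` of a word read as a lattice path that starts at height `h`, stays
nonnegative and ends at height zero; it is zero for the other words. -/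
def pathVal (q : F) (k : ℤ) : ℤ → List Letter → F
  | h, [] => if h = 0 then 1 else 0
  | h, a :: w => if 0 ≤ h then qnum q (h + k * ((a.bar + 1) / 2)) * pathVal q k (h + a.bar) w else 0

theorem pathVal_eq (q : F) (k : ℤ) (h : ℤ) (w : List Letter) :
    pathVal q k h w = if (∀ i ≤ w.length, 0 ≤ h + wt (w.take i)) ∧ h + wt w = 0 then
      ∏ i : Fin w.length, qnum q (h + wt (w.take i) + k * ((w[i].bar + 1) / 2)) else 0 := by
  induction w generalizing h with
  | nil => 
    by_cases h0 : h = 0 <;> simp [pathVal, wt, h0]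
  | cons a w ih =>
    have hwt : ∀ v, wt (a :: v) = a.bar + wt v := fun v => by simp [wt]
    have e : ((∀ i ≤ (a :: w).length, 0 ≤ h + wt ((a :: w).take i)) ∧ h + wt (a :: w) = 0) ↔
        0 ≤ h ∧ (∀ i ≤ w.length, 0 ≤ h + a.bar + wt (w.take i)) ∧ h + a.bar + wt w = 0 := by
      rw [hwt, ← add_assoc, ← and_assoc]
      refine and_congr_left fun _ => ⟨fun H => ⟨?_, fun i hi => ?_⟩, fun H i hi => ?_⟩
      · simpa [wt] using H 0 (by simp)
      · have := H (i + 1) (by simpa using hi)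
        rwa [List.take_succ_cons, hwt, ← add_assoc] at this
      · cases i with
        | zero => simpa [wt] using H.1
        | succ i =>
          rw [List.take_succ_cons, hwt, ← add_assoc]
          exact H.2 i (by simpa using hi)
    rw [pathVal, ih]
    simp only [e]
    by_cases h0 : 0 ≤ h
    · simp only [h0, if_true, true_and]
      split_ifs with hc
      · simp only [List.length_cons]
        rw [Fin.prod_univ_succ]
        congr 1
        · simp [wt]
        · refine Finset.prod_congr rfl fun i _ => ?_
          have : ((a :: w).take (i.succ : Fin (w.length + 1))) = a :: w.take i := by simp
          rw [this, hwt, ← add_assoc]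
          simp
      · simp
    · simp [h0]

theorem exists_ofFn {N : ℕ} {w : List Letter} (hw : w.length = N) :
    ∃ a : Fin N → Letter, List.ofFn a = w := by
  subst hw
  exact ⟨w.get, List.ofFn_get w⟩

theorem coeffW_delta (q : F) (k : ℤ) (n : ℕ) (w : List Letter) :
    coeffW w (delta q k n) = if w.length = 2 * n then pathVal q k 0 w else 0 := by
  have hcat : pathVal q k 0 w = if IsCatalan w then deltaCoeff q k w else 0 := by
    rw [pathVal_eq]
    simp only [zero_add]
    exact if_congr Iff.rfl rfl rfl
  rw [delta, map_sum, hcat]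
  split_ifs with h1 h2
  · obtain ⟨a, rfl⟩ := exists_ofFn h1
    rw [Finset.sum_eq_single a]
    · rw [if_pos h2, map_smul, coeffW_word, if_pos rfl, smul_eq_mul, mul_one]
    · intro b _ hb
      split_ifs
      · rw [map_smul, coeffW_word, if_neg (fun e => hb (List.ofFn_injective e)), smul_zero]
      · exact map_zero _
    · simp
  · refine Finset.sum_eq_zero fun b _ => ?_
    split_ifs with hb
    · rw [map_smul, coeffW_word, if_neg (by rintro rfl; exact h2 hb), smul_zero]
    · exact map_zero _
  · refine Finset.sum_eq_zero fun b _ => ?_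
    split_ifs with hb
    · rw [map_smul, coeffW_word, if_neg (fun e => h1 (by rw [← e, List.length_ofFn])), smul_zero]
    · exact map_zero _

theorem wt_append (v w : List Letter) : wt (v ++ w) = wt v + wt w := by simp [wt]

theorem wt_replicate (n : ℕ) (a : Letter) : wt (List.replicate n a) = n * a.bar := by simp [wt]

theorem wt_of_pathVal_ne_zero {q : F} {k h : ℤ} {w : List Letter} (hw : pathVal q k h w ≠ 0) :
    h + wt w = 0 := by
  rw [pathVal_eq] at hw
  by_contra e
  exact hw (if_neg fun H => e H.2)

/-- The induction needs an arbitrary starting height `n`, whence `key`. -/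
theorem pathVal_replicate_x (q : F) (k : ℤ) (l : ℕ) (w : List Letter) :
    pathVal q k 0 (List.replicate l .x ++ w) =
      (∏ j ∈ Finset.range l, qnum q (j + k)) * pathVal q k l w := by
  have key : ∀ n : ℕ, pathVal q k n (List.replicate l .x ++ w) =
      (∏ j ∈ Finset.range l, qnum q (n + j + k)) * pathVal q k (n + l) w := by
    induction l with
    | zero => simp
    | succ l ih =>
      intro n
      have := ih (n + 1)
      rw [List.replicate_succ, List.cons_append, pathVal, if_pos (by positivity)]
      simp only [Letter.bar]
      push_cast at this ⊢
      rw [this, Finset.prod_range_succ']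
      simp only [Nat.cast_zero, add_zero]
      rw [mul_one, show (n : ℤ) + (l + 1) = n + 1 + l by ring, mul_comm _ (qnum q (n + k)),
        mul_assoc]
      congr 2
      refine Finset.prod_congr rfl fun j _ => ?_
      congr 1; push_cast; ring
  simpa using key 0

theorem pathVal_replicate_y (q : F) (k : ℤ) (h p : ℕ) :
    pathVal q k h (List.replicate p .y) = if h = p then qfact q p else 0 := by
  induction p generalizing h with
  | zero => simp [pathVal, qfact]
  | succ p ih =>
    rw [List.replicate_succ, pathVal, if_pos (by positivity)]
    simp only [Letter.bar]
    cases h with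
    | zero => simp [qnum]
    | succ h =>
      have := ih h
      rw [show ((h + 1 : ℕ) : ℤ) + -1 = h by push_cast; ring, this]
      simp only [Nat.add_right_cancel_iff]
      split_ifs with e
      · subst e
        rw [qfact, qfact, Finset.prod_range_succ, mul_comm]
        simp
      · simp

/-- The coefficient of a word in `∑ₙ (-1)ⁿ Δ^{(k)}_n`. -/
def signedVal (q : F) (k : ℤ) (w : List Letter) : F := (-1) ^ (w.length / 2) * pathVal q k 0 w

/-- The factor of the last `x` is `[m - m] = 0`. Thus `x^{-(m+1)}` kills `Δ^{(-m)}`, and the columns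
of the K-matrix stop at `m`. -/
theorem signedVal_x_pow_eq_zero (q : F) (m : ℕ) (w : List Letter) :
    signedVal q (-m) (List.replicate (m + 1) .x ++ w) = 0 := by
  rw [signedVal, pathVal_replicate_x, Finset.prod_range_succ]
  simp [qnum]

theorem signedVal_y (q : F) (k : ℤ) (w : List Letter) : signedVal q k (.y :: w) = 0 := by
  rw [signedVal, pathVal]
  simp [Letter.bar, qnum]

/-- An extra `x` followed by `y` returns to height `l`; it contributes `[l+k]` going up, `[l+1]`
going down, and one sign. This closes the system of left quotients under `y⁻¹`. -/
theorem signedVal_x_pow_y (q : F) (k : ℤ) (l : ℕ) (w : List Letter) :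
    signedVal q k (List.replicate (l + 1) .x ++ .y :: w) =
      - (qnum q (l + k) * qnum q (l + 1)) * signedVal q k (List.replicate l .x ++ w) := by
  rw [signedVal, signedVal, pathVal_replicate_x, pathVal_replicate_x, Finset.prod_range_succ,
    pathVal, if_pos (by positivity)]
  have e1 : (List.replicate (l + 1) Letter.x ++ Letter.y :: w).length / 2 =
      (List.replicate l Letter.x ++ w).length / 2 + 1 := by
    simp only [List.length_append, List.length_replicate, List.length_cons]
    omega
  have e2 : ((l + 1 : ℕ) : ℤ) + Letter.bar .y = l := by simp [Letter.bar]
  have e3 : ((l + 1 : ℕ) : ℤ) + k * ((Letter.bar .y + 1) / 2) = l + 1 := by simp [Letter.bar]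
  rw [e1, e2, e3, pow_succ]
  ring

theorem coeff_ofPowerSeries {A : Type*} [Semiring A] (f : PowerSeries A) (g : ℤ) :
    (HahnSeries.ofPowerSeries ℤ A f).coeff g =
      if 0 ≤ g then PowerSeries.coeff g.toNat f else 0 := by
  split_ifs with hg
  · obtain ⟨n, rfl⟩ := Int.eq_ofNat_of_zero_le hg
    exact HahnSeries.ofPowerSeries_apply_coeff f n
  · rw [HahnSeries.ofPowerSeries_apply]
    refine HahnSeries.embDomain_of_notMem_range ?_
    rintro ⟨n, rfl⟩
    exact hg (by simp)

/-- The power of `t` in the definition is normalised so that a word occurs only with the exponent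
equal to its length. -/
theorem coeffW_Kmat (q r : F) (s : ℕ → F) (m : ℕ) (i l : Fin (m + 1)) (w : List Letter) (g : ℤ) :
    coeffW w ((Kmat q r s m i l).coeff g) =
      if g = w.length then phi q r s (i + 1) (l + 1) m *
        signedVal q (-m) (List.replicate l .x ++ (w ++ List.replicate (m - i) .y)) else 0 := by
  have hi := i.2
  rw [Kmat, Matrix.of_apply, HahnSeries.coeff_single_mul, coeff_ofPowerSeries]
  by_cases hg : 0 ≤ g - ((i : ℤ) - l - m)
  · obtain ⟨d, hd⟩ := Int.eq_ofNat_of_zero_le hg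
    rw [if_pos hg, hd, Int.toNat_natCast, deltaSeries, PowerSeries.coeff_mk, signedVal]
    have hlen : (List.replicate (l : ℕ) Letter.x ++ (w ++ List.replicate (m - i) Letter.y)).length
        = l + w.length + (m - i) := by simp; ring
    have hl : (g = (w.length : ℤ)) ↔
        (List.replicate (l : ℕ) Letter.x ++ (w ++ List.replicate (m - i) Letter.y)).length = d := by
      rw [hlen]; omega
    simp only [hl]
    -- Length and weight have the same parity, so the vanishing odd coefficients of `deltaSeries`
    -- lose nothing.
    have hev : ∀ {W : List Letter}, pathVal q (-m) 0 W ≠ 0 → Even W.length := by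
      intro W hW
      have := wt_of_pathVal_ne_zero hW
      have hp : ∀ V : List Letter, Even (wt V + V.length) := by
        intro V
        induction V with
        | nil => simp [wt]
        | cons a V ih =>
          have e : wt (a :: V) + ((a :: V).length : ℤ) = wt V + V.length + (a.bar + 1) := by
            simp [wt]; ring
          rw [e]
          refine ih.add ?_
          cases a <;> simp [Letter.bar]
      have h2 := hp W
      rw [zero_add] at this
      rw [this, zero_add] at h2
      exact_mod_cast h2
    rw [← Algebra.smul_def, map_smul, smul_eq_mul]
    by_cases he : Even d
    · obtain ⟨n, rfl⟩ := he.exists_two_nsmul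
      simp only [smul_eq_mul] at *
      rw [if_pos he, map_smul, coeffW_leftQuot_pow, coeffW_rightQuot_pow, List.append_assoc,
        Nat.mul_div_cancel_left _ two_pos, coeffW_delta, smul_eq_mul]
      split_ifs with h1
      · rw [h1, Nat.mul_div_cancel_left _ two_pos]
      · simp
    · rw [if_neg he, map_zero, mul_zero]
      split_ifs with h1
      · by_contra h2
        refine he (h1 ▸ hev fun h3 => h2 ?_)
        rw [h3, mul_zero, mul_zero]
      · rfl
  · rw [if_neg hg, mul_zero, map_zero, if_neg]
    omega

theorem twoRho_succ_left_sub (a b m : ℤ) :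
    twoRho a b m = twoRho a (b + 1) m + (3 * m + 5 - 4 * a - 2 * b) := by
  simp only [twoRho]; ring

theorem sqrtFact_succ (s : ℕ → F) (n : ℕ) : sqrtFact s (n + 1) = sqrtFact s n * s (n + 1) :=
  Finset.prod_range_succ _ n

/-- The structure constants of the left quotients of the K-matrix. -/
def quotCoeff (r : F) (s : ℕ → F) (m : ℕ) : Letter → ℕ → ℕ → F
  | .x, l', l => if l' = l + 1 then r ^ (-((m : ℤ) + 2 * l) - 1) * (s (m - l) * s (l + 1)) else 0
  | .y, l', l => if l' + 1 = l then r ^ (((m : ℤ) + 2 * l) - 1) * (s (m + 1 - l) * s l) else 0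

/-! ### Twists, constant terms and left quotients of the entries of the K-matrix -/

namespace IsParam

variable {q r : F} {s : ℕ → F} (h : IsParam q r s)

include h

theorem sqrtFact_ne_zero (n : ℕ) : sqrtFact s n ≠ 0 :=
  Finset.prod_ne_zero_iff.2 fun i _ => h.s_ne_zero i

theorem sqrtFact_sq (n : ℕ) : sqrtFact s n ^ 2 = qfact q n := by
  rw [sqrtFact, qfact, ← Finset.prod_pow]
  refine Finset.prod_congr rfl fun i _ => ?_
  rw [h.hs]; push_cast; rfl

theorem qfact_ne_zero (n : ℕ) : qfact q n ≠ 0 := by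
  rw [← h.sqrtFact_sq]
  exact pow_ne_zero _ (h.sqrtFact_ne_zero n)

theorem phi_succ (a m l : ℕ) (hl : l < m) :
    phi q r s a (l + 1) m = r ^ (3 * (m : ℤ) + 5 - 4 * a - 2 * (l + 1)) *
      (s (m - l) * s (l + 1)) * phi q r s a (l + 2) m := by
  obtain ⟨p, rfl⟩ : ∃ p, m = l + 1 + p := ⟨m - (l + 1), by omega⟩
  have e1 : l + 1 + p + 1 - (l + 1) = p + 1 := by omega
  have e2 : l + 1 + p + 1 - (l + 2) = p := by omega
  have e3 : l + 1 + p - l = p + 1 := by omega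
  have e4 : l + 1 - 1 = l := by omega
  have e5 : l + 2 - 1 = l + 1 := by omega
  have h1 := h.s_ne_zero l
  have h2 := h.sqrtFact_ne_zero l
  have h3 := h.sqrtFact_ne_zero (l + 1 + p + 1 - a)
  have h4 := h.qfact_ne_zero (l + 1 + p)
  rw [phi, phi, e1, e2, e3, e4, e5, sqrtFact_succ, sqrtFact_succ]
  have := twoRho_succ_left_sub (a : ℤ) ((l + 1 : ℕ) : ℤ) ((l + 1 + p : ℕ) : ℤ)
  rw [this, zpow_add₀ h.r0]
  push_cast
  rw [show (l : ℤ) + 1 + 1 = l + 2 by ring]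
  field_simp

/-- Catalan words have weight zero, so after removing `x^l` and `y^{m-i}` only words of weight `m -
i - l` remain. -/
theorem twistMap_Kmat (a : Letter) (m : ℕ) (i l : Fin (m + 1)) :
    hmap (twistMap q a).toAddMonoidHom (Kmat q r s m i l) =
      r ^ (4 * a.bar * ((m : ℤ) - i - l)) • Kmat q r s m i l := by
  have hi := i.2
  ext g
  refine shuffle_ext fun w => ?_
  rw [coeff_hmap, HahnSeries.coeff_smul, map_smul]
  change coeffW w (twistMap q a _) = _
  rw [coeffW_twistMap, twist_eq_zpow h.q0, h.q_eq_r, smul_eq_mul]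
  by_cases h0 : coeffW w ((Kmat q r s m i l).coeff g) = 0
  · rw [h0, mul_zero, mul_zero]
  · congr 2
    rw [coeffW_Kmat] at h0
    have h1 : pathVal q (-m) 0 (List.replicate l .x ++ (w ++ List.replicate (m - i) .y)) ≠ 0 := by
      intro e
      apply h0
      rw [signedVal, e]
      simp
    have := wt_of_pathVal_ne_zero h1
    rw [wt_append, wt_append, wt_replicate, wt_replicate] at this
    simp only [Letter.bar] at this
    have : wt w = m - i - l := by
      push_cast [Nat.cast_sub (show (i : ℕ) ≤ m by omega)] at this
      linarith
    rw [this]; ring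

/-- The constant term comes from the single path `x^l y^{m-i}`, closed only when `i + l = m`. Its
factorials cancel those in `phi`, leaving a power of `r`. -/
theorem coeffW_nil_Kmat (m : ℕ) (i l : Fin (m + 1)) :
    hmap (coeffW []).toAddMonoidHom (Kmat q r s m i l) =
      HahnSeries.single 0 (if (i : ℕ) + l = m then r ^ twoRho (i + 1) (l + 1) m else 0) := by
  have hi := i.2
  have hl := l.2
  ext g
  rw [coeff_hmap]
  change coeffW [] _ = _
  rw [coeffW_Kmat, HahnSeries.coeff_single, List.nil_append, List.length_nil, Nat.cast_zero]
  by_cases hg : g = 0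
  swap
  · rw [if_neg hg, if_neg hg]
  rw [if_pos hg, if_pos hg]
  rw [signedVal, pathVal_replicate_x, pathVal_replicate_y]
  by_cases hil : (i : ℕ) + l = m
  · rw [if_pos (by omega), if_pos hil]
    have ei : (i : ℕ) = m - l := by omega
    have e1 : (List.replicate (l : ℕ) Letter.x ++ List.replicate (m - i) Letter.y).length / 2
        = l := by
      simp only [List.length_append, List.length_replicate]; omega
    have e2 : (-1 : F) ^ (l : ℕ) * ∏ j ∈ Finset.range l, qnum q (j + -(m : ℤ)) =
        qfact q m / qfact q (m - l) := by
      rw [eq_div_iff (h.qfact_ne_zero _)]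
      have : ∀ p : ℕ, p ≤ m → (-1 : F) ^ p * (∏ j ∈ Finset.range p, qnum q (j + -(m : ℤ))) *
          qfact q (m - p) = qfact q m := by
        intro p
        induction p with
        | zero => simp
        | succ p ih =>
          intro hp
          rw [← ih (by omega), Finset.prod_range_succ]
          obtain ⟨t, ht⟩ : ∃ t, m - p = t + 1 := ⟨m - p - 1, by omega⟩
          rw [ht, show m - (p + 1) = t by omega]
          have e : qfact q (t + 1) = qfact q t * qnum q (t + 1) := Finset.prod_range_succ _ _
          have e' : qnum q (p + -(m : ℤ)) = - qnum q (t + 1) := by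
            rw [show (p : ℤ) + -m = -(t + 1) by omega]
            simp only [qnum, neg_neg]
            ring
          rw [e, e']; ring
      exact this l (by omega)
    rw [e1, ← mul_assoc ((-1) ^ _), e2, phi, show (i : ℕ) + 1 - 1 = m - l by omega,
      show m + 1 - ((i : ℕ) + 1) = l by omega, show m + 1 - ((l : ℕ) + 1) = m - l by omega,
      show m - (i : ℕ) = l by omega, show (l : ℕ) + 1 - 1 = l by omega, ← h.sqrtFact_sq l,
      ← h.sqrtFact_sq (m - l), Nat.cast_add, Nat.cast_add, Nat.cast_one]
    have h2 := h.sqrtFact_ne_zero l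
    have h3 := h.sqrtFact_ne_zero (m - l)
    have h4 := h.qfact_ne_zero m
    field_simp
  · rw [if_neg (by omega), if_neg hil]
    simp

/-- Removing `x` lengthens the deleted prefix from `x^l` to `x^{l+1}`; removing `y` undoes one `x`
by `signedVal_x_pow_y`. The ratio of neighbouring values of `phi` turns the weights into the
symmetric products of square roots, and the row enters only through a power of `r`. -/
theorem leftQuot_Kmat (a : Letter) (m : ℕ) (i l : Fin (m + 1)) :
    hmap (leftQuot q a).toAddMonoidHom (Kmat q r s m i l) =
      ∑ l' : Fin (m + 1), (r ^ (4 * a.bar * ((m : ℤ) - i)) * quotCoeff r s m a l' l) •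
        (HahnSeries.single 1 1 * Kmat q r s m i l') := by
  have hi := i.2
  have hl := l.2
  ext g
  refine shuffle_ext fun w => ?_
  rw [coeff_hmap, HahnSeries.coeff_sum, map_sum]
  change coeffW w (leftQuot q a _) = _
  simp only [HahnSeries.coeff_smul, HahnSeries.coeff_single_mul, one_mul, map_smul, smul_eq_mul]
  rw [coeffW_leftQuot]
  simp only [coeffW_Kmat, List.length_cons]
  have hg : g = ((w.length + 1 : ℕ) : ℤ) ↔ g - 1 = w.length := by omega
  simp only [hg]
  by_cases hgw : g - 1 = w.length
  · simp only [hgw, if_true]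
    cases a with
    | x =>
      simp only [quotCoeff]
      by_cases hlm : (l : ℕ) = m
      · rw [Finset.sum_eq_zero]
        · have := signedVal_x_pow_eq_zero q m (w ++ List.replicate (m - i) Letter.y)
          rw [List.replicate_succ', List.append_assoc] at this
          rw [hlm]
          simpa using Or.inr this
        · intro l' _
          rw [if_neg (by omega)]; simp
      · rw [Finset.sum_eq_single ⟨l + 1, by omega⟩]
        · simp only [if_true]
          rw [h.phi_succ _ _ _ (by omega), List.replicate_succ', List.append_assoc,
            List.singleton_append, List.cons_append]
          have : 3 * (m : ℤ) + 5 - 4 * ((i : ℕ) + 1 : ℕ) - 2 * ((l : ℕ) + 1) =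
            4 * Letter.x.bar * ((m : ℤ) - (i : ℕ)) + (-((m : ℤ) + 2 * (l : ℕ)) - 1) := by
            simp only [Letter.bar]; push_cast; ring
          rw [this, zpow_add₀ h.r0]
          ring
        · intro l' _ hne
          rw [if_neg (fun e => hne (Fin.ext e))]; simp
        · simp
    | y =>
      simp only [quotCoeff]
      obtain hl0 | ⟨p, hp⟩ : (l : ℕ) = 0 ∨ ∃ p, (l : ℕ) = p + 1 := by
        cases (l : ℕ) with
        | zero => exact Or.inl rfl
        | succ p => exact Or.inr ⟨p, rfl⟩
      · rw [Finset.sum_eq_zero]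
        · rw [hl0, List.replicate_zero, List.nil_append, List.cons_append, signedVal_y, mul_zero]
        · intro l' _
          rw [if_neg (by omega)]; simp
      · rw [Finset.sum_eq_single ⟨p, by omega⟩]
        · rw [if_pos hp.symm]
          simp only [hp]
          have e := h.phi_succ ((i : ℕ) + 1) m p (by omega)
          rw [e, List.cons_append, signedVal_x_pow_y]
          -- Since `[p-m] = -[m-p]`, the alternating sign in the series is absorbed here.
          have e1 : - (qnum q (p + -(m : ℤ)) * qnum q (p + 1)) =
              s (m - p) ^ 2 * s (p + 1) ^ 2 := by
            rw [h.hs, h.hs, Nat.cast_sub (by omega)]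
            simp only [qnum]
            rw [show (p : ℤ) + -m = -(m - p) by ring, neg_neg]
            push_cast
            ring
          have e2 : 4 * Letter.y.bar * ((m : ℤ) - (i : ℕ)) + (((m : ℤ) + 2 * (p + 1 : ℕ)) - 1) =
              -(3 * (m : ℤ) + 5 - 4 * ((i : ℕ) + 1 : ℕ) - 2 * ((p : ℕ) + 1)) := by
            simp only [Letter.bar]; push_cast; ring
          have e3 : m + 1 - (p + 1) = m - p := by omega
          rw [e1, e3, ← mul_assoc (r ^ _) (r ^ _), ← zpow_add₀ h.r0, e2, zpow_neg]
          have := zpow_ne_zero (3 * (m : ℤ) + 5 - 4 * ((i : ℕ) + 1 : ℕ) - 2 * ((p : ℕ) + 1)) h.r0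
          field_simp
        · intro l' _ hne
          rw [if_neg (fun e => hne (Fin.ext (show (l' : ℕ) = p by omega)))]; simp
        · simp
  · simp [hgw]

end IsParam

end PathValue

end FreidelMaillet

namespace FreidelMaillet

/-! ### The R-matrix, weights and the reversal of the basis -/

section Weights

open Matrix LaurentPolynomial
open scoped Kronecker

variable {F : Type*} [Field F] {q r : F} {s : ℕ → F} {m₁ m₂ : ℕ}
  {R : Matrix (Fin (m₁ + 1) × Fin (m₂ + 1)) (Fin (m₁ + 1) × Fin (m₂ + 1)) (LaurentPolynomial F)}

/-- `R` commutes with `k ⊗ k`, whose eigenvalues separate the weights because `r` is not a root of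
unity. -/
theorem IsParam.weight_eq (h : IsParam q r s) (hR : IntwEv C s m₁ m₂ r (T 1) R)
    {x y : Fin (m₁ + 1) × Fin (m₂ + 1)} (hxy : R x y ≠ 0) : (x.1 : ℕ) + x.2 = y.1 + y.2 := by
  have e := congrFun (congrFun hR.k x) y
  simp only [Rep.tens, Rep.tensOp, ev, diagonal_kronecker_diagonal, mul_diagonal,
    diagonal_mul] at e
  rw [mul_comm] at e
  have e := mul_right_cancel₀ hxy e
  rw [← map_mul, ← map_mul, ← zpow_add₀ h.r0, ← zpow_add₀ h.r0] at e
  have e2 : r ^ (2 * ((x.1 : ℤ) + x.2 - y.1 - y.2)) = 1 := by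
    have e' := congrArg (fun f : LaurentPolynomial F => f.coeff 0) e
    simp only [← single_eq_C, AddMonoidAlgebra.coeff_single, Finsupp.single_eq_same] at e'
    rw [show 2 * ((x.1 : ℤ) + x.2 - y.1 - y.2) = (m₁ : ℤ) - 2 * (y.1 : ℕ) + (m₂ - 2 * (y.2 : ℕ)) -
      (m₁ - 2 * (x.1 : ℕ) + (m₂ - 2 * (x.2 : ℕ))) by ring, zpow_sub₀ h.r0, e',
      div_self (zpow_ne_zero _ h.r0)]
  have := h.r_zpow e2
  omega

theorem IsParam.mul_diagonal_weight (h : IsParam q r s) (hR : IntwEv C s m₁ m₂ r (T 1) R)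
    (g : ℕ → LaurentPolynomial F) :
    R * diagonal (fun x => g (x.1 + x.2)) = diagonal (fun x => g (x.1 + x.2)) * R := by
  refine Matrix.ext fun x y => ?_
  rw [mul_diagonal, diagonal_mul, mul_comm]
  by_cases hxy : R x y = 0
  · rw [hxy, mul_zero, mul_zero]
  · rw [h.weight_eq hR hxy]

/-- The reversal of both indices. -/
def revPair (m₁ m₂ : ℕ) : Fin (m₁ + 1) × Fin (m₂ + 1) ≃ Fin (m₁ + 1) × Fin (m₂ + 1) :=
  Fin.revPerm.prodCongr Fin.revPerm

theorem ev_J_apply {L : Type*} [CommRing L] (φ : F →+* L) (κ : F) (z w : L)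
    (x y : Fin (m₁ + 1) × Fin (m₂ + 1)) :
    ((ev φ s m₁ κ z).J ⊗ₖ (ev φ s m₂ κ w).J) x y = if x = revPair m₁ m₂ y then 1 else 0 := by
  obtain ⟨a, b⟩ := x
  obtain ⟨c, d⟩ := y
  have h1 : a = c.rev ↔ (a : ℕ) + c = m₁ := by
    rw [Fin.ext_iff, Fin.val_rev]; omega
  have h2 : b = d.rev ↔ (b : ℕ) + d = m₂ := by
    rw [Fin.ext_iff, Fin.val_rev]; omega
  simp only [kroneckerMap_apply, ev, of_apply, revPair, Equiv.prodCongr_apply, Prod.map,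
    Fin.revPerm_apply, Prod.mk.injEq, h1, h2]
  by_cases h1 : (a : ℕ) + c = m₁ <;> by_cases h2 : (b : ℕ) + d = m₂ <;> simp [h1, h2]

theorem revPair_revPair (x : Fin (m₁ + 1) × Fin (m₂ + 1)) :
    revPair m₁ m₂ (revPair m₁ m₂ x) = x := by
  exact Prod.ext (Fin.rev_rev _) (Fin.rev_rev _)

theorem IntwEv.submatrix_revPair (hR : IntwEv C s m₁ m₂ r (T 1) R) :
    R.submatrix (revPair m₁ m₂) (revPair m₁ m₂) = R := by
  refine Matrix.ext fun x y => ?_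
  have e := congrFun (congrFun hR.J x) (revPair m₁ m₂ y)
  simp only [Rep.tens, Rep.tensOp, mul_apply, ev_J_apply, revPair_revPair] at e
  rw [Finset.sum_eq_single y (by intro z _ hz; simp [hz]) (by simp),
    Finset.sum_eq_single (revPair m₁ m₂ x)
      (by
        intro z _ hz
        rw [if_neg, zero_mul]
        rintro rfl
        exact hz (revPair_revPair z).symm)
      (by simp), revPair_revPair, if_pos rfl, if_pos rfl] at e
  rw [submatrix_apply, ← one_mul (R _ _), ← e, mul_one]

/-- The matrix of structure constants for the left quotients by `a` attached to a lowering
matrix. -/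
def shiftMat (r : F) (m₁ m₂ : ℕ) (f : Matrix (Fin (m₁ + 1) × Fin (m₂ + 1))
      (Fin (m₁ + 1) × Fin (m₂ + 1)) (LaurentPolynomial F)) :
    Letter → Matrix (Fin (m₁ + 1) × Fin (m₂ + 1)) (Fin (m₁ + 1) × Fin (m₂ + 1))
      (LaurentPolynomial F)
  | .x => f * diagonal fun x => C (r ^ (-((m₁ : ℤ) + m₂) - 1 - 2 * ((x.1 + x.2 : ℕ) : ℤ)))
  | .y => f.submatrix (revPair m₁ m₂) (revPair m₁ m₂) *
      diagonal fun x => C (r ^ ((m₁ : ℤ) + m₂ - 1 + 2 * ((x.1 + x.2 : ℕ) : ℤ)))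

/-- For `x` this is the relation for `f` times a function of the weight. For `y` both indices are
reversed: `R` is invariant because it commutes with `J`, so no separate relation for a raising
operator is needed. -/
theorem IsParam.shiftMat_mul (h : IsParam q r s) (hR : IntwEv C s m₁ m₂ r (T 1) R) (a : Letter) :
    shiftMat r m₁ m₂ ((ev C s m₁ r (T 1)).tensOp (ev C s m₂ r 1)).f a * R =
      R * shiftMat r m₁ m₂ ((ev C s m₁ r (T 1)).tens (ev C s m₂ r 1)).f a := by
  cases a with
  | x =>
    rw [shiftMat, shiftMat, Matrix.mul_assoc, ← h.mul_diagonal_weight hR fun n => C (r ^ (-((m₁ :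
      ℤ) + m₂) - 1 - 2 * (n : ℤ))),
      ← Matrix.mul_assoc, ← hR.f, Matrix.mul_assoc]
  | y =>
    rw [shiftMat, shiftMat, Matrix.mul_assoc, ← h.mul_diagonal_weight hR fun n => C (r ^ ((m₁ : ℤ)
      + m₂ - 1 + 2 * (n : ℤ))),
      ← Matrix.mul_assoc, ← Matrix.mul_assoc]
    congr 1
    have e := congrArg (fun M => M.submatrix (revPair m₁ m₂) (revPair m₁ m₂)) hR.f
    simp only [← submatrix_mul_equiv _ _ _ (revPair m₁ m₂), hR.submatrix_revPair] at e
    exact e.symm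

/-- The constant terms of the two products of K-matrices. -/
def flipMat (m₁ m₂ : ℕ) (g : ℕ → LaurentPolynomial F) :
    Matrix (Fin (m₁ + 1) × Fin (m₂ + 1)) (Fin (m₁ + 1) × Fin (m₂ + 1)) (LaurentPolynomial F) :=
  Matrix.of fun x y => if x = revPair m₁ m₂ y then g (y.1 + y.2) else 0

theorem IsParam.flipMat_mul (h : IsParam q r s) (hR : IntwEv C s m₁ m₂ r (T 1) R)
    (g : ℕ → LaurentPolynomial F) : flipMat m₁ m₂ g * R = R * flipMat m₁ m₂ g := by
  have e : flipMat m₁ m₂ g =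
      ((ev C s m₁ r (T 1)).J ⊗ₖ (ev C s m₂ r 1).J) * diagonal fun x => g (x.1 + x.2) := by
    refine Matrix.ext fun x y => ?_
    rw [mul_diagonal, ev_J_apply, flipMat, of_apply, ite_mul, one_mul, zero_mul]
  rw [e, Matrix.mul_assoc, ← h.mul_diagonal_weight hR, ← Matrix.mul_assoc, ← Matrix.mul_assoc]
  exact congrArg (· * _) hR.J.symm

theorem C_zpow_mul_eq (hr : r ≠ 0) (u : F) {a b c d : ℤ} (e : a + b = c + d) :
    C u * C (r ^ a) * C (r ^ b) = C (r ^ c * (r ^ d * u)) := by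
  rw [← map_mul, ← map_mul, mul_assoc, ← mul_assoc (r ^ c), ← zpow_add₀ hr, ← zpow_add₀ hr, e,
    mul_comm]

theorem T_mul_C_zpow_mul_eq (hr : r ≠ 0) (u : F) {a b c d : ℤ} (e : a + b = c + d) :
    T 1 * C u * C (r ^ a) * C (r ^ b) = C (r ^ c * (r ^ d * u)) * T 1 := by
  rw [mul_assoc, mul_assoc, ← mul_assoc (C _), C_zpow_mul_eq hr u e, mul_comm]

/-- The nonzero entries of the lowering matrix of an evaluation module, and of its reversal. -/
def stepCoeff (s : ℕ → F) (m : ℕ) : Letter → ℕ → ℕ → F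
  | .x, l', l => if l' = l + 1 then s (m - l) * s (l + 1) else 0
  | .y, l', l => if l' + 1 = l then s (m + 1 - l) * s l else 0

theorem quotCoeff_eq (r : F) (s : ℕ → F) (m : ℕ) (a : Letter) (l' l : ℕ) :
    quotCoeff r s m a l' l = r ^ (-a.bar * ((m : ℤ) + 2 * l) - 1) * stepCoeff s m a l' l := by
  cases a <;> simp [quotCoeff, stepCoeff, Letter.bar]

theorem ev_f_apply {L : Type*} [CommRing L] (φ : F →+* L) (s : ℕ → F) (m : ℕ) (κ : F) (z : L)
    (i j : Fin (m + 1)) : (ev φ s m κ z).f i j = z * φ (stepCoeff s m .x i j) := by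
  simp only [ev, of_apply, stepCoeff]
  split_ifs
  · rw [mul_comm (s _)]
  · simp

theorem ev_f_rev_apply {L : Type*} [CommRing L] (φ : F →+* L) (s : ℕ → F) (m : ℕ) (κ : F) (z : L)
    (i j : Fin (m + 1)) : (ev φ s m κ z).f i.rev j.rev = z * φ (stepCoeff s m .y i j) := by
  have hi := i.2
  have hj := j.2
  have e1 : m + 1 - ((i : ℕ) + 1) = m + 1 - (j + 1) + 1 ↔ (i : ℕ) + 1 = j := by omega
  have e2 : m + 1 - ((j : ℕ) + 1) + 1 = m + 1 - j := by omega
  have e3 : m - (m + 1 - ((j : ℕ) + 1)) = j := by omega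
  simp only [ev, of_apply, stepCoeff, Fin.val_rev, e1]
  rw [e2, e3]
  split_ifs <;> simp

theorem ev_k_rev_apply {L : Type*} [CommRing L] (φ : F →+* L) (s : ℕ → F) (m : ℕ) (κ : F) (z : L)
    (i j : Fin (m + 1)) : (ev φ s m κ z).k i.rev j.rev = (ev φ s m κ z).k' i j := by
  have hi := i.2
  have e : ((m + 1 - ((i : ℕ) + 1) : ℕ) : ℤ) = m - i := by omega
  simp only [ev, diagonal_apply, Fin.rev_inj, Fin.val_rev, e]
  rw [show (m : ℤ) - 2 * (m - (i : ℕ)) = 2 * (i : ℕ) - m by ring]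

theorem ev_k'_rev_apply {L : Type*} [CommRing L] (φ : F →+* L) (s : ℕ → F) (m : ℕ) (κ : F) (z : L)
    (i j : Fin (m + 1)) : (ev φ s m κ z).k' i.rev j.rev = (ev φ s m κ z).k i j := by
  rw [← ev_k_rev_apply, Fin.rev_rev, Fin.rev_rev]

theorem shiftMat_apply_aux (hr : r ≠ 0) (u v : F) {b₁ b₂ : Prop} [Decidable b₁] [Decidable b₂]
    {a a' b c c' d d' : ℤ} (e : b₂ → a + b = c + d) (e' : b₁ → a' + b = c' + d') :
    (T 1 * C u * (if b₂ then C (r ^ a) else 0) + (if b₁ then C (r ^ a') else 0) * (1 * C v)) *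
        C (r ^ b) =
      C (if b₂ then r ^ c * (r ^ d * u) else 0) * T 1 +
        C (if b₁ then r ^ c' * (r ^ d' * v) else 0) := by
  rw [add_mul]
  congr 1
  · split_ifs with h
    · exact T_mul_C_zpow_mul_eq hr u (e h)
    · simp
  · split_ifs with h
    · rw [one_mul, mul_comm (C _) (C v)]
      exact C_zpow_mul_eq hr v (e' h)
    · simp

theorem IsParam.shiftMat_tensOp_apply (h : IsParam q r s) (a : Letter)
    (z y : Fin (m₁ + 1) × Fin (m₂ + 1)) :
    shiftMat r m₁ m₂ ((ev C s m₁ r (T 1)).tensOp (ev C s m₂ r 1)).f a z y =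
      C (if z.2 = y.2 then r ^ (-2 * a.bar * (m₂ : ℤ)) * quotCoeff r s m₁ a z.1 y.1 else 0) * T 1 +
      C (if z.1 = y.1 then r ^ (-4 * a.bar * (y.1 : ℤ)) * quotCoeff r s m₂ a z.2 y.2 else 0) := by
  simp only [quotCoeff_eq]
  cases a with
  | x =>
    simp only [shiftMat, mul_diagonal, Rep.tensOp, Matrix.add_apply, kroneckerMap_apply, ev_f_apply]
    simp only [ev, diagonal_apply]
    refine shiftMat_apply_aux h.r0 _ _ (fun e => ?_) (fun e => ?_) <;> rw [e] <;>
      simp only [Letter.bar] <;> push_cast <;> ring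
  | y =>
    simp only [shiftMat, mul_diagonal, Rep.tensOp, Matrix.add_apply, kroneckerMap_apply,
      submatrix_apply, revPair, Equiv.prodCongr_apply, Prod.map, Fin.revPerm_apply, ev_f_rev_apply,
      ev_k_rev_apply, ev_k'_rev_apply]
    simp only [ev, diagonal_apply]
    refine shiftMat_apply_aux h.r0 _ _ (fun e => ?_) (fun e => ?_) <;> rw [e] <;>
      simp only [Letter.bar] <;> push_cast <;> ring

theorem IsParam.shiftMat_tens_apply (h : IsParam q r s) (a : Letter)
    (z y : Fin (m₁ + 1) × Fin (m₂ + 1)) :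
    shiftMat r m₁ m₂ ((ev C s m₁ r (T 1)).tens (ev C s m₂ r 1)).f a z y =
      C (if z.2 = y.2 then r ^ (-4 * a.bar * (y.2 : ℤ)) * quotCoeff r s m₁ a z.1 y.1 else 0) * T 1 +
      C (if z.1 = y.1 then r ^ (-2 * a.bar * (m₁ : ℤ)) * quotCoeff r s m₂ a z.2 y.2 else 0) := by
  simp only [quotCoeff_eq]
  cases a with
  | x =>
    simp only [shiftMat, mul_diagonal, Rep.tens, Matrix.add_apply, kroneckerMap_apply, ev_f_apply]
    simp only [ev, diagonal_apply]
    refine shiftMat_apply_aux h.r0 _ _ (fun e => ?_) (fun e => ?_) <;> rw [e] <;>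
      simp only [Letter.bar] <;> push_cast <;> ring
  | y =>
    simp only [shiftMat, mul_diagonal, Rep.tens, Matrix.add_apply, kroneckerMap_apply,
      submatrix_apply, revPair, Equiv.prodCongr_apply, Prod.map, Fin.revPerm_apply, ev_f_rev_apply,
      ev_k_rev_apply, ev_k'_rev_apply]
    simp only [ev, diagonal_apply]
    refine shiftMat_apply_aux h.r0 _ _ (fun e => ?_) (fun e => ?_) <;> rw [e] <;>
      simp only [Letter.bar] <;> push_cast <;> ring

end Weights

end FreidelMaillet

namespace FreidelMaillet

/-! ### Two-variable series -/

section TwoVariables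

variable {F A B : Type*} [Field F]

/-- A linear map applied coefficientwise to a Hahn series. -/
def hmapL {Γ : Type*} [PartialOrder Γ] [AddCommGroup A] [AddCommGroup B] [Module F A] [Module F B]
    (f : A →ₗ[F] B) : HahnSeries Γ A →ₗ[F] HahnSeries Γ B where
  toFun := hmap f.toAddMonoidHom
  map_add' := map_add _
  map_smul' c x := by
    ext g
    exact map_smul f c (x.coeff g)

theorem hmapL_apply {Γ : Type*} [PartialOrder Γ] [AddCommGroup A] [AddCommGroup B] [Module F A]
    [Module F B] (f : A →ₗ[F] B) (x : HahnSeries Γ A) : hmapL f x = hmap f.toAddMonoidHom x := rfl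

variable [Ring A] [Ring B]

theorem coeff_inS (x : HahnSeries ℤ A) (g : ℤ × ℤ) :
    (inS x).coeff g = if g.2 = 0 then x.coeff g.1 else 0 := by
  split_ifs with h
  · have : g = (g.1, 0) := by rw [← h]
    rw [this]
    exact HahnSeries.embDomain_coeff
  · refine HahnSeries.embDomain_of_notMem_range ?_
    rintro ⟨n, rfl⟩
    exact h rfl

theorem coeff_inT (x : HahnSeries ℤ A) (g : ℤ × ℤ) :
    (inT x).coeff g = if g.1 = 0 then x.coeff g.2 else 0 := by
  split_ifs with h
  · have : g = (0, g.2) := by rw [← h]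
    rw [this]
    exact HahnSeries.embDomain_coeff
  · refine HahnSeries.embDomain_of_notMem_range ?_
    rintro ⟨n, rfl⟩
    exact h rfl

theorem hmap_inS (f : A →+ B) (x : HahnSeries ℤ A) : hmap f (inS x) = inS (hmap f x) := by
  ext g
  rw [coeff_hmap, coeff_inS, coeff_inS]
  split_ifs <;> simp

theorem hmap_inT (f : A →+ B) (x : HahnSeries ℤ A) : hmap f (inT x) = inT (hmap f x) := by
  ext g
  rw [coeff_hmap, coeff_inT, coeff_inT]
  split_ifs <;> simp

theorem inS_single (n : ℤ) (a : A) :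
    inS (HahnSeries.single n a) = HahnSeries.single (n, 0) a := HahnSeries.embDomain_single

theorem inT_single (n : ℤ) (a : A) :
    inT (HahnSeries.single n a) = HahnSeries.single (0, n) a := HahnSeries.embDomain_single

theorem inS_smul [Module F A] (c : F) (x : HahnSeries ℤ A) : inS (c • x) = c • inS x := by
  ext g
  rw [HahnSeries.coeff_smul, coeff_inS, coeff_inS]
  split_ifs <;> simp

theorem inT_smul [Module F A] (c : F) (x : HahnSeries ℤ A) : inT (c • x) = c • inT x := by
  ext g
  rw [HahnSeries.coeff_smul, coeff_inT, coeff_inT]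
  split_ifs <;> simp

theorem commute_single_one (g : ℤ × ℤ) (x : HahnSeries (ℤ × ℤ) A) :
    Commute (HahnSeries.single g 1) x := by
  ext g'
  rw [HahnSeries.coeff_single_mul, HahnSeries.coeff_mul_single, one_mul, mul_one]

open LaurentPolynomial

variable [Algebra F A]

/-- The substitution `T ↦ s / t` as an algebra homomorphism. -/
def quotHom (F A : Type*) [Field F] [Ring A] [Algebra F A] :
    LaurentPolynomial F →ₐ[F] HahnSeries (ℤ × ℤ) A :=
  AddMonoidAlgebra.lift F _ ℤ
    { toFun n := HahnSeries.single (n.toAdd, -n.toAdd) 1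
      map_one' := by simp; rfl
      map_mul' a b := by
        rw [HahnSeries.single_mul_single, one_mul]
        congr 2
        simp only [toAdd_mul, neg_add]
        rfl }

theorem quotHom_apply (f : LaurentPolynomial F) : quotHom F A f = atQuotient f := by
  rw [quotHom, AddMonoidAlgebra.lift_apply, atQuotient]
  refine Finsupp.sum_congr fun n _ => ?_
  ext g
  simp only [MonoidHom.coe_mk, OneHom.coe_mk, toAdd_ofAdd, HahnSeries.coeff_smul,
    HahnSeries.coeff_single]
  split_ifs
  · rw [Algebra.algebraMap_eq_smul_one]
  · simp

theorem quotHom_T (n : ℤ) : quotHom F A (T n) = HahnSeries.single (n, -n) 1 := by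
  rw [quotHom, AddMonoidAlgebra.lift_apply, T, AddMonoidAlgebra.coeff_single,
    Finsupp.sum_single_index] <;> simp

theorem quotHom_C (c : F) : quotHom F A (C c) = c • 1 := by
  rw [← Algebra.algebraMap_eq_smul_one]
  exact (quotHom F A).commutes c

theorem quotHom_C_mul_T (c : F) (n : ℤ) :
    quotHom F A (C c * T n) = HahnSeries.single (n, -n) (algebraMap F A c) := by
  rw [map_mul, quotHom_C, quotHom_T, smul_mul_assoc, one_mul]
  ext g
  simp only [HahnSeries.coeff_smul, HahnSeries.coeff_single]
  split_ifs
  · rw [Algebra.algebraMap_eq_smul_one]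
  · simp

end TwoVariables

/-! ### Left quotients of series -/

section Series

open LaurentPolynomial

variable {F : Type*} [Field F] {q : F}

/-- The left quotient by a letter, on series. -/
def quotSer (q : F) (a : Letter) :
    HahnSeries (ℤ × ℤ) (Shuffle F q) →ₗ[F] HahnSeries (ℤ × ℤ) (Shuffle F q) :=
  hmapL (leftQuot q a)

/-- The twist by a letter, on series. -/
def twistSer (q : F) (a : Letter) :
    HahnSeries (ℤ × ℤ) (Shuffle F q) →ₗ[F] HahnSeries (ℤ × ℤ) (Shuffle F q) :=
  hmapL (twistMap q a)

/-- The coefficient of the trivial word, on series. -/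
def constSer (q : F) : HahnSeries (ℤ × ℤ) (Shuffle F q) →ₗ[F] HahnSeries (ℤ × ℤ) F :=
  hmapL (coeffW [])

theorem quotSer_mul (a : Letter) (x y : HahnSeries (ℤ × ℤ) (Shuffle F q)) :
    quotSer q a (x * y) = quotSer q a x * y + twistSer q a x * quotSer q a y :=
  hmap_leibniz (fun f g => leftQuot_mul a f g) x y

theorem constSer_mul (x y : HahnSeries (ℤ × ℤ) (Shuffle F q)) :
    constSer q (x * y) = constSer q x * constSer q y :=
  hmap_mul (fun f g => coeffW_nil_mul f g) x y

theorem coeffW_cons_coeff (a : Letter) (w : List Letter) (x : HahnSeries (ℤ × ℤ) (Shuffle F q))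
    (g : ℤ × ℤ) : coeffW (a :: w) (x.coeff g) = coeffW w ((quotSer q a x).coeff g) :=
  (coeffW_leftQuot a w (x.coeff g)).symm

theorem quotSer_quotHom (a : Letter) (f : LaurentPolynomial F) :
    quotSer q a (quotHom F _ f) = 0 := by
  induction f using LaurentPolynomial.induction_on' with
  | add p q hp hq => rw [map_add, map_add, hp, hq, add_zero]
  | C_mul_T n c =>
    rw [quotHom_C_mul_T, quotSer, hmapL_apply, hmap_single]
    exact (congrArg _ (leftQuot_algebraMap a c)).trans (map_zero _)

theorem twistSer_quotHom (a : Letter) (f : LaurentPolynomial F) :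
    twistSer q a (quotHom F _ f) = quotHom F _ f := by
  induction f using LaurentPolynomial.induction_on' with
  | add p q hp hq => rw [map_add, map_add, hp, hq]
  | C_mul_T n c =>
    rw [quotHom_C_mul_T, twistSer, hmapL_apply, hmap_single]
    exact congrArg _ (twistMap_algebraMap a c)

theorem quotSer_single_one (a : Letter) (g : ℤ × ℤ) :
    quotSer q a (HahnSeries.single g 1) = 0 := by
  rw [quotSer, hmapL_apply, hmap_single]
  refine (congrArg _ ?_).trans (map_zero _)
  exact leftQuot_word_nil a

/-- A matrix of series is determined by its constant terms and by a linear system for its left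
quotients. -/
theorem eq_zero_of_quotSer {ι : Type*} [Fintype ι] {Z : Matrix ι ι (HahnSeries (ℤ × ℤ) (Shuffle F
  q))}
    {μ : Letter → ι → F} {M : Letter → Matrix ι ι (HahnSeries (ℤ × ℤ) (Shuffle F q))}
    (hM : ∀ a b x y, quotSer q b (M a x y) = 0)
    (hZ : ∀ a x y, quotSer q a (Z x y) = μ a x • (Z * M a) x y)
    (h0 : ∀ x y, constSer q (Z x y) = 0) : Z = 0 := by
  classical
  -- Each letter taken off a word puts one more factor `M a` to the right of `Z`, so the induction
  -- runs over all right factors `N` with vanishing left quotients.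
  have key : ∀ (w : List Letter) (N : Matrix ι ι (HahnSeries (ℤ × ℤ) (Shuffle F q))),
      (∀ b x y, quotSer q b (N x y) = 0) → ∀ x y g, coeffW w (((Z * N) x y).coeff g) = 0 := by
    intro w
    induction w with
    | nil =>
      intro N _ x y g
      have : constSer q ((Z * N) x y) = 0 := by
        rw [Matrix.mul_apply, map_sum]
        exact Finset.sum_eq_zero fun z _ => by rw [constSer_mul, h0, zero_mul]
      have := congrArg (fun f => f.coeff g) this
      exact this
    | cons a w ih =>
      intro N hN x y g
      have e : quotSer q a ((Z * N) x y) = μ a x • (Z * (M a * N)) x y := by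
        rw [← Matrix.mul_assoc, Matrix.mul_apply, Matrix.mul_apply, map_sum, Finset.smul_sum]
        refine Finset.sum_congr rfl fun z _ => ?_
        rw [quotSer_mul, hN, mul_zero, add_zero, hZ, smul_mul_assoc]
      rw [coeffW_cons_coeff, e, HahnSeries.coeff_smul, map_smul, ih, smul_zero]
      intro b x y
      rw [Matrix.mul_apply, map_sum]
      exact Finset.sum_eq_zero fun z _ => by rw [quotSer_mul, hN, hM, mul_zero, zero_mul, add_zero]
  refine Matrix.ext fun x y => HahnSeries.ext (funext fun g => shuffle_ext fun w => ?_)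
  have := key w 1 (fun b x y => ?_) x y g
  · rw [Matrix.mul_one] at this
    rw [this]
    exact (map_zero _).symm
  · rw [Matrix.one_apply]
    split_ifs
    · rw [← HahnSeries.single_zero_one]
      exact quotSer_single_one b 0
    · exact map_zero _

/-- The left quotient of the product of two matrices acting on different tensor factors. -/
theorem quot_tensor {H α β : Type*} [Ring H] [Algebra F H] [Fintype α] [Fintype β]
    [DecidableEq α] [DecidableEq β] {D τ : H →ₗ[F] H}
    (hD : ∀ x y, D (x * y) = D x * y + τ x * D y) {X : Matrix α α H} {Y : Matrix β β H}
    {lX vX : α → F} {lY : β → F} {G : α → α → F} {G' : β → β → F} {σ σ' : H}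
    (hσ : ∀ x, Commute σ x) (hσ' : ∀ x, Commute σ' x)
    (hX : ∀ i l, D (X i l) = ∑ l', (lX i * G l' l) • (σ * X i l'))
    (hτ : ∀ i l, τ (X i l) = (lX i * vX l) • X i l)
    (hY : ∀ k p, D (Y k p) = ∑ p', (lY k * G' p' p) • (σ' * Y k p'))
    {ρ : α → β → F} {c : F} (hρ : ∀ l l' k, ρ l k * G l' l = c * lY k * ρ l' k * G l' l)
    (i l : α) (k p : β) :
    D (ρ l k • (X i l * Y k p)) = (lX i * lY k) • ∑ z : α × β, (ρ z.1 k • (X i z.1 * Y k z.2)) *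
      ((if z.2 = p then c * G z.1 l else 0) • σ + (if z.1 = l then vX l * G' z.2 p else 0) • σ') :=
        by
  have e1 : ∑ z : α × β, (ρ z.1 k • (X i z.1 * Y k z.2)) *
      ((if z.2 = p then c * G z.1 l else 0) • σ) =
      ∑ l', (ρ l' k • (X i l' * Y k p)) * ((c * G l' l) • σ) := by
    rw [Fintype.sum_prod_type]
    refine Finset.sum_congr rfl fun l' _ => ?_
    rw [Finset.sum_eq_single p]
    · rw [if_pos rfl]
    · intro p' _ hp
      rw [if_neg hp, zero_smul, mul_zero]
    · simp
  have e2 : ∑ z : α × β, (ρ z.1 k • (X i z.1 * Y k z.2)) *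
      ((if z.1 = l then vX l * G' z.2 p else 0) • σ') =
      ∑ p', (ρ l k • (X i l * Y k p')) * ((vX l * G' p' p) • σ') := by
    rw [Fintype.sum_prod_type_right]
    refine Finset.sum_congr rfl fun p' _ => ?_
    rw [Finset.sum_eq_single l]
    · rw [if_pos rfl]
    · intro p' _ hp
      rw [if_neg hp, zero_smul, mul_zero]
    · simp
  simp only [mul_add]
  rw [Finset.sum_add_distrib, e1, e2, map_smul, hD, hX, hY, hτ, smul_add, smul_add,
    Finset.sum_mul, Finset.mul_sum, Finset.smul_sum, Finset.smul_sum, Finset.smul_sum,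
    Finset.smul_sum]
  congr 1
  -- Differentiating the first factor does not produce the row factor `lY k` of the second; `hρ`
  -- supplies it.
  · refine Finset.sum_congr rfl fun l' _ => ?_
    rw [mul_smul_comm, smul_mul_assoc, smul_mul_assoc, smul_smul, smul_smul, smul_smul, mul_assoc σ,
      (hσ _).eq]
    congr 1
    linear_combination lX i * hρ l l' k
  · refine Finset.sum_congr rfl fun p' _ => ?_
    rw [mul_smul_comm, smul_mul_assoc, smul_mul_assoc, mul_smul_comm, smul_smul, smul_smul,
      smul_smul, smul_smul, (hσ' _).eq, ← mul_assoc (X i l)]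
    congr 1
    ring

end Series

end FreidelMaillet

namespace FreidelMaillet

/-! ### The reflection equation -/

section Reflection

open Matrix LaurentPolynomial
open scoped Kronecker

variable {F : Type*} [Field F] {q r : F} {s : ℕ → F} {m₁ m₂ : ℕ}

theorem leg1_diagonal_leg2_apply {A α β : Type*} [Semiring A] [DecidableEq α] [DecidableEq β]
    [Fintype α] [Fintype β] (M : Matrix α α A) (N : Matrix β β A) (d : α × β → A) (x y : α × β) :
    (leg1 β M * diagonal d * leg2 α N) x y = M x.1 y.1 * d (y.1, x.2) * N x.2 y.2 := by
  rw [mul_apply, Finset.sum_eq_single (y.1, x.2)]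
  · rw [mul_diagonal]
    simp [leg1, leg2]
  · intro z _ hz
    rw [mul_diagonal]
    simp only [leg1, leg2, kroneckerMap_apply, one_apply]
    by_cases h1 : x.2 = z.2
    · rw [if_neg (fun h2 : z.1 = y.1 => hz (Prod.ext h2 h1.symm)), zero_mul, mul_zero]
    · rw [if_neg h1, mul_zero, zero_mul, zero_mul]
  · simp

theorem leg2_diagonal_leg1_apply {A α β : Type*} [Semiring A] [DecidableEq α] [DecidableEq β]
    [Fintype α] [Fintype β] (M : Matrix α α A) (N : Matrix β β A) (d : α × β → A) (x y : α × β) :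
    (leg2 α N * diagonal d * leg1 β M) x y = N x.2 y.2 * d (x.1, y.2) * M x.1 y.1 := by
  rw [mul_apply, Finset.sum_eq_single (x.1, y.2)]
  · rw [mul_diagonal]
    simp [leg1, leg2]
  · intro z _ hz
    rw [mul_diagonal]
    simp only [leg1, leg2, kroneckerMap_apply, one_apply]
    by_cases h1 : x.1 = z.1
    · rw [if_neg (fun h2 : z.2 = y.2 => hz (Prod.ext h1.symm h2)), mul_zero, mul_zero]
    · rw [if_neg h1, zero_mul, zero_mul, zero_mul]
  · simp

theorem K1_Rhat_K2_apply (x y : Fin (m₁ + 1) × Fin (m₂ + 1)) :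
    (K1 q r s m₁ m₂ * Rhat q r m₁ m₂ * K2 q r s m₁ m₂) x y =
      r ^ (((m₁ : ℤ) - 2 * (y.1 : ℕ)) * ((m₂ : ℤ) - 2 * (x.2 : ℕ))) •
        (inS (Kmat q r s m₁ x.1 y.1) * inT (Kmat q r s m₂ x.2 y.2)) := by
  rw [K1, K2, Rhat, leg1_diagonal_leg2_apply, ← HahnSeries.algebraMap_apply, ← Algebra.commutes,
    mul_assoc, ← Algebra.smul_def]
  rfl

theorem K2_Rhat_K1_apply (x y : Fin (m₁ + 1) × Fin (m₂ + 1)) :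
    (K2 q r s m₁ m₂ * Rhat q r m₁ m₂ * K1 q r s m₁ m₂) x y =
      r ^ (((m₁ : ℤ) - 2 * (x.1 : ℕ)) * ((m₂ : ℤ) - 2 * (y.2 : ℕ))) •
        (inT (Kmat q r s m₂ x.2 y.2) * inS (Kmat q r s m₁ x.1 y.1)) := by
  rw [K1, K2, Rhat, leg2_diagonal_leg1_apply, ← HahnSeries.algebraMap_apply, ← Algebra.commutes,
    mul_assoc, ← Algebra.smul_def]
  rfl

/-- A Laurent polynomial `f`, as the series `t f(s / t)`. -/
def shiftHom (q : F) (f : LaurentPolynomial F) : HahnSeries (ℤ × ℤ) (Shuffle F q) :=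
  HahnSeries.single (0, 1) 1 * quotHom F _ f

theorem shiftHom_apply (u v : F) : shiftHom q (C u * T 1 + C v) =
    u • HahnSeries.single (1, 0) 1 + v • HahnSeries.single (0, 1) 1 := by
  rw [shiftHom, map_add, map_mul, quotHom_C, quotHom_C, quotHom_T, mul_add, smul_mul_assoc, one_mul,
    mul_smul_comm, mul_smul_comm, mul_one, HahnSeries.single_mul_single, one_mul]
  rfl

theorem quotSer_shiftHom (a : Letter) (f : LaurentPolynomial F) :
    quotSer q a (shiftHom q f) = 0 := by
  rw [shiftHom, quotSer_mul, quotSer_quotHom, quotSer_single_one, zero_mul, mul_zero, add_zero]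

theorem map_shiftHom_mul {ι : Type*} [Fintype ι] (M N : Matrix ι ι (LaurentPolynomial F)) :
    M.map (shiftHom q) * N.map (quotHom F _) = (M * N).map (shiftHom q) := by
  refine Matrix.ext fun x y => ?_
  simp only [mul_apply, map_apply, shiftHom, map_sum, Finset.mul_sum, map_mul, mul_assoc]

theorem mul_map_shiftHom {ι : Type*} [Fintype ι] (M N : Matrix ι ι (LaurentPolynomial F)) :
    M.map (quotHom F _) * N.map (shiftHom q) = (M * N).map (shiftHom q) := by
  refine Matrix.ext fun x y => ?_
  simp only [mul_apply, map_apply, shiftHom, map_sum, Finset.mul_sum, map_mul]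
  refine Finset.sum_congr rfl fun z _ => ?_
  rw [← mul_assoc, ← (commute_single_one _ _).eq, mul_assoc]

/-- The exponents of `r` in the constant terms. -/
def constExp (m₁ m₂ : ℕ) (n : ℕ) : ℤ :=
  2 * ((m₁ : ℤ) + m₂) * n - 2 * (n : ℤ) ^ 2 - m₁ * m₂ + twoRho 1 (m₁ + 1) m₁ + twoRho 1 (m₂ + 1) m₂

theorem constSer_quotHom_C (c : F) :
    constSer q (quotHom F _ (C c)) = HahnSeries.single 0 c := by
  have : quotHom F (Shuffle F q) (C c) = HahnSeries.single 0 (algebraMap F _ c) := by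
    rw [quotHom_C, ← Algebra.algebraMap_eq_smul_one, HahnSeries.algebraMap_apply]
    rfl
  rw [this, constSer, hmapL_apply, hmap_single]
  exact congrArg _ (coeffW_nil_algebraMap c)

/-! ### Left quotients and constant terms of the two products of K-matrices -/

namespace IsParam

variable (h : IsParam q r s)

include h

theorem quotSer_inS_Kmat (a : Letter) (m : ℕ) (i l : Fin (m + 1)) :
    quotSer q a (inS (Kmat q r s m i l)) =
      ∑ l' : Fin (m + 1), (r ^ (4 * a.bar * ((m : ℤ) - i)) * quotCoeff r s m a l' l) •
        (HahnSeries.single (1, 0) 1 * inS (Kmat q r s m i l')) := by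
  rw [quotSer, hmapL_apply, hmap_inS, h.leftQuot_Kmat, map_sum]
  simp only [inS_smul, map_mul, inS_single]

theorem quotSer_inT_Kmat (a : Letter) (m : ℕ) (i l : Fin (m + 1)) :
    quotSer q a (inT (Kmat q r s m i l)) =
      ∑ l' : Fin (m + 1), (r ^ (4 * a.bar * ((m : ℤ) - i)) * quotCoeff r s m a l' l) •
        (HahnSeries.single (0, 1) 1 * inT (Kmat q r s m i l')) := by
  rw [quotSer, hmapL_apply, hmap_inT, h.leftQuot_Kmat, map_sum]
  simp only [inT_smul, map_mul, inT_single]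

theorem twistSer_inS_Kmat (a : Letter) (m : ℕ) (i l : Fin (m + 1)) :
    twistSer q a (inS (Kmat q r s m i l)) =
      (r ^ (4 * a.bar * ((m : ℤ) - i)) * r ^ (-4 * a.bar * (l : ℤ))) •
        inS (Kmat q r s m i l) := by
  rw [twistSer, hmapL_apply, hmap_inS, h.twistMap_Kmat, inS_smul, ← zpow_add₀ h.r0]
  congr 2; ring

theorem twistSer_inT_Kmat (a : Letter) (m : ℕ) (i l : Fin (m + 1)) :
    twistSer q a (inT (Kmat q r s m i l)) =
      (r ^ (4 * a.bar * ((m : ℤ) - i)) * r ^ (-4 * a.bar * (l : ℤ))) •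
        inT (Kmat q r s m i l) := by
  rw [twistSer, hmapL_apply, hmap_inT, h.twistMap_Kmat, inT_smul, ← zpow_add₀ h.r0]
  congr 2; ring

/-- This is the reason for `R̂`. A nonzero structure constant forces `l' = l + ā`, and this step
changes the bilinear exponent by `2ā(m' - 2k)`: up to a constant, the row factor of the other
K-matrix. -/
theorem rho_mul_quotCoeff (a : Letter) (l' l : ℕ) (m m' k : ℤ) (M : ℕ) :
    r ^ ((m - 2 * l) * (m' - 2 * k)) * quotCoeff r s M a l' l =
      r ^ (-2 * a.bar * m') * r ^ (4 * a.bar * (m' - k)) * r ^ ((m - 2 * l') * (m' - 2 * k)) *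
        quotCoeff r s M a l' l := by
  by_cases h0 : quotCoeff r s M a l' l = 0
  · rw [h0, mul_zero, mul_zero]
  · have hl : (l' : ℤ) = l + a.bar := by
      cases a <;> simp only [quotCoeff] at h0 <;> split_ifs at h0 with e <;>
        simp only [Letter.bar] <;> first | omega | exact absurd rfl h0
    rw [← zpow_add₀ h.r0, ← zpow_add₀ h.r0, hl]
    congr 2
    ring

theorem quotSer_K1_Rhat_K2 (a : Letter) (x y : Fin (m₁ + 1) × Fin (m₂ + 1)) :
    quotSer q a ((K1 q r s m₁ m₂ * Rhat q r m₁ m₂ * K2 q r s m₁ m₂) x y) =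
      (r ^ (4 * a.bar * ((m₁ : ℤ) - x.1)) * r ^ (4 * a.bar * ((m₂ : ℤ) - x.2))) •
        ((K1 q r s m₁ m₂ * Rhat q r m₁ m₂ * K2 q r s m₁ m₂) *
          (shiftMat r m₁ m₂ ((ev C s m₁ r (T 1)).tensOp (ev C s m₂ r 1)).f a).map (shiftHom q))
            x y := by
  have key := quot_tensor (D := quotSer q a) (τ := twistSer q a) (quotSer_mul a)
    (commute_single_one _) (commute_single_one _)
    (X := (Kmat q r s m₁).map inS) (Y := (Kmat q r s m₂).map inT)
    (fun i l => h.quotSer_inS_Kmat a m₁ i l) (fun i l => h.twistSer_inS_Kmat a m₁ i l)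
    (fun i l => h.quotSer_inT_Kmat a m₂ i l)
    (ρ := fun l k => r ^ (((m₁ : ℤ) - 2 * (l : ℕ)) * ((m₂ : ℤ) - 2 * (k : ℕ))))
    (c := r ^ (-2 * a.bar * (m₂ : ℤ)))
    (fun l l' k => h.rho_mul_quotCoeff a l' l m₁ m₂ k m₁) x.1 y.1 x.2 y.2
  rw [K1_Rhat_K2_apply, mul_apply]
  simp only [K1_Rhat_K2_apply, map_apply, h.shiftMat_tensOp_apply, shiftHom_apply]
  exact key

theorem quotSer_K2_Rhat_K1 (a : Letter) (x y : Fin (m₁ + 1) × Fin (m₂ + 1)) :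
    quotSer q a ((K2 q r s m₁ m₂ * Rhat q r m₁ m₂ * K1 q r s m₁ m₂) x y) =
      (r ^ (4 * a.bar * ((m₁ : ℤ) - x.1)) * r ^ (4 * a.bar * ((m₂ : ℤ) - x.2))) •
        ((K2 q r s m₁ m₂ * Rhat q r m₁ m₂ * K1 q r s m₁ m₂) *
          (shiftMat r m₁ m₂ ((ev C s m₁ r (T 1)).tens (ev C s m₂ r 1)).f a).map (shiftHom q))
            x y := by
  have key := quot_tensor (D := quotSer q a) (τ := twistSer q a) (quotSer_mul a)
    (commute_single_one _) (commute_single_one _)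
    (X := (Kmat q r s m₂).map inT) (Y := (Kmat q r s m₁).map inS)
    (fun i l => h.quotSer_inT_Kmat a m₂ i l) (fun i l => h.twistSer_inT_Kmat a m₂ i l)
    (fun i l => h.quotSer_inS_Kmat a m₁ i l)
    (ρ := fun l k => r ^ (((m₂ : ℤ) - 2 * (l : ℕ)) * ((m₁ : ℤ) - 2 * (k : ℕ))))
    (c := r ^ (-2 * a.bar * (m₁ : ℤ)))
    (fun l l' k => h.rho_mul_quotCoeff a l' l m₂ m₁ k m₂) x.2 y.2 x.1 y.1
  rw [K2_Rhat_K1_apply, mul_apply]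
  simp only [K2_Rhat_K1_apply, map_apply, h.shiftMat_tens_apply, shiftHom_apply]
  rw [mul_comm ((m₁ : ℤ) - 2 * _), mul_comm (r ^ (4 * a.bar * ((m₁ : ℤ) - _)))]
  refine key.trans (congrArg _ ?_)
  -- `key` treats the second leg as the first factor, so the double sum is taken in the other order.
  rw [Fintype.sum_prod_type_right, Fintype.sum_prod_type]
  refine Finset.sum_congr rfl fun i _ => Finset.sum_congr rfl fun k _ => ?_
  simp only [map_apply]
  rw [mul_comm ((m₁ : ℤ) - 2 * _)]
  exact congrArg _ (add_comm _ _)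

theorem constSer_inS_Kmat (m : ℕ) (i l : Fin (m + 1)) :
    constSer q (inS (Kmat q r s m i l)) =
      HahnSeries.single 0 (if (i : ℕ) + l = m then r ^ twoRho (i + 1) (l + 1) m else 0) := by
  rw [constSer, hmapL_apply, hmap_inS, h.coeffW_nil_Kmat, inS_single]
  rfl

theorem constSer_inT_Kmat (m : ℕ) (i l : Fin (m + 1)) :
    constSer q (inT (Kmat q r s m i l)) =
      HahnSeries.single 0 (if (i : ℕ) + l = m then r ^ twoRho (i + 1) (l + 1) m else 0) := by
  rw [constSer, hmapL_apply, hmap_inT, h.coeffW_nil_Kmat, inT_single]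
  rfl

/-- On the antidiagonal the exponents from `phi` and from `R̂` add up to a function of `y.1 + y.2`
alone, which is why the constant term commutes with `R`. The exponent of `R̂` matters only there,
where its forms in the two products agree. -/
theorem constSer_aux (x y : Fin (m₁ + 1) × Fin (m₂ + 1)) {e : ℤ}
    (he : x = revPair m₁ m₂ y →
      e = ((m₁ : ℤ) - 2 * (y.1 : ℕ)) * ((m₂ : ℤ) - 2 * (x.2 : ℕ))) :
    r ^ e • (HahnSeries.single (0 : ℤ × ℤ)
        (if (x.1 : ℕ) + y.1 = m₁ then r ^ twoRho (x.1 + 1) (y.1 + 1) m₁ else 0) *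
      HahnSeries.single 0
        (if (x.2 : ℕ) + y.2 = m₂ then r ^ twoRho (x.2 + 1) (y.2 + 1) m₂ else 0)) =
    constSer q (quotHom F _ (flipMat m₁ m₂ (fun n => C (r ^ constExp m₁ m₂ n)) x y)) := by
  obtain ⟨x₁, x₂⟩ := x
  obtain ⟨y₁, y₂⟩ := y
  have hx : (⟨x₁, x₂⟩ : Fin (m₁ + 1) × Fin (m₂ + 1)) = revPair m₁ m₂ ⟨y₁, y₂⟩ ↔
      (x₁ : ℕ) + y₁ = m₁ ∧ (x₂ : ℕ) + y₂ = m₂ := by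
    simp only [revPair, Equiv.prodCongr_apply, Prod.map, Fin.revPerm_apply, Prod.mk.injEq,
      Fin.ext_iff, Fin.val_rev]
    omega
  rw [flipMat, of_apply, HahnSeries.single_mul_single, add_zero]
  rw [hx] at he
  simp only [hx]
  by_cases h1 : (x₁ : ℕ) + y₁ = m₁ ∧ (x₂ : ℕ) + y₂ = m₂
  · rw [if_pos h1.1, if_pos h1.2, if_pos h1, constSer_quotHom_C, ← zpow_add₀ h.r0,
      ← HahnSeries.single_zero_mul_eq_smul, HahnSeries.single_mul_single, add_zero, ← zpow_add₀
        h.r0, he h1]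
    have e1 : ((x₁ : ℕ) : ℤ) = m₁ - (y₁ : ℕ) := by omega
    have e2 : ((x₂ : ℕ) : ℤ) = m₂ - (y₂ : ℕ) := by omega
    rw [constExp, e1, e2]
    congr 2
    simp only [twoRho]
    push_cast
    ring
  · rw [if_neg h1, map_zero, map_zero]
    rw [not_and_or] at h1
    rcases h1 with h1 | h1 <;> rw [if_neg h1] <;> simp

theorem constSer_K1_Rhat_K2 (x y : Fin (m₁ + 1) × Fin (m₂ + 1)) :
    constSer q ((K1 q r s m₁ m₂ * Rhat q r m₁ m₂ * K2 q r s m₁ m₂) x y) =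
      constSer q (quotHom F _ (flipMat m₁ m₂ (fun n => C (r ^ constExp m₁ m₂ n)) x y)) := by
  rw [K1_Rhat_K2_apply, map_smul, constSer_mul, h.constSer_inS_Kmat, h.constSer_inT_Kmat,
    h.constSer_aux x y fun _ => rfl]

theorem constSer_K2_Rhat_K1 (x y : Fin (m₁ + 1) × Fin (m₂ + 1)) :
    constSer q ((K2 q r s m₁ m₂ * Rhat q r m₁ m₂ * K1 q r s m₁ m₂) x y) =
      constSer q (quotHom F _ (flipMat m₁ m₂ (fun n => C (r ^ constExp m₁ m₂ n)) x y)) := by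
  rw [K2_Rhat_K1_apply, map_smul, constSer_mul, h.constSer_inS_Kmat, h.constSer_inT_Kmat,
    mul_comm (HahnSeries.single _ _), h.constSer_aux x y]
  rintro rfl
  have hy1 := y.1.2
  have hy2 := y.2.2
  have e1 : ((m₁ + 1 - ((y.1 : ℕ) + 1) : ℕ) : ℤ) = m₁ - (y.1 : ℕ) := by omega
  have e2 : ((m₂ + 1 - ((y.2 : ℕ) + 1) : ℕ) : ℤ) = m₂ - (y.2 : ℕ) := by omega
  simp only [revPair, Equiv.prodCongr_apply, Prod.map, Fin.revPerm_apply, Fin.val_rev, e1, e2]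
  ring

/-- The reflection equation, for every matrix `R(T)` that intertwines the tensor products
of evaluation modules. -/
theorem reflection {R : Matrix (Fin (m₁ + 1) × Fin (m₂ + 1)) (Fin (m₁ + 1) × Fin (m₂ + 1))
      (LaurentPolynomial F)} (hR : IntwEv C s m₁ m₂ r (T 1) R) :
    K1 q r s m₁ m₂ * Rhat q r m₁ m₂ * K2 q r s m₁ m₂ * R.map (quotHom F (Shuffle F q)) =
      R.map (quotHom F (Shuffle F q)) *
        (K2 q r s m₁ m₂ * Rhat q r m₁ m₂ * K1 q r s m₁ m₂) := by
  have hS := h.shiftMat_mul hR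
  have hq := fun a => h.quotSer_K1_Rhat_K2 (m₁ := m₁) (m₂ := m₂) a
  have hq' := fun a => h.quotSer_K2_Rhat_K1 (m₁ := m₁) (m₂ := m₂) a
  have hc := h.constSer_K1_Rhat_K2 (m₁ := m₁) (m₂ := m₂)
  have hc' := h.constSer_K2_Rhat_K1 (m₁ := m₁) (m₂ := m₂)
  have hflip := h.flipMat_mul hR fun n => C (r ^ constExp m₁ m₂ n)
  generalize K1 q r s m₁ m₂ * Rhat q r m₁ m₂ * K2 q r s m₁ m₂ = X at *
  generalize K2 q r s m₁ m₂ * Rhat q r m₁ m₂ * K1 q r s m₁ m₂ = Y at *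
  generalize flipMat m₁ m₂ (fun n => C (r ^ constExp m₁ m₂ n)) = J at *
  -- The difference satisfies the linear system of `Y`; on the part `X R`, the relation `hS` moves
  -- `R` past the structure matrix.
  refine sub_eq_zero.1 (eq_zero_of_quotSer
    (M := fun a =>
      (shiftMat r m₁ m₂ ((ev C s m₁ r (T 1)).tens (ev C s m₂ r 1)).f a).map (shiftHom q))
    (μ := fun a x => r ^ (4 * a.bar * ((m₁ : ℤ) - x.1)) * r ^ (4 * a.bar * ((m₂ : ℤ) - x.2)))
    (fun a b x y => quotSer_shiftHom b _) (fun a x y => ?_) fun x y => ?_)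
  · rw [Matrix.sub_mul, Matrix.sub_apply, Matrix.sub_apply, map_sub, smul_sub]
    congr 1
    · rw [Matrix.mul_assoc, mul_map_shiftHom, ← hS, ← map_shiftHom_mul, ← Matrix.mul_assoc,
        mul_apply, mul_apply, map_sum, Finset.smul_sum]
      refine Finset.sum_congr rfl fun z _ => ?_
      rw [quotSer_mul, map_apply, quotSer_quotHom, mul_zero, add_zero, hq, smul_mul_assoc]
    · rw [Matrix.mul_assoc, mul_apply, mul_apply, map_sum, Finset.smul_sum]
      refine Finset.sum_congr rfl fun z _ => ?_
      rw [quotSer_mul, map_apply, quotSer_quotHom, zero_mul, zero_add, twistSer_quotHom, hq',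
        mul_smul_comm]
      -- The row factor depends only on the weight of the row, so it can be moved past `R`.
      by_cases hxz : R x z = 0
      · rw [hxz, map_zero, zero_mul, smul_zero, smul_zero]
      · have := h.weight_eq hR hxz
        rw [← zpow_add₀ h.r0, ← zpow_add₀ h.r0]
        have e : 4 * a.bar * ((m₁ : ℤ) - (z.1 : ℕ)) + 4 * a.bar * ((m₂ : ℤ) - (z.2 : ℕ)) =
            4 * a.bar * ((m₁ : ℤ) - (x.1 : ℕ)) + 4 * a.bar * ((m₂ : ℤ) - (x.2 : ℕ)) := by
          have : ((x.1 : ℕ) : ℤ) + (x.2 : ℕ) = (z.1 : ℕ) + (z.2 : ℕ) := by exact_mod_cast this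
          linear_combination 4 * a.bar * this
        rw [e]
  · have e1 : constSer q ((X * R.map (quotHom F (Shuffle F q))) x y) =
        constSer q (quotHom F _ ((J * R) x y)) := by
      simp only [mul_apply, map_sum, constSer_mul, map_mul, map_apply, hc]
    have e2 : constSer q ((R.map (quotHom F (Shuffle F q)) * Y) x y) =
        constSer q (quotHom F _ ((R * J) x y)) := by
      simp only [mul_apply, map_sum, constSer_mul, map_mul, map_apply, hc']
    rw [Matrix.sub_apply, map_sub, e1, e2, hflip, sub_self]

end IsParam

end Reflection

end FreidelMaillet

end

/-! ### The reflection equation for the fused R-matrices -/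

theorem corollary3p2 {F : Type*} [Field F] [CharZero F] (_hF : ∀ a : F, IsSquare a)
    (q : F) (hq0 : q ≠ 0) (hq : ∀ n : ℕ, 0 < n → q ^ n ≠ 1)
    (r : F) (hr : r ^ 2 = q)
    (s : ℕ → F) (hs : ∀ n : ℕ, s n ^ 2 = FreidelMaillet.qnum q n)
    (m₁ m₂ : ℕ) (hm₁ : 1 ≤ m₁) (hm₂ : 1 ≤ m₂) :
    FreidelMaillet.K1 q r s m₁ m₂ * FreidelMaillet.Rhat q r m₁ m₂ *
        FreidelMaillet.K2 q r s m₁ m₂ * FreidelMaillet.Rquot q r s m₁ m₂ =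
      FreidelMaillet.Rquot q r s m₁ m₂ * FreidelMaillet.K2 q r s m₁ m₂ *
        FreidelMaillet.Rhat q r m₁ m₂ * FreidelMaillet.K1 q r s m₁ m₂ := by
  have h : FreidelMaillet.IsParam q r s := ⟨hq0, hq, hr, hs, two_ne_zero⟩
  obtain ⟨n, rfl⟩ : ∃ n, m₁ = n + 1 := ⟨m₁ - 1, by omega⟩
  obtain ⟨m, rfl⟩ : ∃ m, m₂ = m + 1 := ⟨m₂ - 1, by omega⟩
  have e : FreidelMaillet.Rquot q r s (n + 1) (m + 1) =
      (FreidelMaillet.Rmat q r s (m + 1) (n + 1)).map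
        (FreidelMaillet.quotHom F (FreidelMaillet.Shuffle F q)) :=
    Matrix.ext fun x y => (FreidelMaillet.quotHom_apply _).symm
  rw [e, h.reflection (h.intwT_Rmat n m).1]
  simp only [Matrix.mul_assoc]
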